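/- Let $l\ge 2$ be an integer. Let $B_{X1},B_{X2},\dots$ and $B_{Y1},B_{Y2},\dots$ be independent random variables, each uniform on $\{l-1,l,l+1\}$. Let $X^\infty$ be the random binary sequence whose $i$-th block (maximal run of equal letters) has length $B_{Xi}$ and whose first letter is $0$ or $1$ with probability $1/2$ each, and let $Y^\infty$ be built in the same way from the $B_{Yi}$; the two first letters and all block lengths are independent. Let $X$ and $Y$ be the first $n$ letters of $X^\infty$ and $Y^\infty$, and let $L_n$ be the length of a longest common subsequence of $X$ and $Y$. Given $X$ and $Y$, choose a block of length $l-1$ of $X$ and a block of length $l+1$ of $X$, independently and uniformly among all such blocks, and change the length of both to $l$ (if $X$ lacks a block of one of the two lengths, leave $X$ unchanged). Let $\tilde X$ be the resulting string and $\tilde L_n$ the length of a longest common subsequence of $\tilde X$ and $Y$. An alignment of $X$ and $Y$ is a set of pairs of positions, strictly increasing in both coordinates, that carry equal letters; it is optimal if it has the largest possible number of pairs; it leaves out a block if no letter of that block belongs to an aligned pair. Let $F^n(q)$ be the event that every optimal alignment of $X$ and $Y$ leaves out at most a proportion $q$ of the blocks of $X$ and at most a proportion $q$ of the blocks of $Y$,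 and let $F^{nc}(q)$ be its complement. Let $I=\{l-1,l,l+1\}$, $H(q)=q\ln\frac1q+(1-q)\ln\frac1{1-q}$ and $H(p)=\sum_{i,j\in I}p_{ij}\ln\frac1{p_{ij}}$, where $0\ln\frac10=0$. Theorem. Let $q_0\in[0,\tfrac13)$ and $\varepsilon>0$ be such that the minimum of $$\frac{p_{l-1,l}+p_{l-1,l+1}}{p_{l-1,l-1}+p_{l-1,l}+p_{l-1,l+1}}(1-9q)-\frac{p_{l+1,l+1}}{p_{l+1,l-1}+p_{l+1,l}+p_{l+1,l+1}}(1-3q)-3q$$ over all $q$ and $(p_{ij})_{i,j\in I}$ subject to $$q\in[0,q_0],\qquad \sum_{j}p_{l-1,j}\ge\tfrac12\left(\tfrac13-q_0\right),\qquad \sum_{j}p_{l+1,j}\ge\tfrac12\left(\tfrac13-q_0\right),$$ $$\sum_{i,j\in I}p_{ij}=1,\qquad p_{ij}\ge0\ \text{ for all } i,j\in I,$$ $$2H(q)+(1-4q)\left(\ln\tfrac19+H(p)\right)\ge0$$ equals $2\varepsilon$. Then there is a constant $\beta>0$, not depending on $n$, such that for all sufficiently large $n$ $$\mathrm P\left(\mathrm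 E[\tilde L_n-L_n\mid X,Y]\ge\varepsilon\right)\ \ge\ 1-e^{-n^\beta}-\mathrm P\left(F^{nc}(q_0)\right).$$ -/

import Mathlib

open MeasureTheory ProbabilityTheory Filter

namespace BlockLCS

/-! ### Strings, blocks, common subsequences and alignments -/

/-- The blocks of a binary string: its maximal runs of equal letters, from left to right. -/
def blocks (x : List Bool) : List (List Bool) := x.splitBy (· == ·)

/-- The positions (counted from `0`) of `x` that are occupied by its `k`-th block. -/
def blockPositions (x : List Bool) (k : ℕ) : Finset ℕ :=
  Finset.Ico ((blocks x).take k).flatten.length ((blocks x).take (k + 1)).flatten.length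

/-- The length of a longest common subsequence of `x` and `y`. -/
noncomputable def lcsLength (x y : List Bool) : ℕ :=
  sSup {k | ∃ z : List Bool, z.Sublist x ∧ z.Sublist y ∧ z.length = k}

/-- An alignment with gaps of `x` and `y`, given by its set of aligned pairs of positions: aligned
positions carry the same letter, and the aligned pairs are strictly increasing in both coordinates.
All other letters are aligned with gaps. -/
def IsAlignment (x y : List Bool) (a : Finset (ℕ × ℕ)) : Prop :=
  (∀ p ∈ a, ∃ b : Bool, x[p.1]? = some b ∧ y[p.2]? = some b) ∧
    ∀ p ∈ a, ∀ p' ∈ a, p.1 < p'.1 ↔ p.2 < p'.2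

/-- An alignment that aligns a maximal number of pairs of letters. -/
def IsOptimalAlignment (x y : List Bool) (a : Finset (ℕ × ℕ)) : Prop :=
  IsAlignment x y a ∧ ∀ a' : Finset (ℕ × ℕ), IsAlignment x y a' → a'.card ≤ a.card

/-- The proportion, among all blocks of `x`, of the blocks that are left out when `s` is the set of
positions of `x` that are not aligned with a gap. -/
noncomputable def leftOutProportion (x : List Bool) (s : Finset ℕ) : ℝ :=
  (((Finset.range (blocks x).length).filter fun k => Disjoint (blockPositions x k) s).card : ℝ) /
    ((blocks x).length : ℝ)

/-- Every optimal alignment of `x` and `y` leaves out at most a proportion `q` of the blocks of `x`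
and at most a proportion `q` of the blocks of `y`. -/
def LeavesOutAtMost (x y : List Bool) (q : ℝ) : Prop :=
  ∀ a : Finset (ℕ × ℕ), IsOptimalAlignment x y a →
    leftOutProportion x (a.image Prod.fst) ≤ q ∧ leftOutProportion y (a.image Prod.snd) ≤ q

/-! ### The random modification -/

/-- The length of the `k`-th block of `x` (`0` if there is no such block). -/
def blockLength (x : List Bool) (k : ℕ) : ℕ := ((blocks x).getD k []).length

/-- The pairs `(i, j)` such that the `i`-th block of `x` has length `l - 1` and the `j`-th block of
`x` has length `l + 1`. -/
def choices (l : ℕ) (x : List Bool) : Finset (ℕ × ℕ) :=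
  ((Finset.range (blocks x).length) ×ˢ (Finset.range (blocks x).length)).filter fun c =>
    blockLength x c.1 = l - 1 ∧ blockLength x c.2 = l + 1

/-- Replace the `k`-th block of a list of blocks by a block of the same letter and of length `l`. -/
def resizeBlock (l : ℕ) (bs : List (List Bool)) (k : ℕ) : List (List Bool) :=
  bs.modify k fun b => List.replicate l (b.headD false)

/-- Change the length of the block `c.1` (of length `l - 1`) and of the block `c.2` (of length
`l + 1`) to `l`. A string without such a pair of blocks is left unchanged. -/
def modifyString (l : ℕ) (x : List Bool) (c : ℕ × ℕ) : List Bool :=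
  if c ∈ choices l x then (resizeBlock l (resizeBlock l (blocks x) c.1) c.2).flatten else x

/-! ### The probabilistic model -/

/-- The first `n` letters of the binary sequence with first letter `s` whose successive blocks have
the (positive) lengths `B 0, B 1, B 2, …`; the first `n` blocks contain at least `n` letters. -/
def blockString (s : Bool) (B : ℕ → ℕ) (n : ℕ) : List Bool :=
  ((List.range n).flatMap fun i => List.replicate (B i) (if Even i then s else !s)).take n

/-- The block model with parameter `l`: the block lengths `BX i`, `BY i` are uniform on
`{l - 1, l, l + 1}`, the first letters `sX`, `sY` are uniform, and all of these are independent. -/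
structure IsBlockModel {Ω : Type*} [MeasurableSpace Ω] (μ : Measure Ω) (l : ℕ)
    (sX sY : Ω → Bool) (BX BY : ℕ → Ω → ℕ) : Prop where
  measurable_sX : Measurable sX
  measurable_sY : Measurable sY
  measurable_BX : ∀ i, Measurable (BX i)
  measurable_BY : ∀ i, Measurable (BY i)
  law_sX : ∀ b : Bool, μ {ω | sX ω = b} = 1 / 2
  law_sY : ∀ b : Bool, μ {ω | sY ω = b} = 1 / 2
  law_BX : ∀ i, ∀ k ∈ ({l - 1, l, l + 1} : Finset ℕ), μ {ω | BX i ω = k} = 1 / 3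
  law_BY : ∀ i, ∀ k ∈ ({l - 1, l, l + 1} : Finset ℕ), μ {ω | BY i ω = k} = 1 / 3
  indep_lengths : iIndepFun (Sum.elim BX BY : ℕ ⊕ ℕ → Ω → ℕ) μ
  indep_letters : IndepFun sX sY μ
  indep_letters_lengths :
    IndepFun (fun ω => (sX ω, sY ω)) (fun ω => (fun i => BX i ω, fun i => BY i ω)) μ

/-- Given the random strings `X` and `Y`, the random pair of blocks `C` is uniformly distributed on
the pairs (block of `X` of length `l - 1`, block of `X` of length `l + 1`). -/
structure IsUniformChoice {Ω : Type*} [MeasurableSpace Ω] (μ : Measure Ω) (l : ℕ)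
    (X Y : Ω → List Bool) (C : Ω → ℕ × ℕ) : Prop where
  measurable_choice : Measurable C
  law_choice : ∀ x y : List Bool, ∀ c ∈ choices l x,
    μ {ω | X ω = x ∧ Y ω = y ∧ C ω = c} =
      μ {ω | X ω = x ∧ Y ω = y} / ((choices l x).card : ENNReal)

/-- The σ-algebra generated by the pair of random strings `(X, Y)`. -/
@[reducible] def sigmaXY {Ω : Type*} (X Y : Ω → List Bool) : MeasurableSpace Ω :=
  MeasurableSpace.comap (fun ω => (X ω, Y ω)) ⊤

/-- The conditional expectation, given `X` and `Y`, of the change of the length of the longest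
common subsequence under the random modification of `X` with chosen pair of blocks `C`. -/
noncomputable def expectedChange {Ω : Type*} [MeasurableSpace Ω] (μ : Measure Ω) (l : ℕ)
    (X Y : Ω → List Bool) (C : Ω → ℕ × ℕ) : Ω → ℝ :=
  μ[fun ω => (lcsLength (modifyString l (X ω) (C ω)) (Y ω) : ℝ) - (lcsLength (X ω) (Y ω) : ℝ) |
    sigmaXY X Y]

/-! ### The minimisation problem

A distribution on the pairs of block lengths is `p : Fin 3 → Fin 3 → ℝ`; the indices `0`, `1`, `2`
stand for the lengths `l - 1`, `l`, `l + 1`. -/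

/-- The objective function. -/
noncomputable def objective (p : Fin 3 → Fin 3 → ℝ) (q : ℝ) : ℝ :=
  (p 0 1 + p 0 2) / (p 0 0 + p 0 1 + p 0 2) * (1 - 9 * q)
    - p 2 2 / (p 2 0 + p 2 1 + p 2 2) * (1 - 3 * q) - 3 * q

/-- The entropy `∑ p_ij ln (1 / p_ij)`, with `0 ln (1 / 0) = 0`. -/
noncomputable def entropy (p : Fin 3 → Fin 3 → ℝ) : ℝ :=
  ∑ i, ∑ j, p i j * Real.log (1 / p i j)

/-- The entropy `q ln (1 / q) + (1 - q) ln (1 / (1 - q))`. -/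
noncomputable def entropyTwo (q : ℝ) : ℝ :=
  q * Real.log (1 / q) + (1 - q) * Real.log (1 / (1 - q))

/-- The constraints. -/
structure IsFeasible (q₀ : ℝ) (p : Fin 3 → Fin 3 → ℝ) (q : ℝ) : Prop where
  q_mem : q ∈ Set.Icc 0 q₀
  short_mass : (1 / 3 - q₀) / 2 ≤ ∑ j, p 0 j
  long_mass : (1 / 3 - q₀) / 2 ≤ ∑ j, p 2 j
  nonneg : ∀ i j, 0 ≤ p i j
  total_mass : ∑ i, ∑ j, p i j = 1
  entropy_nonneg : 0 ≤ 2 * entropyTwo q + (1 - 4 * q) * (Real.log (1 / 9) + entropy p)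

/-- The values of the objective function at the feasible points. -/
def feasibleValues (q₀ : ℝ) : Set ℝ :=
  {v | ∃ (p : Fin 3 → Fin 3 → ℝ) (q : ℝ), IsFeasible q₀ p q ∧ objective p q = v}

end BlockLCS

open BlockLCS

/-! Fix one optimal alignment and remember only the number `w i j` of pairs aligned between the
`i`-th block of X and the `j`-th block of Y. A table that respects order, letters and block
capacities (`IsPlan`) can be turned back into an alignment, so the effect of changing block lengths
can be read off from `w`. Lengthening a short block gains a pair if a block aligned with it has a
free letter. Shortening a long block costs at most one pair, and nothing unless all its letters are
aligned. The choice of the two blocks is uniform on a product set, so the mean change is at least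
`inc / S - dec / L`, where `inc` of the `S` short blocks gain and `dec` of the `L` long ones may
lose.

To estimate `inc` and `dec`, let `R` and `R'` be the blocks of X and Y that are not left out, cut
into runs of equal letters; `changes` numbers these runs. An order-preserving alignment of equal
letters can only align blocks in runs with the same number (`IsBlockGraph.changes_eq`). If both runs
are single blocks, these are aligned with each other and with nothing else: `singlePairs`, which
depends on `R` and `R'` alone. Adjacent blocks carry different letters, so a longer run is paid for
by left out blocks. Hence at most a proportion of about `4q` of the blocks lies outside the single
pairs. In a single pair a short block gains when its partner is longer, and a long block can be full
only when its partner has length `l + 1`. Outside the single pairs, optimality keeps full long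
blocks rare: two left out blocks with the same letter in matching gaps could otherwise be aligned.
This produces the objective function at the empirical type distribution `p` of the pairs.

The sets `R`, `R'` depend on the strings, but for fixed `R`, `R'` the pairs form a deterministic
matching, whose lengths are independent and uniform on nine types. The method of types bounds the
probability of given type counts by `exp (N (ln (1/9) + H(p)))`, and the choices of `R` are counted
by the binary entropy. The union bound (`IsBlockModel.measure_entropy_lt_le`) shows that, up to an
exponentially small probability, the entropy constraint holds with a small linear error
simultaneously for all `R`, `R'`. By compactness (`exists_objective_ge`) almost feasible points
still have objective at least `3ε/2`. The remaining `ε/2` absorbs the fluctuations of the block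
counts, controlled by Hoeffding's inequality, and the truncated last blocks. -/

namespace BlockLCS

/-! ### Strings with prescribed block lengths -/

/-- The letter of the `i`-th block of a string that starts with the letter `s`. -/
def letter (s : Bool) (i : ℕ) : Bool := if Even i then s else !s

lemma letter_succ (s : Bool) (i : ℕ) : letter s (i + 1) = !letter s i := by
  unfold letter
  by_cases h : Even i <;> simp [h, Nat.even_add_one]

lemma letter_eq_iff (s : Bool) (i j : ℕ) : letter s i = letter s j ↔ (Even i ↔ Even j) := by
  unfold letter
  by_cases h : Even i <;> by_cases h' : Even j <;> simp [h, h']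

/-- The list of `K` alternating blocks with lengths `f 0, …, f (K - 1)`, the first letter being
`s`. -/
def blockList (s : Bool) (f : ℕ → ℕ) (K : ℕ) : List (List Bool) :=
  (List.range K).map fun i => List.replicate (f i) (letter s i)

@[simp] lemma length_blockList (s : Bool) (f : ℕ → ℕ) (K : ℕ) :
    (blockList s f K).length = K := by simp [blockList]

lemma blockList_succ (s : Bool) (f : ℕ → ℕ) (K : ℕ) :
    blockList s f (K + 1) = blockList s f K ++ [List.replicate (f K) (letter s K)] := by
  simp [blockList, List.range_succ]

lemma length_flatten_blockList (s : Bool) (f : ℕ → ℕ) (K : ℕ) :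
    (blockList s f K).flatten.length = ∑ i ∈ Finset.range K, f i := by
  induction K with
  | zero => simp [blockList]
  | succ K ih => simp only [blockList_succ, List.flatten_append, List.length_append, ih,
      Finset.sum_range_succ]; simp

lemma take_blockList (s : Bool) (f : ℕ → ℕ) {k K : ℕ} (h : k ≤ K) :
    (blockList s f K).take k = blockList s f k := by
  simp [blockList, ← List.map_take, List.take_range, h]

/-- A decomposition into nonempty constant pieces whose neighbors carry different letters is the
decomposition into maximal runs. Positivity of the lengths is essential: an empty block would merge
its neighbors. -/
lemma blocks_flatten_blockList (s : Bool) (f : ℕ → ℕ) (K : ℕ) (hf : ∀ i < K, 0 < f i) :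
    blocks (blockList s f K).flatten = blockList s f K := by
  apply List.splitBy_flatten
  · simp only [blockList, List.mem_map, List.mem_range, not_exists, not_and]
    intro i hi h
    have := hf i hi
    have h2 := congrArg List.length h
    simp at h2; omega
  · intro m hm
    simp only [blockList, List.mem_map, List.mem_range] at hm
    obtain ⟨i, -, rfl⟩ := hm
    apply List.isChain_replicate_of_rel
    simp
  · rw [List.isChain_iff_getElem]
    intro i hi
    simp only [length_blockList] at hi
    have h1 := hf i (by omega)
    have h2 := hf (i + 1) (by omega)
    refine ⟨by simp [blockList]; omega, by simp [blockList]; omega, ?_⟩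
    simp [blockList, letter_succ]

lemma blockPositions_flatten_blockList (s : Bool) (f : ℕ → ℕ) {k K : ℕ} (hf : ∀ i < K, 0 < f i)
    (hk : k < K) : blockPositions (blockList s f K).flatten k =
      Finset.Ico (∑ i ∈ Finset.range k, f i) (∑ i ∈ Finset.range (k + 1), f i) := by
  unfold blockPositions
  rw [blocks_flatten_blockList s f K hf, take_blockList s f hk.le, take_blockList s f hk,
    length_flatten_blockList, length_flatten_blockList]

lemma getElem?_flatten_blockList (s : Bool) (f : ℕ → ℕ) {k K u : ℕ} (hk : k < K)
    (h1 : ∑ i ∈ Finset.range k, f i ≤ u) (h2 : u < ∑ i ∈ Finset.range (k + 1), f i) :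
    (blockList s f K).flatten[u]? = some (letter s k) := by
  induction K with
  | zero => omega
  | succ K ih =>
    rw [blockList_succ, List.flatten_append]
    rcases Nat.lt_succ_iff_lt_or_eq.1 hk with h | rfl
    · rw [List.getElem?_append_left, ih h]
      rw [length_flatten_blockList]
      exact h2.trans_le (Finset.sum_le_sum_of_subset (Finset.range_mono h))
    · rw [List.getElem?_append_right, length_flatten_blockList]
      · rw [Finset.sum_range_succ] at h2
        simp [List.getElem?_replicate]; omega
      · rw [length_flatten_blockList]; exact h1

lemma exists_block_of_lt (f : ℕ → ℕ) {K u : ℕ} (hu : u < ∑ i ∈ Finset.range K, f i) :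
    ∃ k < K, ∑ i ∈ Finset.range k, f i ≤ u ∧ u < ∑ i ∈ Finset.range (k + 1), f i := by
  induction K with
  | zero => simp at hu
  | succ K ih =>
    by_cases h : u < ∑ i ∈ Finset.range K, f i
    · obtain ⟨k, hk, h⟩ := ih h
      exact ⟨k, by omega, h⟩
    · exact ⟨K, by omega, by omega, hu⟩

/-- Cutting at `n` letters shortens only the block that contains the last letter; `f` agrees with
`B` before that block. All later arguments treat this last block separately. -/
lemma blockString_eq_flatten_blockList (s : Bool) (B : ℕ → ℕ) (hB : ∀ i, 0 < B i) {n : ℕ}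
    (hn : 0 < n) : ∃ k f, k < n ∧ (∀ i < k, f i = B i) ∧ 0 < f k ∧ f k ≤ B k ∧
      ∑ i ∈ Finset.range (k + 1), f i = n ∧
      blockString s B n = (blockList s f (k + 1)).flatten := by
  have hsum : n ≤ ∑ i ∈ Finset.range n, B i := by
    calc n = ∑ i ∈ Finset.range n, 1 := by simp
      _ ≤ _ := Finset.sum_le_sum fun i _ => hB i
  -- Block `k` is the one that contains the last letter, at position `n - 1`.
  obtain ⟨k, hk, h1, h2⟩ := exists_block_of_lt B (K := n) (u := n - 1) (by omega)
  have hS : ∑ i ∈ Finset.range k, B i < n := by omega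
  rw [Finset.sum_range_succ] at h2
  have hcongr : ∀ i < k, Function.update B k (n - ∑ i ∈ Finset.range k, B i) i = B i := by
    intro i hi
    rw [Function.update_of_ne hi.ne]
  have hsumk : ∑ i ∈ Finset.range k, Function.update B k (n - ∑ i ∈ Finset.range k, B i) i =
      ∑ i ∈ Finset.range k, B i :=
    Finset.sum_congr rfl fun i hi => hcongr i (Finset.mem_range.1 hi)
  refine ⟨k, Function.update B k (n - ∑ i ∈ Finset.range k, B i), hk, hcongr, by simpa using hS,
    by simp; omega, by rw [Finset.sum_range_succ, hsumk]; simp; omega, ?_⟩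
  have hlist : blockList s (Function.update B k (n - ∑ i ∈ Finset.range k, B i)) k =
      blockList s B k := by
    simp only [blockList]
    apply List.map_congr_left
    intro i hi
    rw [hcongr i (List.mem_range.1 hi)]
  have h3 : blockString s B n = (blockList s B n).flatten.take n := by
    simp only [blockString, blockList, List.flatMap_def]; rfl
  have h4 : (blockList s B n).flatten =
      (blockList s B (k + 1)).flatten ++ ((blockList s B n).drop (k + 1)).flatten := by
    rw [← take_blockList s B hk, ← List.flatten_append, List.take_append_drop]
  rw [h3, h4, List.take_append_of_le_length, blockList_succ, blockList_succ, hlist]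
  · rw [List.flatten_append, List.flatten_append, List.take_append, length_flatten_blockList,
      List.take_of_length_le]
    · simp; omega
    · rw [length_flatten_blockList]; omega
  · rw [length_flatten_blockList, Finset.sum_range_succ]; omega

/-! ### Longest common subsequences and alignments -/

lemma bddAbove_lcs (x y : List Bool) :
    BddAbove {k | ∃ z : List Bool, z.Sublist x ∧ z.Sublist y ∧ z.length = k} := by
  refine ⟨x.length, ?_⟩
  rintro k ⟨z, h, -, rfl⟩
  exact h.length_le

lemma lcsLength_le_length (x y : List Bool) : lcsLength x y ≤ y.length := by
  refine csSup_le (Set.nonempty_of_mem (x := 0) ⟨[], by simp⟩) ?_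
  rintro k ⟨z, -, h, rfl⟩
  exact h.length_le

lemma sublist_ofFn {m : ℕ} {x : List Bool} {v : Fin m → ℕ} (hv : StrictMono v) {b : Fin m → Bool}
    (hb : ∀ k, x[v k]? = some (b k)) : (List.ofFn b).Sublist x := by
  rw [List.sublist_iff_exists_fin_orderEmbedding_get_eq]
  have hx : ∀ k, v k < x.length := fun k => (List.getElem?_eq_some_iff.1 (hb k)).1
  have hmono : StrictMono fun k : Fin (List.ofFn b).length =>
      (⟨v (k.cast List.length_ofFn), hx _⟩ : Fin x.length) := by
    intro k k' h
    exact hv (by simpa using h)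
  refine ⟨OrderEmbedding.ofStrictMono _ hmono, ?_⟩
  intro k
  have := (List.getElem?_eq_some_iff.1 (hb (k.cast List.length_ofFn))).2
  rw [List.get_eq_getElem, List.getElem_ofFn]
  exact this.symm

/-- Reading the aligned letters from left to right gives a common subsequence. -/
lemma IsAlignment.card_le {x y : List Bool} {a : Finset (ℕ × ℕ)} (ha : IsAlignment x y a) :
    a.card ≤ lcsLength x y := by
  obtain ⟨h1, h2⟩ := ha
  have hinj : Set.InjOn Prod.fst (a : Set (ℕ × ℕ)) := by
    intro p hp q hq h
    have e1 := (h2 p hp q hq).not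
    have e2 := (h2 q hq p hp).not
    exact Prod.ext h (by omega)
  have hc : (a.image Prod.fst).card = a.card := Finset.card_image_of_injOn hinj
  let e := (a.image Prod.fst).orderEmbOfFin hc
  have hex : ∀ k, ∃ v, (e k, v) ∈ a := by
    intro k
    obtain ⟨p, hp, hpe⟩ := Finset.mem_image.1 (Finset.orderEmbOfFin_mem _ hc k)
    exact ⟨p.2, by simpa [e, ← hpe] using hp⟩
  choose v hv using hex
  have hvlt : ∀ k k', k < k' → v k < v k' := fun k k' h =>
    (h2 _ (hv k) _ (hv k')).1 (e.strictMono h)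
  choose b hb using fun k => h1 _ (hv k)
  apply le_csSup (bddAbove_lcs x y)
  exact ⟨List.ofFn b, sublist_ofFn e.strictMono fun k => (hb k).1,
    sublist_ofFn (fun k k' h => hvlt k k' h) fun k => (hb k).2, by simp⟩

lemma exists_isAlignment_card_eq (x y : List Bool) :
    ∃ a, IsAlignment x y a ∧ a.card = lcsLength x y := by
  obtain ⟨z, hx, hy, hz⟩ := Nat.sSup_mem (s := {k | ∃ z : List Bool, z.Sublist x ∧ z.Sublist y ∧
    z.length = k}) ⟨0, [], by simp⟩ (bddAbove_lcs x y)
  rw [List.sublist_iff_exists_fin_orderEmbedding_get_eq] at hx hy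
  obtain ⟨e, he⟩ := hx
  obtain ⟨g, hg⟩ := hy
  refine ⟨Finset.univ.image fun k => ((e k : ℕ), (g k : ℕ)), ⟨?_, ?_⟩, ?_⟩
  · intro p hp
    obtain ⟨k, -, rfl⟩ := Finset.mem_image.1 hp
    refine ⟨z.get k, ?_, ?_⟩
    · rw [he]; simp
    · rw [hg]; simp
  · intro p hp p' hp'
    obtain ⟨k, -, rfl⟩ := Finset.mem_image.1 hp
    obtain ⟨k', -, rfl⟩ := Finset.mem_image.1 hp'
    simp only [Fin.val_fin_lt, OrderEmbedding.lt_iff_lt]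
  · rw [Finset.card_image_of_injective]
    · simp only [Finset.card_univ, Fintype.card_fin]; exact hz
    · intro k k' h
      simp only [Prod.mk.injEq, Fin.val_inj] at h
      exact e.injective h.1

lemma IsOptimalAlignment.card_eq {x y : List Bool} {a : Finset (ℕ × ℕ)}
    (ha : IsOptimalAlignment x y a) : a.card = lcsLength x y := by
  obtain ⟨a', h, h'⟩ := exists_isAlignment_card_eq x y
  exact le_antisymm ha.1.card_le (h' ▸ ha.2 a' h)

lemma exists_isOptimalAlignment (x y : List Bool) : ∃ a, IsOptimalAlignment x y a := by
  obtain ⟨a', h, h'⟩ := exists_isAlignment_card_eq x y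
  exact ⟨a', h, fun a ha => h' ▸ ha.card_le⟩

/-! ### Alignments counted block by block -/

/-- A plan records how many pairs of letters are aligned between the `i`-th block of one string and
the `j`-th block of another one. The strings start with the letters `s`, `t` and have `K`, `K'`
blocks of the lengths `f`, `g`. -/
structure IsPlan (s t : Bool) (f g : ℕ → ℕ) (K K' : ℕ) (w : ℕ → ℕ → ℕ) : Prop where
  bound : ∀ i j, w i j ≠ 0 → i < K ∧ j < K'
  color : ∀ i j, w i j ≠ 0 → letter s i = letter t j
  chain : ∀ i j i' j', w i j ≠ 0 → w i' j' ≠ 0 → i < i' → j ≤ j'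
  row : ∀ i < K, ∑ j ∈ Finset.range K', w i j ≤ f i
  col : ∀ j < K', ∑ i ∈ Finset.range K, w i j ≤ g j

lemma sum_range_add_lt (h : ℕ → ℕ) {a b r : ℕ} (hab : a < b) (hr : r < h a) :
    ∑ i ∈ Finset.range a, h i + r < ∑ i ∈ Finset.range b, h i := by
  calc ∑ i ∈ Finset.range a, h i + r < ∑ i ∈ Finset.range (a + 1), h i := by
        rw [Finset.sum_range_succ]; omega
    _ ≤ _ := Finset.sum_le_sum_of_subset (Finset.range_mono hab)

lemma block_mono {f : ℕ → ℕ} {k k' u u' : ℕ} (h1 : ∑ i ∈ Finset.range k, f i ≤ u)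
    (h2' : u' < ∑ i ∈ Finset.range (k' + 1), f i) (hu : u ≤ u') : k ≤ k' := by
  by_contra hne
  have := Finset.sum_le_sum_of_subset (f := f) (Finset.range_mono (by omega : k' + 1 ≤ k))
  omega

lemma eq_of_mem_block {f : ℕ → ℕ} {k k' u : ℕ} (h1 : ∑ i ∈ Finset.range k, f i ≤ u)
    (h2 : u < ∑ i ∈ Finset.range (k + 1), f i) (h1' : ∑ i ∈ Finset.range k', f i ≤ u)
    (h2' : u < ∑ i ∈ Finset.range (k' + 1), f i) : k = k' :=
  le_antisymm (block_mono h1 h2' le_rfl) (block_mono h1' h2 le_rfl)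

/-- Each block hands out its letters to its partner blocks from left to right. The capacity bounds
ensure that enough letters are available, and the chain condition that no two pairs cross. -/
theorem IsPlan.weight_le_lcsLength {s t : Bool} {f g : ℕ → ℕ} {K K' : ℕ} {w : ℕ → ℕ → ℕ}
    (hw : IsPlan s t f g K K' w) :
    ∑ i ∈ Finset.range K, ∑ j ∈ Finset.range K', w i j ≤
      lcsLength (blockList s f K).flatten (blockList t g K').flatten := by
  set T : Finset (Σ _ : ℕ × ℕ, ℕ) :=
    (Finset.range K ×ˢ Finset.range K').sigma fun e => Finset.range (w e.1 e.2) with hT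
  have hTmem : ∀ {i j r}, (⟨(i, j), r⟩ : Σ _ : ℕ × ℕ, ℕ) ∈ T ↔ i < K ∧ j < K' ∧ r < w i j := by
    intro i j r
    simp [hT, and_assoc]
  -- The `r`-th pair of blocks `i`, `j` uses in block `i` the letter after those reserved for the
  -- partners before `j`, and symmetrically in block `j`.
  let cx : (Σ _ : ℕ × ℕ, ℕ) → ℕ := fun e => ∑ k ∈ Finset.range e.1.1, f k +
    (∑ k ∈ Finset.range e.1.2, w e.1.1 k + e.2)
  let cy : (Σ _ : ℕ × ℕ, ℕ) → ℕ := fun e => ∑ k ∈ Finset.range e.1.2, g k +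
    (∑ k ∈ Finset.range e.1.1, w k e.1.2 + e.2)
  have hx : ∀ {i j r}, (⟨(i, j), r⟩ : Σ _ : ℕ × ℕ, ℕ) ∈ T →
      ∑ k ∈ Finset.range j, w i k + r < f i := by
    intro i j r h
    obtain ⟨h1, h2, h3⟩ := hTmem.1 h
    exact (sum_range_add_lt (w i) h2 h3).trans_le (hw.row i h1)
  have hy : ∀ {i j r}, (⟨(i, j), r⟩ : Σ _ : ℕ × ℕ, ℕ) ∈ T →
      ∑ k ∈ Finset.range i, w k j + r < g j := by
    intro i j r h
    obtain ⟨h1, h2, h3⟩ := hTmem.1 h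
    exact (sum_range_add_lt (fun k => w k j) h1 h3).trans_le (hw.col j h2)
  -- Both coordinates increase along the lexicographic order of `(i, j, r)`.
  have key : ∀ {i j r i' j' r'}, (⟨(i, j), r⟩ : Σ _ : ℕ × ℕ, ℕ) ∈ T →
      (⟨(i', j'), r'⟩ : Σ _ : ℕ × ℕ, ℕ) ∈ T →
      (i < i' ∨ i = i' ∧ (j < j' ∨ j = j' ∧ r < r')) →
      cx ⟨(i, j), r⟩ < cx ⟨(i', j'), r'⟩ ∧ cy ⟨(i, j), r⟩ < cy ⟨(i', j'), r'⟩ := by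
    intro i j r i' j' r' h h' hlt
    have hx1 := hx h
    have hy1 := hy h
    obtain ⟨-, -, h3⟩ := hTmem.1 h
    obtain ⟨-, -, h3'⟩ := hTmem.1 h'
    simp only [cx, cy]
    rcases hlt with hi | ⟨rfl, hj | ⟨rfl, hr⟩⟩
    · refine ⟨(sum_range_add_lt f hi hx1).trans_le (by omega), ?_⟩
      rcases (hw.chain i j i' j' (by omega) (by omega) hi).lt_or_eq with hj | rfl
      · exact (sum_range_add_lt g hj hy1).trans_le (by omega)
      -- Both pairs lie in the same block `j`, where the letters are ordered by the partner block.
      · have := sum_range_add_lt (fun k => w k j) hi h3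
        omega
    · refine ⟨?_, (sum_range_add_lt g hj hy1).trans_le (by omega)⟩
      have := sum_range_add_lt (w i) hj h3
      omega
    · constructor <;> omega
  have key' : ∀ {e e'}, e ∈ T → e' ∈ T → e ≠ e' →
      (cx e < cx e' ∧ cy e < cy e') ∨ (cx e' < cx e ∧ cy e' < cy e) := by
    rintro ⟨⟨i, j⟩, r⟩ ⟨⟨i', j'⟩, r'⟩ h h' hne
    have : (i < i' ∨ i = i' ∧ (j < j' ∨ j = j' ∧ r < r')) ∨
        (i' < i ∨ i' = i ∧ (j' < j ∨ j' = j ∧ r' < r)) := by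
      by_contra hcon
      apply hne
      obtain rfl : i = i' := by omega
      obtain rfl : j = j' := by omega
      obtain rfl : r = r' := by omega
      rfl
    exact this.imp (key h h') (key h' h)
  have hcard : (T.image fun e => (cx e, cy e)).card =
      ∑ i ∈ Finset.range K, ∑ j ∈ Finset.range K', w i j := by
    rw [Finset.card_image_of_injOn, hT, Finset.card_sigma, Finset.sum_product]
    · simp
    · intro e he e' he' h
      by_contra hne
      simp only [Prod.mk.injEq] at h
      rcases key' he he' hne with h' | h' <;> omega
  rw [← hcard]
  apply IsAlignment.card_le
  constructor
  · intro p hp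
    obtain ⟨⟨⟨i, j⟩, r⟩, he, rfl⟩ := Finset.mem_image.1 hp
    obtain ⟨h1, h2, h3⟩ := hTmem.1 he
    have hx1 := hx he
    have hy1 := hy he
    refine ⟨letter s i, ?_, ?_⟩
    · apply getElem?_flatten_blockList _ _ h1
      · simp [cx]
      · simp only [cx]; rw [Finset.sum_range_succ]; omega
    · rw [hw.color i j (by omega)]
      apply getElem?_flatten_blockList _ _ h2
      · simp [cy]
      · simp only [cy]; rw [Finset.sum_range_succ]; omega
  · intro p hp p' hp'
    obtain ⟨e, he, rfl⟩ := Finset.mem_image.1 hp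
    obtain ⟨e', he', rfl⟩ := Finset.mem_image.1 hp'
    by_cases hne : e = e'
    · subst hne; simp
    · have := key' he he' hne
      simp only
      omega

/-- The plan counts the aligned pairs in each product of two blocks. The last two conclusions
translate "left out" into a vanishing row or column. -/
theorem exists_isPlan_of_isAlignment {s t : Bool} {f g : ℕ → ℕ} {K K' : ℕ}
    (hf : ∀ i < K, 0 < f i) (hg : ∀ j < K', 0 < g j) {a : Finset (ℕ × ℕ)}
    (ha : IsAlignment (blockList s f K).flatten (blockList t g K').flatten a) :
    ∃ w, IsPlan s t f g K K' w ∧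
      ∑ i ∈ Finset.range K, ∑ j ∈ Finset.range K', w i j = a.card ∧
      (∀ i < K, Disjoint (blockPositions (blockList s f K).flatten i) (a.image Prod.fst) ↔
        ∀ j, w i j = 0) ∧
      (∀ j < K', Disjoint (blockPositions (blockList t g K').flatten j) (a.image Prod.snd) ↔
        ∀ i, w i j = 0) := by
  classical
  -- Each position is sent to the block containing it; positions beyond the end get the irrelevant
  -- value `0`.
  have hex : ∀ (f : ℕ → ℕ) (K u : ℕ), ∃ k, u < ∑ i ∈ Finset.range K, f i →
      k < K ∧ ∑ i ∈ Finset.range k, f i ≤ u ∧ u < ∑ i ∈ Finset.range (k + 1), f i := by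
    intro f K u
    by_cases h : u < ∑ i ∈ Finset.range K, f i
    · obtain ⟨k, hk⟩ := exists_block_of_lt f h
      exact ⟨k, fun _ => hk⟩
    · exact ⟨0, fun h' => absurd h' h⟩
  choose β hβ using hex f K
  choose γ hγ using hex g K'
  have hβ' : ∀ p ∈ a, β p.1 < K ∧ ∑ i ∈ Finset.range (β p.1), f i ≤ p.1 ∧
      p.1 < ∑ i ∈ Finset.range (β p.1 + 1), f i := by
    intro p hp
    obtain ⟨b, h, -⟩ := ha.1 p hp
    have := (List.getElem?_eq_some_iff.1 h).1
    rw [length_flatten_blockList] at this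
    exact hβ _ this
  have hγ' : ∀ p ∈ a, γ p.2 < K' ∧ ∑ i ∈ Finset.range (γ p.2), g i ≤ p.2 ∧
      p.2 < ∑ i ∈ Finset.range (γ p.2 + 1), g i := by
    intro p hp
    obtain ⟨b, -, h⟩ := ha.1 p hp
    have := (List.getElem?_eq_some_iff.1 h).1
    rw [length_flatten_blockList] at this
    exact hγ _ this
  have hinj1 : ∀ p ∈ a, ∀ q ∈ a, p.1 = q.1 → p = q := by
    intro p hp q hq h
    have e1 := ha.2 p hp q hq
    have e2 := ha.2 q hq p hp
    exact Prod.ext h (by omega)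
  have hinj2 : ∀ p ∈ a, ∀ q ∈ a, p.2 = q.2 → p = q := by
    intro p hp q hq h
    have e1 := ha.2 p hp q hq
    have e2 := ha.2 q hq p hp
    exact Prod.ext (by omega) h
  set w : ℕ → ℕ → ℕ := fun i j => (a.filter fun p => β p.1 = i ∧ γ p.2 = j).card with hwdef
  have hwne : ∀ i j, w i j ≠ 0 ↔ ∃ p ∈ a, β p.1 = i ∧ γ p.2 = j := by
    intro i j
    rw [hwdef]
    simp only [ne_eq, Finset.card_eq_zero, Finset.filter_eq_empty_iff, not_forall, not_not,
      exists_prop]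
  have hrow : ∀ i, ∑ j ∈ Finset.range K', w i j = (a.filter fun p => β p.1 = i).card := by
    intro i
    rw [Finset.card_eq_sum_card_fiberwise (f := fun p => γ p.2) (t := Finset.range K')]
    · refine Finset.sum_congr rfl fun j _ => ?_
      rw [hwdef, Finset.filter_filter]
    · intro p hp
      simp only [Finset.coe_filter, Set.mem_ofPred_eq] at hp
      simpa using (hγ' p hp.1).1
  have hcol : ∀ j, ∑ i ∈ Finset.range K, w i j = (a.filter fun p => γ p.2 = j).card := by
    intro j
    rw [Finset.card_eq_sum_card_fiberwise (f := fun p => β p.1) (t := Finset.range K)]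
    · refine Finset.sum_congr rfl fun i _ => ?_
      rw [hwdef, Finset.filter_filter]
      simp only [and_comm]
    · intro p hp
      simp only [Finset.coe_filter, Set.mem_ofPred_eq] at hp
      simpa using (hβ' p hp.1).1
  refine ⟨w, ⟨?_, ?_, ?_, ?_, ?_⟩, ?_, ?_, ?_⟩
  · intro i j h
    obtain ⟨p, hp, rfl, rfl⟩ := (hwne i j).1 h
    exact ⟨(hβ' p hp).1, (hγ' p hp).1⟩
  · intro i j h
    obtain ⟨p, hp, rfl, rfl⟩ := (hwne i j).1 h
    obtain ⟨b, h1, h2⟩ := ha.1 p hp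
    obtain ⟨e1, e2, e3⟩ := hβ' p hp
    obtain ⟨e4, e5, e6⟩ := hγ' p hp
    rw [getElem?_flatten_blockList _ _ e1 e2 e3] at h1
    rw [getElem?_flatten_blockList _ _ e4 e5 e6] at h2
    simpa using h1.trans h2.symm
  · intro i j i' j' h h' hlt
    obtain ⟨p, hp, rfl, rfl⟩ := (hwne i j).1 h
    obtain ⟨q, hq, rfl, rfl⟩ := (hwne i' j').1 h'
    obtain ⟨-, e2, e3⟩ := hβ' p hp
    obtain ⟨-, e2', e3'⟩ := hβ' q hq
    obtain ⟨-, e5, e6⟩ := hγ' p hp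
    obtain ⟨-, e5', e6'⟩ := hγ' q hq
    have : p.1 < q.1 := by
      by_contra hcon
      have := block_mono e2' e3 (by omega : q.1 ≤ p.1)
      omega
    exact block_mono e5 e6' ((ha.2 p hp q hq).1 this).le
  · intro i hi
    rw [hrow]
    calc (a.filter fun p => β p.1 = i).card
        = ((a.filter fun p => β p.1 = i).image Prod.fst).card := by
          rw [Finset.card_image_of_injOn]
          intro p hp q hq h
          simp only [Finset.coe_filter, Set.mem_ofPred_eq] at hp hq
          exact hinj1 p hp.1 q hq.1 h
      _ ≤ (Finset.Ico (∑ k ∈ Finset.range i, f k) (∑ k ∈ Finset.range (i + 1), f k)).card := by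
          apply Finset.card_le_card
          intro u hu
          obtain ⟨p, hp, rfl⟩ := Finset.mem_image.1 hu
          obtain ⟨hp', rfl⟩ := Finset.mem_filter.1 hp
          exact Finset.mem_Ico.2 (hβ' p hp').2
      _ = f i := by rw [Nat.card_Ico, Finset.sum_range_succ]; omega
  · intro j hj
    rw [hcol]
    calc (a.filter fun p => γ p.2 = j).card
        = ((a.filter fun p => γ p.2 = j).image Prod.snd).card := by
          rw [Finset.card_image_of_injOn]
          intro p hp q hq h
          simp only [Finset.coe_filter, Set.mem_ofPred_eq] at hp hq
          exact hinj2 p hp.1 q hq.1 h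
      _ ≤ (Finset.Ico (∑ k ∈ Finset.range j, g k) (∑ k ∈ Finset.range (j + 1), g k)).card := by
          apply Finset.card_le_card
          intro u hu
          obtain ⟨p, hp, rfl⟩ := Finset.mem_image.1 hu
          obtain ⟨hp', rfl⟩ := Finset.mem_filter.1 hp
          exact Finset.mem_Ico.2 (hγ' p hp').2
      _ = g j := by rw [Nat.card_Ico, Finset.sum_range_succ]; omega
  · simp only [hrow]
    rw [Finset.card_eq_sum_card_fiberwise (f := fun p => β p.1) (t := Finset.range K)]
    intro p hp
    simpa using (hβ' p hp).1
  · intro i hi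
    rw [blockPositions_flatten_blockList s f hf hi, Finset.disjoint_right]
    constructor
    · intro h j
      by_contra hne
      obtain ⟨p, hp, rfl, rfl⟩ := (hwne i j).1 hne
      exact h (Finset.mem_image_of_mem _ hp) (Finset.mem_Ico.2 (hβ' p hp).2)
    · intro h u hu hu'
      obtain ⟨p, hp, rfl⟩ := Finset.mem_image.1 hu
      rw [Finset.mem_Ico] at hu'
      refine (hwne i (γ p.2)).2 ⟨p, hp, ?_, rfl⟩ (h _)
      exact eq_of_mem_block (hβ' p hp).2.1 (hβ' p hp).2.2 hu'.1 hu'.2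
  · intro j hj
    rw [blockPositions_flatten_blockList t g hg hj, Finset.disjoint_right]
    constructor
    · intro h i
      by_contra hne
      obtain ⟨p, hp, rfl, rfl⟩ := (hwne i j).1 hne
      exact h (Finset.mem_image_of_mem _ hp) (Finset.mem_Ico.2 (hγ' p hp).2)
    · intro h u hu hu'
      obtain ⟨p, hp, rfl⟩ := Finset.mem_image.1 hu
      rw [Finset.mem_Ico] at hu'
      refine (hwne (β p.1) j).2 ⟨p, hp, rfl, ?_⟩ (h _)
      exact eq_of_mem_block (hγ' p hp).2.1 (hγ' p hp).2.2 hu'.1 hu'.2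

/-! ### Blocks that are aligned one to one -/

/-- The number of changes of parity between consecutive elements of `R` up to `i`. -/
def changes (R : Finset ℕ) (i : ℕ) : ℕ :=
  (R.filter fun k => k ≤ i ∧
    ∃ k' ∈ R, k' < k ∧ (∀ m ∈ R, m < k → m ≤ k') ∧ ¬ (Even k' ↔ Even k)).card

lemma changes_mono (R : Finset ℕ) : Monotone (changes R) := by
  intro i i' h
  apply Finset.card_le_card
  intro k hk
  simp only [Finset.mem_filter] at hk ⊢
  exact ⟨hk.1, hk.2.1.trans h, hk.2.2⟩

lemma changes_of_isLeast {R : Finset ℕ} {i : ℕ} (h : ∀ k ∈ R, i ≤ k) : changes R i = 0 := by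
  simp only [changes, Finset.card_eq_zero, Finset.filter_eq_empty_iff]
  rintro k hk ⟨h1, k', hk', h2, -⟩
  have := h k' hk'
  omega

/-- The recursion for `changes`: passing from an element of `R` to the next one counts a change
exactly when the two blocks carry different letters, that is, when the parities differ. -/
lemma changes_of_pred {R : Finset ℕ} {k i : ℕ} (hk : k ∈ R) (hi : i ∈ R) (hki : k < i)
    (hpred : ∀ m ∈ R, m < i → m ≤ k) :
    changes R i = changes R k + if (Even k ↔ Even i) then 0 else 1 := by
  have key : ∀ m, (m ∈ R.filter fun m => m ≤ i ∧
      ∃ k' ∈ R, k' < m ∧ (∀ m' ∈ R, m' < m → m' ≤ k') ∧ ¬ (Even k' ↔ Even m)) ↔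
      (m ∈ R.filter fun m => m ≤ k ∧
      ∃ k' ∈ R, k' < m ∧ (∀ m' ∈ R, m' < m → m' ≤ k') ∧ ¬ (Even k' ↔ Even m)) ∨
        (m = i ∧ ¬ (Even k ↔ Even i)) := by
    intro m
    simp only [Finset.mem_filter]
    constructor
    · rintro ⟨h1, h2, k', h3, h4, h5, h6⟩
      rcases h2.lt_or_eq with h | rfl
      · exact Or.inl ⟨h1, hpred m h1 h, k', h3, h4, h5, h6⟩
      · obtain rfl : k = k' := le_antisymm (h5 k hk hki) (hpred k' h3 h4)
        exact Or.inr ⟨rfl, h6⟩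
    · rintro (⟨h1, h2, h3⟩ | ⟨rfl, h⟩)
      · exact ⟨h1, h2.trans hki.le, h3⟩
      · exact ⟨hi, le_rfl, k, hk, hki, hpred, h⟩
  by_cases hpar : Even k ↔ Even i
  · rw [if_pos hpar, add_zero]
    unfold changes
    congr 1
    ext m
    rw [key]
    tauto
  · rw [if_neg hpar]
    unfold changes
    rw [← Finset.card_insert_of_notMem (a := i)]
    · congr 1
      ext m
      rw [key, Finset.mem_insert]
      tauto
    · simp only [Finset.mem_filter]
      omega

lemma exists_pred {R : Finset ℕ} {i k : ℕ} (hk : k ∈ R) (hki : k < i) :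
    ∃ p ∈ R, p < i ∧ (∀ m ∈ R, m < i → m ≤ p) ∧ k ≤ p := by
  have hne : (R.filter (· < i)).Nonempty := ⟨k, Finset.mem_filter.2 ⟨hk, hki⟩⟩
  have hmem := Finset.mem_filter.1 (Finset.max'_mem _ hne)
  have hle : ∀ m ∈ R, m < i → m ≤ (R.filter (· < i)).max' hne := fun m hm hmi =>
    Finset.le_max' _ _ (Finset.mem_filter.2 ⟨hm, hmi⟩)
  exact ⟨_, hmem.1, hmem.2, hle, hle k hk hki⟩

lemma exists_next {R : Finset ℕ} {i k : ℕ} (hk : k ∈ R) (hki : i < k) :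
    ∃ p ∈ R, i < p ∧ (∀ m ∈ R, i < m → p ≤ m) ∧ p ≤ k := by
  have hne : (R.filter (i < ·)).Nonempty := ⟨k, Finset.mem_filter.2 ⟨hk, hki⟩⟩
  have hmem := Finset.mem_filter.1 (Finset.min'_mem _ hne)
  have hle : ∀ m ∈ R, i < m → (R.filter (i < ·)).min' hne ≤ m := fun m hm hmi =>
    Finset.min'_le _ _ (Finset.mem_filter.2 ⟨hm, hmi⟩)
  exact ⟨_, hmem.1, hmem.2, hle, hle k hk hki⟩

lemma changes_lt_changes_succ {R : Finset ℕ} {i : ℕ} (hi : i ∈ R) (hi' : i + 1 ∈ R) :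
    changes R i < changes R (i + 1) := by
  rw [changes_of_pred hi hi' (by omega) (fun m _ h => by omega)]
  have : ¬ (Even i ↔ Even (i + 1)) := by rw [Nat.even_add_one]; tauto
  rw [if_neg this]
  omega

/-- Adjacent blocks carry different letters, so if block `i + 1` were used, the count would increase
strictly before `i'`. Thus each run of several used blocks contains left out blocks. -/
lemma succ_notMem_of_changes_eq {R : Finset ℕ} {i i' : ℕ} (hi : i ∈ R)
    (hlt : i < i') (h : changes R i = changes R i') : i + 1 ∉ R := by
  intro h'
  have := changes_lt_changes_succ hi h'
  have := changes_mono R (Nat.succ_le_of_lt hlt)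
  simp only [Nat.succ_eq_add_one] at this
  omega

lemma pred_notMem_of_changes_eq {R : Finset ℕ} {i i' : ℕ} (hi' : i' ∈ R)
    (hlt : i < i') (h : changes R i = changes R i') : i' - 1 ∉ R := by
  intro h'
  obtain ⟨k, rfl⟩ : ∃ k, i' = k + 1 := ⟨i' - 1, by omega⟩
  have := changes_lt_changes_succ h' hi'
  have := changes_mono R (Nat.le_of_lt_succ hlt)
  simp only [Nat.add_sub_cancel] at *
  omega

/-- The elements of `R` that share their number of changes with another element are at most twice
as many as the elements that are missing in `R`. -/
lemma card_filter_changes_eq_le {R : Finset ℕ} {K : ℕ} (hR : R ⊆ Finset.range K) :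
    (R.filter fun i => ∃ i' ∈ R, i' ≠ i ∧ changes R i' = changes R i).card ≤
      2 * (Finset.range K \ R).card := by
  have h1 : (R.filter fun i => i + 1 < K ∧ i + 1 ∉ R).card ≤ (Finset.range K \ R).card := by
    apply Finset.card_le_card_of_injOn (· + 1)
    · intro i hi
      simp only [Finset.coe_filter, Set.mem_ofPred_eq] at hi
      simp [hi.2]
    · intro i _ i' _ h
      simpa using h
  have h2 : (R.filter fun i => 0 < i ∧ i - 1 ∉ R).card ≤ (Finset.range K \ R).card := by
    apply Finset.card_le_card_of_injOn (· - 1)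
    · intro i hi
      simp only [Finset.coe_filter, Set.mem_ofPred_eq] at hi
      have := Finset.mem_range.1 (hR hi.1)
      simp only [Finset.coe_sdiff, Finset.coe_range, Set.mem_sdiff, Set.mem_Iio, Finset.mem_coe]
      exact ⟨by omega, hi.2.2⟩
    · intro i hi i' hi' h
      simp only [Finset.coe_filter, Set.mem_ofPred_eq] at hi hi' h
      omega
  -- An element that shares its run has a missing neighbor on the side of the other element. Each
  -- missing block is the right neighbor of at most one element and the left neighbor of at most
  -- one.
  calc _ ≤ ((R.filter fun i => i + 1 < K ∧ i + 1 ∉ R) ∪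
        (R.filter fun i => 0 < i ∧ i - 1 ∉ R)).card := by
        apply Finset.card_le_card
        intro i hi
        obtain ⟨hi, i', hi', hne, h⟩ := Finset.mem_filter.1 hi
        rw [Finset.mem_union, Finset.mem_filter, Finset.mem_filter]
        have := Finset.mem_range.1 (hR hi')
        rcases Nat.lt_or_gt_of_ne hne with hlt | hlt
        · exact Or.inr ⟨hi, by omega, pred_notMem_of_changes_eq hi hlt h⟩
        · exact Or.inl ⟨hi, by omega, succ_notMem_of_changes_eq hi hlt h.symm⟩
    _ ≤ _ := (Finset.card_union_le _ _).trans (by omega)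

/-- The pairs of blocks, among the blocks that are not left out, that have to be aligned one to
one. -/
def singlePairs (R R' : Finset ℕ) : Finset (ℕ × ℕ) :=
  (R ×ˢ R').filter fun e => changes R e.1 = changes R' e.2 ∧
    (∀ i ∈ R, changes R i = changes R e.1 → i = e.1) ∧
    ∀ j ∈ R', changes R' j = changes R' e.2 → j = e.2

lemma fst_injOn_singlePairs {R R' : Finset ℕ} {e e' : ℕ × ℕ} (he : e ∈ singlePairs R R')
    (he' : e' ∈ singlePairs R R') (h : e.1 = e'.1) : e = e' := by
  simp only [singlePairs, Finset.mem_filter, Finset.mem_product] at he he'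
  refine Prod.ext h (he'.2.2.2 _ he.1.2 ?_)
  rw [← he.2.1, ← he'.2.1, h]

lemma snd_injOn_singlePairs {R R' : Finset ℕ} {e e' : ℕ × ℕ} (he : e ∈ singlePairs R R')
    (he' : e' ∈ singlePairs R R') (h : e.2 = e'.2) : e = e' := by
  simp only [singlePairs, Finset.mem_filter, Finset.mem_product] at he he'
  refine Prod.ext (he'.2.2.1 _ he.1.1 ?_) h
  rw [he.2.1, he'.2.1, h]

/-- The relation "some letters of the two blocks are aligned" of an alignment; `R` and `R'` are the
sets of the blocks that are not left out. -/
structure IsBlockGraph (s t : Bool) (R R' : Finset ℕ) (E : ℕ → ℕ → Prop) : Prop where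
  chain : ∀ {i j i' j'}, E i j → E i' j' → i < i' → j ≤ j'
  color : ∀ {i j}, E i j → letter s i = letter t j
  left : ∀ {i}, i ∈ R ↔ ∃ j, E i j
  right : ∀ {j}, j ∈ R' ↔ ∃ i, E i j

/-! ### Runs of used blocks correspond to each other under an alignment -/

namespace IsBlockGraph

variable {s t : Bool} {R R' : Finset ℕ} {E : ℕ → ℕ → Prop}

lemma chain' (h : IsBlockGraph s t R R' E) {i j i' j' : ℕ} (h1 : E i j) (h2 : E i' j')
    (hlt : j < j') : i ≤ i' := by
  by_contra hcon
  have := h.chain h2 h1 (by omega)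
  omega

/-- Induction along the edges from left to right. Before every edge but the first there is an edge
obtained by stepping back to the preceding used block in one or both strings. Edges join equal
letters, so a one-sided step changes no letter and a two-sided step changes both letters or none. -/
lemma changes_eq_aux (h : IsBlockGraph s t R R' E) (n : ℕ) : ∀ i j, i + j = n → E i j →
    changes R i = changes R' j := by
  induction n using Nat.strong_induction_on with
  | _ n ih =>
    rintro i j rfl hE
    have hi : i ∈ R := h.left.2 ⟨j, hE⟩
    have hj : j ∈ R' := h.right.2 ⟨i, hE⟩
    have hup : ∀ k, k < i → (∀ m ∈ R, m < i → m ≤ k) → E k j → changes R i = changes R' j := by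
      intro k hk hpred hEk
      have hkR : k ∈ R := h.left.2 ⟨j, hEk⟩
      have hp : Even k ↔ Even i :=
        (letter_eq_iff s k i).1 ((h.color hEk).trans (h.color hE).symm)
      rw [changes_of_pred hkR hi hk hpred, if_pos hp, add_zero]
      exact ih _ (by omega) k j rfl hEk
    have hleft : ∀ k, k < j → (∀ m ∈ R', m < j → m ≤ k) → E i k →
        changes R i = changes R' j := by
      intro k hk hpred hEk
      have hkR : k ∈ R' := h.right.2 ⟨i, hEk⟩
      have hp : Even k ↔ Even j :=
        (letter_eq_iff t k j).1 ((h.color hEk).symm.trans (h.color hE))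
      rw [changes_of_pred hkR hj hk hpred, if_pos hp, add_zero]
      exact ih _ (by omega) i k rfl hEk
    by_cases hpi : ∃ k ∈ R, k < i
    · obtain ⟨k, hk, hki⟩ := hpi
      obtain ⟨p, hpR, hpi, hpred, -⟩ := exists_pred hk hki
      obtain ⟨j', hj'⟩ := h.left.1 hpR
      have hjj' := h.chain hj' hE hpi
      rcases hjj'.lt_or_eq with hlt | rfl
      · obtain ⟨p', hpR', hpj', hpred', hjp'⟩ := exists_pred (h.right.2 ⟨p, hj'⟩) hlt
        obtain ⟨i', hi'⟩ := h.right.1 hpR'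
        have hii' := h.chain' hi' hE hpj'
        rcases hii'.lt_or_eq with hlt' | rfl
        · have hip := hpred i' (h.left.2 ⟨p', hi'⟩) hlt'
          -- The edges `p`–`j'` and `i'`–`p'` satisfy `j' ≤ p'` and `i' ≤ p`; were both inequalities
          -- strict, the edges would violate the chain condition.
          have hEpp : E p p' := by
            rcases hip.lt_or_eq with h' | rfl
            · obtain rfl : p' = j' := le_antisymm (h.chain hi' hj' h') hjp'
              exact hj'
            · exact hi'
          rw [changes_of_pred hpR hi hpi hpred, changes_of_pred hpR' hj hpj' hpred',
            ih _ (by omega) p p' rfl hEpp]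
          have hpar : (Even p ↔ Even i) ↔ (Even p' ↔ Even j) := by
            rw [← letter_eq_iff s p i, ← letter_eq_iff t p' j, h.color hEpp, h.color hE]
          simp only [hpar]
        · exact hleft p' hpj' hpred' hi'
      · exact hup p hpi hpred hj'
    · push Not at hpi
      by_cases hpj : ∃ k ∈ R', k < j
      · obtain ⟨k, hk, hkj⟩ := hpj
        obtain ⟨p', hpR', hpj', hpred', -⟩ := exists_pred hk hkj
        obtain ⟨i', hi'⟩ := h.right.1 hpR'
        have hii' := h.chain' hi' hE hpj'
        obtain rfl : i' = i := le_antisymm hii' (hpi i' (h.left.2 ⟨p', hi'⟩))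
        exact hleft p' hpj' hpred' hi'
      · push Not at hpj
        rw [changes_of_isLeast hpi, changes_of_isLeast hpj]

lemma changes_eq (h : IsBlockGraph s t R R' E) {i j : ℕ} (hE : E i j) :
    changes R i = changes R' j := h.changes_eq_aux _ i j rfl hE

lemma eq_left_of_single (h : IsBlockGraph s t R R' E) {i j i' : ℕ}
    (hs : (i, j) ∈ singlePairs R R') (hE : E i' j) : i' = i := by
  simp only [singlePairs, Finset.mem_filter, Finset.mem_product] at hs
  exact hs.2.2.1 i' (h.left.2 ⟨j, hE⟩) ((h.changes_eq hE).trans hs.2.1.symm)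

lemma eq_right_of_single (h : IsBlockGraph s t R R' E) {i j j' : ℕ}
    (hs : (i, j) ∈ singlePairs R R') (hE : E i j') : j' = j := by
  simp only [singlePairs, Finset.mem_filter, Finset.mem_product] at hs
  exact hs.2.2.2 j' (h.right.2 ⟨i, hE⟩) ((h.changes_eq hE).symm.trans hs.2.1)

/-- Single pairs are defined by `R` and `R'` alone, yet they are edges of every block graph with
these used blocks. This is why the union bound need only run over `R` and `R'`, not over alignments.
-/
lemma rel_of_single (h : IsBlockGraph s t R R' E) {i j : ℕ}
    (hs : (i, j) ∈ singlePairs R R') : E i j := by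
  have hi : i ∈ R := by
    simp only [singlePairs, Finset.mem_filter, Finset.mem_product] at hs
    exact hs.1.1
  obtain ⟨j', hE⟩ := h.left.1 hi
  rwa [h.eq_right_of_single hs hE] at hE

/-- A block of the first string shares its number of changes with another one, or belongs to a
single pair, or is aligned with two blocks that are aligned with no other block. -/
lemma trichotomy (h : IsBlockGraph s t R R' E) {i : ℕ} (hi : i ∈ R) :
    (∃ i' ∈ R, i' ≠ i ∧ changes R i' = changes R i) ∨ (∃ j, (i, j) ∈ singlePairs R R') ∨
      ∃ j j', j ≠ j' ∧ E i j ∧ E i j' ∧ (∀ i', E i' j → i' = i) ∧ ∀ i', E i' j' → i' = i := by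
  by_cases h1 : ∃ i' ∈ R, i' ≠ i ∧ changes R i' = changes R i
  · exact Or.inl h1
  right
  push Not at h1
  have hi1 : ∀ i' ∈ R, changes R i' = changes R i → i' = i := fun i' hi' he => by
    by_contra hne
    exact h1 i' hi' hne he
  obtain ⟨j, hE⟩ := h.left.1 hi
  have hcls : ∀ j', changes R' j' = changes R' j → ∀ i', E i' j' → i' = i := fun j' hc i' hE' =>
    hi1 i' (h.left.2 ⟨j', hE'⟩) (by rw [h.changes_eq hE', hc, h.changes_eq hE])
  by_cases h2 : ∃ j' ∈ R', j' ≠ j ∧ changes R' j' = changes R' j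
  · obtain ⟨j', hj', hne, hc⟩ := h2
    obtain ⟨i', hE'⟩ := h.right.1 hj'
    obtain rfl := hcls j' hc i' hE'
    exact Or.inr ⟨j, j', hne.symm, hE, hE', hcls j rfl, hcls j' hc⟩
  · push Not at h2
    refine Or.inl ⟨j, ?_⟩
    simp only [singlePairs, Finset.mem_filter, Finset.mem_product]
    refine ⟨⟨hi, h.right.2 ⟨i, hE⟩⟩, h.changes_eq hE, hi1, fun j' hj' he => ?_⟩
    by_contra hne
    exact h2 j' hj' hne he

/-- The number of blocks that are aligned with two blocks is at most the number of left out blocks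
of the other string. -/
lemma card_two_neighbors_le (h : IsBlockGraph s t R R' E) {K' : ℕ} (hR' : R' ⊆ Finset.range K')
    (A : Finset ℕ) (hA : ∀ i ∈ A, ∃ j j', j ≠ j' ∧ E i j ∧ E i j') :
    A.card ≤ (Finset.range K' \ R').card := by
  have hA' : ∀ i, ∃ j j', i ∈ A → j < j' ∧ E i j ∧ E i j' := by
    intro i
    by_cases hi : i ∈ A
    · obtain ⟨j, j', hne, h1, h2⟩ := hA i hi
      rcases Nat.lt_or_gt_of_ne hne with hlt | hlt
      · exact ⟨j, j', fun _ => ⟨hlt, h1, h2⟩⟩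
      · exact ⟨j', j, fun _ => ⟨hlt, h2, h1⟩⟩
    · exact ⟨0, 0, fun h' => absurd h' hi⟩
  choose u v huv using hA'
  -- Two neighbors `u i < v i` of the same block lie in one run, so block `u i + 1` is left out. For
  -- different `i` these blocks differ, since `v i ≤ u i'` whenever `i < i'`.
  apply Finset.card_le_card_of_injOn (fun i => u i + 1)
  · intro i hi
    obtain ⟨hlt, h1, h2⟩ := huv i hi
    have := Finset.mem_range.1 (hR' (h.right.2 ⟨i, h2⟩))
    simp only [Finset.coe_sdiff, Finset.coe_range, Set.mem_sdiff, Set.mem_Iio, Finset.mem_coe]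
    exact ⟨by omega, succ_notMem_of_changes_eq (h.right.2 ⟨i, h1⟩) hlt
      ((h.changes_eq h1).symm.trans (h.changes_eq h2))⟩
  · have key : ∀ i ∈ A, ∀ i' ∈ A, u i = u i' → ¬ i < i' := by
      intro i hi i' hi' he hlt
      obtain ⟨hlt1, h1, h2⟩ := huv i hi
      obtain ⟨hlt2, h3, h4⟩ := huv i' hi'
      have := h.chain h2 h3 hlt
      omega
    intro i hi i' hi' he
    have he' : u i = u i' := by simpa using he
    have := key i hi i' hi' he'
    have := key i' hi' i hi he'.symm
    omega

/-- If no pair of blocks can be added to the block graph, then two blocks that are aligned with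
each other only form a single pair. -/
lemma mem_singlePairs_of_maximal (h : IsBlockGraph s t R R' E)
    (hmax : ∀ u v, u ∉ R → v ∉ R' → (∃ i ∈ R, u < i) → (∃ j ∈ R', v < j) →
      letter s u = letter t v → ∃ i j, E i j ∧ ((i < u ∧ v < j) ∨ (u < i ∧ j < v)))
    {i j : ℕ} (hE : E i j) (hi : ∀ j', E i j' → j' = j) (hj : ∀ i', E i' j → i' = i) :
    (i, j) ∈ singlePairs R R' := by
  have hiR : i ∈ R := h.left.2 ⟨j, hE⟩
  have hjR : j ∈ R' := h.right.2 ⟨i, hE⟩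
  have hmain : ∀ i' ∈ R, changes R i' = changes R i → i' = i := by
    intro i' hi' hc
    by_contra hne
    rcases Nat.lt_or_gt_of_ne hne with hlt | hlt
    -- Take the preceding edge `p`–`q` in the same run. Blocks `p + 1` and `q + 1` are left out,
    -- carry the same letter, and lie strictly between the consecutive edges `p`–`q` and `i`–`j`.
    · obtain ⟨p, hpR, hpi, hpred, hip⟩ := exists_pred hi' hlt
      have hcp : changes R p = changes R i :=
        le_antisymm (changes_mono R hpi.le) (hc ▸ changes_mono R hip)
      obtain ⟨b, hb⟩ := h.left.1 hpR
      have hbj : b < j := lt_of_le_of_ne (h.chain hb hE hpi) (by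
        rintro rfl
        exact hpi.ne (hj p hb))
      obtain ⟨q, hqR, hqj, hqred, hbq⟩ := exists_pred (h.right.2 ⟨p, hb⟩) hbj
      obtain ⟨a, ha⟩ := h.right.1 hqR
      have hai : a < i := lt_of_le_of_ne (h.chain' ha hE hqj) (by
        rintro rfl
        exact hqj.ne (hi q ha))
      have hap := hpred a (h.left.2 ⟨q, ha⟩) hai
      have hpq : E p q := by
        rcases hap.lt_or_eq with h' | rfl
        · obtain rfl : q = b := le_antisymm (h.chain ha hb h') hbq
          exact hb
        · exact ha
      have hp1 : p + 1 ∉ R := succ_notMem_of_changes_eq hpR hpi hcp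
      have hq1 : q + 1 ∉ R' := succ_notMem_of_changes_eq hqR hqj
        (by rw [← h.changes_eq hpq, ← h.changes_eq hE, hcp])
      have hp2 : p + 1 < i := lt_of_le_of_ne hpi (by rintro rfl; exact hp1 hiR)
      have hq2 : q + 1 < j := lt_of_le_of_ne hqj (by rintro rfl; exact hq1 hjR)
      -- Maximality would need an edge that separates `p + 1` from `q + 1`, but no edge can pass
      -- between two consecutive ones.
      obtain ⟨u, v, huv, h1 | h1⟩ := hmax (p + 1) (q + 1) hp1 hq1 ⟨i, hiR, hp2⟩ ⟨j, hjR, hq2⟩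
        (by rw [letter_succ, letter_succ, h.color hpq])
      · have hvj : v < j := lt_of_le_of_ne (h.chain huv hE (by omega)) (by
          rintro rfl
          have := hj u huv
          omega)
        have := hqred v (h.right.2 ⟨u, huv⟩) hvj
        omega
      · have hui : i ≤ u := by
          by_contra hcon
          have := hpred u (h.left.2 ⟨v, huv⟩) (by omega)
          omega
        rcases hui.lt_or_eq with h' | rfl
        · have := h.chain hE huv h'
          omega
        · have := hi v huv
          omega
    -- The mirror image, with the next edge in place of the preceding one.
    · obtain ⟨p, hpR, hpi, hpred, hip⟩ := exists_next hi' hlt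
      have hcp : changes R p = changes R i :=
        le_antisymm (hc ▸ changes_mono R hip) (changes_mono R hpi.le)
      obtain ⟨b, hb⟩ := h.left.1 hpR
      have hbj : j < b := lt_of_le_of_ne (h.chain hE hb hpi) (by
        rintro rfl
        exact hpi.ne (hj p hb).symm)
      obtain ⟨q, hqR, hqj, hqred, hbq⟩ := exists_next (h.right.2 ⟨p, hb⟩) hbj
      obtain ⟨a, ha⟩ := h.right.1 hqR
      have hai : i < a := lt_of_le_of_ne (h.chain' hE ha hqj) (by
        rintro rfl
        exact hqj.ne (hi q ha).symm)
      have hap := hpred a (h.left.2 ⟨q, ha⟩) hai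
      have hpq : E p q := by
        rcases hap.lt_or_eq with h' | rfl
        · obtain rfl : q = b := le_antisymm hbq (h.chain hb ha h')
          exact hb
        · exact ha
      have hp1 : i + 1 ∉ R := succ_notMem_of_changes_eq hiR hpi hcp.symm
      have hq1 : j + 1 ∉ R' := succ_notMem_of_changes_eq hjR hqj
        (by rw [← h.changes_eq hpq, ← h.changes_eq hE, hcp])
      have hp2 : i + 1 < p := lt_of_le_of_ne hpi (by rintro rfl; exact hp1 hpR)
      have hq2 : j + 1 < q := lt_of_le_of_ne hqj (by rintro rfl; exact hq1 hqR)
      obtain ⟨u, v, huv, h1 | h1⟩ := hmax (i + 1) (j + 1) hp1 hq1 ⟨p, hpR, hp2⟩ ⟨q, hqR, hq2⟩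
        (by rw [letter_succ, letter_succ, h.color hE])
      · rcases (by omega : u ≤ i).lt_or_eq with h' | rfl
        · have := h.chain huv hE h'
          omega
        · have := hi v huv
          omega
      · have hvj : j < v := lt_of_le_of_ne (h.chain hE huv (by omega)) (by
          rintro rfl
          have := hj u huv
          omega)
        have := hqred v (h.right.2 ⟨u, huv⟩) hvj
        omega
  simp only [singlePairs, Finset.mem_filter, Finset.mem_product]
  refine ⟨⟨hiR, hjR⟩, h.changes_eq hE, hmain, fun j' hj' hc => ?_⟩
  obtain ⟨i', hE'⟩ := h.right.1 hj'
  obtain rfl := hmain i' (h.left.2 ⟨j', hE'⟩) (by rw [h.changes_eq hE', hc, h.changes_eq hE])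
  exact hi j' hE'

end IsBlockGraph

/-! ### Changing the length of a block -/

/-- The total number of pairs of a plan. -/
def weight (K K' : ℕ) (w : ℕ → ℕ → ℕ) : ℕ :=
  ∑ i ∈ Finset.range K, ∑ j ∈ Finset.range K', w i j

/-- Some letter of a block aligned with the `i`-th block is free. -/
def HasFreeNeighbor (g : ℕ → ℕ) (K : ℕ) (w : ℕ → ℕ → ℕ) (i : ℕ) : Prop :=
  ∃ j, w i j ≠ 0 ∧ ∑ i' ∈ Finset.range K, w i' j < g j

/-- All letters of the `i`-th block are aligned. -/
def IsFull (f : ℕ → ℕ) (K' : ℕ) (w : ℕ → ℕ → ℕ) (i : ℕ) : Prop :=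
  ∑ j ∈ Finset.range K', w i j = f i

namespace IsPlan

variable {s t : Bool} {f g : ℕ → ℕ} {K K' : ℕ} {w : ℕ → ℕ → ℕ}

lemma mono (hw : IsPlan s t f g K K' w) {f' : ℕ → ℕ} (h : ∀ i < K, f i ≤ f' i) :
    IsPlan s t f' g K K' w :=
  ⟨hw.bound, hw.color, hw.chain, fun i hi => (hw.row i hi).trans (h i hi), hw.col⟩

/-- Only row `u` and column `v` need spare capacity. Separate capacities `f'` allow two uses: a
block that has just been lengthened, and two left out blocks with unchanged lengths. -/
lemma add_single (hw : IsPlan s t f g K K' w) {f' : ℕ → ℕ} {u v : ℕ} (hu : u < K) (hv : v < K')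
    (hcolor : letter s u = letter t v)
    (hchain : ∀ i j, w i j ≠ 0 → (i < u → j ≤ v) ∧ (u < i → v ≤ j))
    (hf : ∀ i < K, i ≠ u → f i ≤ f' i) (hfu : ∑ j ∈ Finset.range K', w u j + 1 ≤ f' u)
    (hgv : ∑ i ∈ Finset.range K, w i v + 1 ≤ g v) :
    IsPlan s t f' g K K' (fun i j => w i j + if i = u ∧ j = v then 1 else 0) ∧
      weight K K' (fun i j => w i j + if i = u ∧ j = v then 1 else 0) = weight K K' w + 1 := by
  have hne : ∀ i j, w i j + (if i = u ∧ j = v then 1 else 0) ≠ 0 →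
      w i j ≠ 0 ∨ (i = u ∧ j = v) := by
    intro i j h
    by_cases hc : i = u ∧ j = v
    · exact Or.inr hc
    · rw [if_neg hc] at h
      exact Or.inl h
  have hrow : ∀ i, ∑ j ∈ Finset.range K', (w i j + if i = u ∧ j = v then 1 else 0) =
      ∑ j ∈ Finset.range K', w i j + if i = u then 1 else 0 := by
    intro i
    rw [Finset.sum_add_distrib]
    by_cases hi : i = u <;> simp [hi, hv]
  have hcol : ∀ j, ∑ i ∈ Finset.range K, (w i j + if i = u ∧ j = v then 1 else 0) =
      ∑ i ∈ Finset.range K, w i j + if j = v then 1 else 0 := by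
    intro j
    rw [Finset.sum_add_distrib]
    by_cases hj : j = v <;> simp [hj, hu]
  refine ⟨⟨?_, ?_, ?_, ?_, ?_⟩, ?_⟩
  · intro i j h
    rcases hne i j h with h | ⟨rfl, rfl⟩
    · exact hw.bound i j h
    · exact ⟨hu, hv⟩
  · intro i j h
    rcases hne i j h with h | ⟨rfl, rfl⟩
    · exact hw.color i j h
    · exact hcolor
  · intro i j i' j' h h' hlt
    rcases hne i j h with h1 | ⟨rfl, rfl⟩ <;> rcases hne i' j' h' with h2 | ⟨rfl, rfl⟩
    · exact hw.chain i j i' j' h1 h2 hlt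
    · exact (hchain i j h1).1 hlt
    · exact (hchain i' j' h2).2 hlt
    · exact le_rfl
  · intro i hi
    rw [hrow]
    by_cases h : i = u
    · subst h; simpa using hfu
    · simpa [h] using (hw.row i hi).trans (hf i hi h)
  · intro j hj
    rw [hcol]
    by_cases h : j = v
    · subst h; simpa using hgv
    · simpa [h] using hw.col j hj
  · simp only [weight, hrow]
    rw [Finset.sum_add_distrib]
    simp [hu]

/-- The additional letter is aligned with the free letter of the neighbor. The two blocks are
already aligned, so order and letters are respected. -/
lemma exists_lengthen (hw : IsPlan s t f g K K' w) {i : ℕ} (h : HasFreeNeighbor g K w i) :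
    ∃ w', IsPlan s t (Function.update f i (f i + 1)) g K K' w' ∧
      weight K K' w' = weight K K' w + 1 := by
  obtain ⟨j, hne, hlt⟩ := h
  obtain ⟨hi, hj⟩ := hw.bound i j hne
  refine ⟨_, hw.add_single hi hj (hw.color i j hne) (fun i' j' h' =>
    ⟨hw.chain i' j' i j h' hne, hw.chain i j i' j' hne h'⟩) (fun i' _ hi' => ?_) ?_ hlt⟩
  · rw [Function.update_of_ne hi']
  · rw [Function.update_self]
    exact Nat.succ_le_succ (hw.row i hi)

/-- A full block gives up one pair; otherwise the plan still fits. The comparison of `w'` with `w`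
keeps the free neighbors of the other blocks free. -/
lemma exists_shorten (hw : IsPlan s t f g K K' w) {i : ℕ} (hi : i < K) (hf : 0 < f i) :
    ∃ w', IsPlan s t (Function.update f i (f i - 1)) g K K' w' ∧ (∀ a b, w' a b ≤ w a b) ∧
      (∀ a b, a ≠ i → w' a b = w a b) ∧
      weight K K' w ≤ weight K K' w' + 1 ∧
      (¬ IsFull f K' w i → weight K K' w' = weight K K' w) := by
  by_cases hfull : IsFull f K' w i
  · obtain ⟨j, hj, hne⟩ : ∃ j ∈ Finset.range K', w i j ≠ 0 := by
      apply Finset.exists_ne_zero_of_sum_ne_zero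
      rw [hfull]
      omega
    rw [Finset.mem_range] at hj
    set w' : ℕ → ℕ → ℕ := fun a b => w a b - if a = i ∧ b = j then 1 else 0 with hw'
    have hle : ∀ a b, w' a b ≤ w a b := fun a b => Nat.sub_le _ _
    have heq : ∀ a b, w a b = w' a b + if a = i ∧ b = j then 1 else 0 := by
      intro a b
      simp only [hw']
      by_cases h : a = i ∧ b = j
      · obtain ⟨rfl, rfl⟩ := h
        simp; omega
      · simp [h]
    have hrow : ∀ a, ∑ b ∈ Finset.range K', w a b =
        ∑ b ∈ Finset.range K', w' a b + if a = i then 1 else 0 := by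
      intro a
      simp only [heq a, Finset.sum_add_distrib]
      by_cases ha : a = i <;> simp [ha, hj]
    have hne' : ∀ a b, w' a b ≠ 0 → w a b ≠ 0 := fun a b h => by
      have := hle a b
      omega
    refine ⟨w', ⟨fun a b h => hw.bound a b (hne' a b h), fun a b h => hw.color a b (hne' a b h),
      fun a b c d h h' => hw.chain a b c d (hne' a b h) (hne' c d h'), ?_, ?_⟩, hle, ?_, ?_, ?_⟩
    · intro a ha
      have h1 := hw.row a ha
      rw [hrow] at h1
      by_cases h : a = i
      · subst h
        simp at h1 ⊢
        omega
      · simpa [h] using h1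
    · exact fun b hb => (Finset.sum_le_sum fun a _ => hle a b).trans (hw.col b hb)
    · intro a b ha
      simp [hw', ha]
    · simp only [weight, hrow]
      rw [Finset.sum_add_distrib]
      simp [hi]
    · exact fun h => absurd hfull h
  · refine ⟨w, ⟨hw.bound, hw.color, hw.chain, fun a ha => ?_, hw.col⟩, fun _ _ => le_rfl,
      fun _ _ _ => rfl, Nat.le_succ _, fun _ => rfl⟩
    by_cases h : a = i
    · subst h
      have := hw.row a ha
      unfold IsFull at hfull
      simp
      omega
    · simpa [h] using hw.row a ha

open Classical in
/-- The effect of changing the lengths of two blocks on the longest common subsequence. -/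
theorem weight_le_lcsLength_update (hw : IsPlan s t f g K K' w) {i j : ℕ} (hj : j < K)
    (hij : i ≠ j) (hf : 0 < f j) :
    weight K K' w + (if HasFreeNeighbor g K w i then 1 else 0) ≤
      lcsLength (blockList s (Function.update (Function.update f i (f i + 1)) j (f j - 1))
        K).flatten (blockList t g K').flatten + (if IsFull f K' w j then 1 else 0) := by
  obtain ⟨w1, hw1, hle, hother, h1, h2⟩ := hw.exists_shorten hj hf
  have hshort : weight K K' w ≤ weight K K' w1 + if IsFull f K' w j then 1 else 0 := by
    by_cases hfull : IsFull f K' w j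
    · simpa [hfull] using h1
    · simp [hfull, h2 hfull]
  -- The long block is shortened first, since removing pairs cannot destroy a free letter.
  have hupd : Function.update (Function.update f i (f i + 1)) j (f j - 1) =
      Function.update (Function.update f j (f j - 1)) i (Function.update f j (f j - 1) i + 1) := by
    rw [Function.update_comm hij, Function.update_of_ne hij]
  rw [hupd]
  by_cases hfree : HasFreeNeighbor g K w i
  · have hfree1 : HasFreeNeighbor g K w1 i := by
      obtain ⟨b, hb, hlt⟩ := hfree
      exact ⟨b, by rwa [hother i b hij],
        (Finset.sum_le_sum fun a _ => hle a b).trans_lt hlt⟩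
    obtain ⟨w2, hw2, hwt⟩ := hw1.exists_lengthen hfree1
    have := hw2.weight_le_lcsLength
    simp only [hfree, if_true]
    unfold weight at *
    omega
  · have hw2 : IsPlan s t (Function.update (Function.update f j (f j - 1)) i
        (Function.update f j (f j - 1) i + 1)) g K K' w1 := by
      apply hw1.mono
      intro a _
      by_cases ha : a = i
      · subst ha; simp
      · simp [ha]
    have := hw2.weight_le_lcsLength
    simp only [hfree, if_false]
    unfold weight at *
    omega

/-- The blocks of the first string that are not left out. -/
def usedRows (K K' : ℕ) (w : ℕ → ℕ → ℕ) : Finset ℕ :=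
  (Finset.range K).filter fun i => ∃ j < K', w i j ≠ 0

/-- The blocks of the second string that are not left out. -/
def usedCols (K K' : ℕ) (w : ℕ → ℕ → ℕ) : Finset ℕ :=
  (Finset.range K').filter fun j => ∃ i < K, w i j ≠ 0

lemma usedRows_subset : usedRows K K' w ⊆ Finset.range K := Finset.filter_subset _ _

lemma usedCols_subset : usedCols K K' w ⊆ Finset.range K' := Finset.filter_subset _ _

lemma isBlockGraph (hw : IsPlan s t f g K K' w) :
    IsBlockGraph s t (usedRows K K' w) (usedCols K K' w) fun i j => w i j ≠ 0 := by
  refine ⟨fun h h' => hw.chain _ _ _ _ h h', fun h => hw.color _ _ h, ?_, ?_⟩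
  · intro i
    simp only [usedRows, Finset.mem_filter, Finset.mem_range]
    exact ⟨fun ⟨_, j, _, h⟩ => ⟨j, h⟩,
      fun ⟨j, h⟩ => ⟨(hw.bound i j h).1, j, (hw.bound i j h).2, h⟩⟩
  · intro j
    simp only [usedCols, Finset.mem_filter, Finset.mem_range]
    exact ⟨fun ⟨_, i, _, h⟩ => ⟨i, h⟩,
      fun ⟨i, h⟩ => ⟨(hw.bound i j h).2, i, (hw.bound i j h).1, h⟩⟩

/-- If no edge separated the left out blocks `u` and `v`, a pair between them could be added to an
optimal plan. -/
lemma exists_crossing (hw : IsPlan s t f g K K' w)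
    (hf : ∀ i < K, 0 < f i) (hg : ∀ j < K', 0 < g j)
    (hopt : lcsLength (blockList s f K).flatten (blockList t g K').flatten ≤ weight K K' w)
    (u v : ℕ) (hu : u ∉ usedRows K K' w) (hv : v ∉ usedCols K K' w)
    (hu' : ∃ i ∈ usedRows K K' w, u < i) (hv' : ∃ j ∈ usedCols K K' w, v < j)
    (hcolor : letter s u = letter t v) :
    ∃ i j, w i j ≠ 0 ∧ ((i < u ∧ v < j) ∨ (u < i ∧ j < v)) := by
  by_contra hcon
  push Not at hcon
  obtain ⟨i, hi, hui⟩ := hu'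
  obtain ⟨j, hj, hvj⟩ := hv'
  have hi := Finset.mem_range.1 (usedRows_subset hi)
  have hj := Finset.mem_range.1 (usedCols_subset hj)
  have hG := hw.isBlockGraph
  have hu0 : ∀ b, w u b = 0 := fun b => by
    by_contra h
    exact hu (hG.left.2 ⟨b, h⟩)
  have hv0 : ∀ a, w a v = 0 := fun a => by
    by_contra h
    exact hv (hG.right.2 ⟨a, h⟩)
  have huK : u < K := by omega
  have hvK : v < K' := by omega
  obtain ⟨h1, h2⟩ := hw.add_single (f' := f) huK hvK hcolor
    (fun a b h => ⟨fun h' => (hcon a b h).1 h', fun h' => (hcon a b h).2 h'⟩)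
    (fun _ _ _ => le_rfl) (by simpa [hu0] using Nat.succ_le_of_lt (hf u huK))
    (by simpa [hv0] using Nat.succ_le_of_lt (hg v hvK))
  have : weight K K' _ ≤ _ := h1.weight_le_lcsLength
  omega

end IsPlan

/-! ### Counting blocks of the different kinds -/

/-- All lengths `f 0, …, f (k - 1)` are `l - 1`, `l` or `l + 1`, and `f k` is the length of a
possibly truncated block. -/
structure IsBlockLengths (l k : ℕ) (f : ℕ → ℕ) : Prop where
  mem : ∀ i < k, f i = l - 1 ∨ f i = l ∨ f i = l + 1
  pos : 0 < f k
  le : f k ≤ l + 1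

lemma IsBlockLengths.pos_of_lt {l k : ℕ} {f : ℕ → ℕ} (h : IsBlockLengths l k f) (hl : 2 ≤ l) :
    ∀ i < k + 1, 0 < f i := by
  intro i hi
  rcases (Nat.lt_succ_iff.1 hi).lt_or_eq with h' | rfl
  · have := h.mem i h'
    omega
  · exact h.pos

lemma IsBlockLengths.le_of_lt {l k : ℕ} {f : ℕ → ℕ} (h : IsBlockLengths l k f) :
    ∀ i < k + 1, f i ≤ l + 1 := by
  intro i hi
  rcases (Nat.lt_succ_iff.1 hi).lt_or_eq with h' | rfl
  · have := h.mem i h'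
    omega
  · exact h.le

/-- The single pairs that do not contain one of the last blocks. -/
def innerPairs (k k' : ℕ) (R R' : Finset ℕ) : Finset (ℕ × ℕ) :=
  (singlePairs R R').filter fun e => e.1 < k ∧ e.2 < k'

/-- The number of pairs of blocks with prescribed lengths. -/
def pairCount (M : Finset (ℕ × ℕ)) (f g : ℕ → ℕ) (x y : ℕ) : ℕ :=
  (M.filter fun e => f e.1 = x ∧ g e.2 = y).card

/-- The blocks of length `x` among the first `K` ones. -/
def blocksOfLength (f : ℕ → ℕ) (K x : ℕ) : Finset ℕ := (Finset.range K).filter fun i => f i = x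

lemma card_image_fst_innerPairs {k k' : ℕ} {R R' : Finset ℕ} {M : Finset (ℕ × ℕ)}
    (hM : M ⊆ innerPairs k k' R R') : (M.image Prod.fst).card = M.card :=
  Finset.card_image_of_injOn fun _ he _ he' h =>
    fst_injOn_singlePairs (Finset.mem_filter.1 (hM he)).1 (Finset.mem_filter.1 (hM he')).1 h

lemma card_image_singlePairs_last_le (k' : ℕ) (R R' : Finset ℕ) :
    (((singlePairs R R').filter fun e => e.2 = k').image Prod.fst).card ≤ 1 := by
  refine Finset.card_image_le.trans (Finset.card_le_one.2 ?_)
  intro e he e' he'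
  rw [Finset.mem_filter] at he he'
  exact snd_injOn_singlePairs he.1 he'.1 (he.2.trans he'.2.symm)

/-- Every set of blocks is covered by the inner pairs, up to a number of blocks that is bounded
in terms of the number of left out blocks, and up to blocks with two neighbors of their own. -/
lemma IsBlockGraph.card_le {s t : Bool} {R R' : Finset ℕ} {E : ℕ → ℕ → Prop}
    (h : IsBlockGraph s t R R' E) {k k' : ℕ} (hR : R ⊆ Finset.range (k + 1))
    (hR' : R' ⊆ Finset.range (k' + 1)) {A T : Finset ℕ} (hA : A ⊆ Finset.range (k + 1))
    (hT : ∀ i ∈ A, (∃ j j', j ≠ j' ∧ E i j ∧ E i j' ∧ (∀ i', E i' j → i' = i) ∧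
      ∀ i', E i' j' → i' = i) → i ∈ T) :
    A.card ≤ ((innerPairs k k' R R').filter fun e => e.1 ∈ A).card +
      3 * (Finset.range (k + 1) \ R).card + T.card + 2 := by
  -- Left out blocks count once and blocks in runs of several blocks at most twice the left out
  -- number, which gives the factor 3. The constant 2 accounts for the last block `k` and the
  -- partner of the last block `k'`.
  have hcover : A ⊆ (((innerPairs k k' R R').filter fun e => e.1 ∈ A).image Prod.fst) ∪
      ((Finset.range (k + 1) \ R) ∪
      ((R.filter fun i => ∃ i' ∈ R, i' ≠ i ∧ changes R i' = changes R i) ∪ (T ∪ ({k} ∪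
      ((singlePairs R R').filter fun e => e.2 = k').image Prod.fst)))) := by
    intro i hi
    by_cases hiR : i ∈ R
    · rcases h.trichotomy hiR with h1 | ⟨j, hj⟩ | h1
      · refine Finset.mem_union_right _ (Finset.mem_union_right _ (Finset.mem_union_left _ ?_))
        exact Finset.mem_filter.2 ⟨hiR, h1⟩
      · by_cases hik : i = k
        · simp [hik]
        by_cases hjk : j = k'
        · iterate 5 apply Finset.mem_union_right
          exact Finset.mem_image.2 ⟨(i, j), Finset.mem_filter.2 ⟨hj, hjk⟩, rfl⟩
        · apply Finset.mem_union_left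
          refine Finset.mem_image.2 ⟨(i, j), Finset.mem_filter.2 ⟨Finset.mem_filter.2
            ⟨hj, ?_⟩, hi⟩, rfl⟩
          have h1 := Finset.mem_range.1 (hA hi)
          have h2 := Finset.mem_range.1 (hR' (h.right.2 ⟨i, h.rel_of_single hj⟩))
          simp only
          omega
      · have := hT i hi h1
        simp [this]
    · have := hA hi
      simp [hiR, this]
  refine (Finset.card_le_card hcover).trans ?_
  have h1 := card_image_fst_innerPairs (M := (innerPairs k k' R R').filter fun e => e.1 ∈ A)
    (Finset.filter_subset _ _)
  have h2 := card_filter_changes_eq_le hR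
  have h3 := card_image_singlePairs_last_le k' R R'
  refine (Finset.card_union_le _ _).trans ?_
  rw [h1, add_assoc, add_assoc]
  refine Nat.add_le_add_left ?_ _
  refine (Finset.card_union_le _ _).trans ?_
  have h4 := Finset.card_union_le (R.filter fun i => ∃ i' ∈ R, i' ≠ i ∧ changes R i' = changes R i)
    (T ∪ ({k} ∪ ((singlePairs R R').filter fun e => e.2 = k').image Prod.fst))
  have h5 := Finset.card_union_le T
    ({k} ∪ ((singlePairs R R').filter fun e => e.2 = k').image Prod.fst)
  have h6 := Finset.card_union_le {k} (((singlePairs R R').filter fun e => e.2 = k').image Prod.fst)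
  rw [Finset.card_singleton] at h6
  omega

-- Here `T` consists of all blocks of `A` with two neighbors; each of them costs a left out block of
-- the other string.
open Classical in
lemma IsBlockGraph.card_le_add_card_sdiff {s t : Bool} {R R' : Finset ℕ} {E : ℕ → ℕ → Prop}
    (h : IsBlockGraph s t R R' E) {k k' : ℕ} (hR : R ⊆ Finset.range (k + 1))
    (hR' : R' ⊆ Finset.range (k' + 1)) {A : Finset ℕ} (hA : A ⊆ Finset.range (k + 1)) :
    A.card ≤ ((innerPairs k k' R R').filter fun e => e.1 ∈ A).card +
      3 * (Finset.range (k + 1) \ R).card + (Finset.range (k' + 1) \ R').card + 2 := by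
  have h1 := h.card_le (T := A.filter fun i => ∃ j j', j ≠ j' ∧ E i j ∧ E i j') hR hR' hA
    (fun i hi ⟨j, j', hne, h1, h2, _⟩ => Finset.mem_filter.2 ⟨hi, j, j', hne, h1, h2⟩)
  have h2 := h.card_two_neighbors_le hR' (A.filter fun i => ∃ j j', j ≠ j' ∧ E i j ∧ E i j')
    (fun i hi => (Finset.mem_filter.1 hi).2)
  omega

/-! ### Gains of short blocks and losses of long blocks -/

namespace IsPlan

variable {l k k' : ℕ} {s t : Bool} {f g : ℕ → ℕ} {w : ℕ → ℕ → ℕ}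

lemma sum_col_of_single (hw : IsPlan s t f g (k + 1) (k' + 1) w) {i j : ℕ}
    (h : (i, j) ∈ singlePairs (usedRows (k + 1) (k' + 1) w) (usedCols (k + 1) (k' + 1) w)) :
    ∑ i' ∈ Finset.range (k + 1), w i' j = w i j := by
  have hE := hw.isBlockGraph.rel_of_single h
  apply Finset.sum_eq_single_of_mem i (Finset.mem_range.2 (hw.bound i j hE).1)
  intro i' _ hne
  by_contra h'
  exact hne (hw.isBlockGraph.eq_left_of_single h h')

lemma sum_row_of_single (hw : IsPlan s t f g (k + 1) (k' + 1) w) {i j : ℕ}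
    (h : (i, j) ∈ singlePairs (usedRows (k + 1) (k' + 1) w) (usedCols (k + 1) (k' + 1) w)) :
    ∑ j' ∈ Finset.range (k' + 1), w i j' = w i j := by
  have hE := hw.isBlockGraph.rel_of_single h
  apply Finset.sum_eq_single_of_mem j (Finset.mem_range.2 (hw.bound i j hE).2)
  intro j' _ hne
  by_contra h'
  exact hne (hw.isBlockGraph.eq_right_of_single h h')

/-- Block `j` is used by block `i` only, which cannot fill it. -/
lemma hasFreeNeighbor_of_single (hw : IsPlan s t f g (k + 1) (k' + 1) w) {i j : ℕ}
    (h : (i, j) ∈ singlePairs (usedRows (k + 1) (k' + 1) w) (usedCols (k + 1) (k' + 1) w))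
    (hlt : f i < g j) : HasFreeNeighbor g (k + 1) w i := by
  have hE := hw.isBlockGraph.rel_of_single h
  refine ⟨j, hE, ?_⟩
  have := hw.row i (hw.bound i j hE).1
  rw [hw.sum_row_of_single h] at this
  rw [hw.sum_col_of_single h]
  omega

/-- The two neighbors belong to block `i` alone and have together more letters than it can fill. -/
lemma hasFreeNeighbor_of_two_neighbors (hw : IsPlan s t f g (k + 1) (k' + 1) w) {i j j' : ℕ}
    (hne : j ≠ j') (hj : w i j ≠ 0) (hj' : w i j' ≠ 0) (h : ∀ i', w i' j ≠ 0 → i' = i)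
    (h' : ∀ i', w i' j' ≠ 0 → i' = i) (hlt : f i < g j + g j') :
    HasFreeNeighbor g (k + 1) w i := by
  have hi := (hw.bound i j hj).1
  have hcol : ∀ b, (∀ i', w i' b ≠ 0 → i' = i) →
      ∑ i' ∈ Finset.range (k + 1), w i' b = w i b := by
    intro b hb
    apply Finset.sum_eq_single_of_mem i (Finset.mem_range.2 hi)
    intro i' _ hne
    by_contra h0
    exact hne (hb i' h0)
  have hrow : w i j + w i j' ≤ f i := by
    calc w i j + w i j' = ∑ b ∈ {j, j'}, w i b := (Finset.sum_pair hne).symm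
      _ ≤ ∑ b ∈ Finset.range (k' + 1), w i b := by
        apply Finset.sum_le_sum_of_subset
        intro b hb
        rw [Finset.mem_insert, Finset.mem_singleton] at hb
        rcases hb with rfl | rfl
        · exact Finset.mem_range.2 (hw.bound i _ hj).2
        · exact Finset.mem_range.2 (hw.bound i _ hj').2
      _ ≤ f i := hw.row i hi
  by_cases hlt' : w i j < g j
  · exact ⟨j, hj, by rwa [hcol j h]⟩
  · exact ⟨j', hj', by rw [hcol j' h']; omega⟩

/-- A short block without gain is left out, shares its run, involves a last block, or forms an inner
pair with another short block. Two private neighbors always give a gain, so no left out blocks of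
the second string enter; this keeps the coefficient at `9q`. -/
lemma card_short_le [DecidablePred (HasFreeNeighbor g (k + 1) w)]
    (hw : IsPlan s t f g (k + 1) (k' + 1) w) (hl : 2 ≤ l)
    (hg : IsBlockLengths l k' g) :
    (blocksOfLength f (k + 1) (l - 1)).card ≤
      ((blocksOfLength f (k + 1) (l - 1)).filter (HasFreeNeighbor g (k + 1) w)).card +
      pairCount (innerPairs k k' (usedRows (k + 1) (k' + 1) w) (usedCols (k + 1) (k' + 1) w))
        f g (l - 1) (l - 1) +
      3 * (Finset.range (k + 1) \ usedRows (k + 1) (k' + 1) w).card + 2 := by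
  set A := (blocksOfLength f (k + 1) (l - 1)).filter (fun i => ¬ HasFreeNeighbor g (k + 1) w i)
    with hA
  have hsplit : ((blocksOfLength f (k + 1) (l - 1)).filter (HasFreeNeighbor g (k + 1) w)).card +
      A.card = (blocksOfLength f (k + 1) (l - 1)).card :=
    Finset.card_filter_add_card_filter_not _
  have hAmem : ∀ i ∈ A, f i = l - 1 ∧ ¬ HasFreeNeighbor g (k + 1) w i := by
    intro i hi
    rw [hA, Finset.mem_filter, blocksOfLength, Finset.mem_filter] at hi
    exact ⟨hi.1.2, hi.2⟩
  have h1 := hw.isBlockGraph.card_le (A := A) (T := ∅) usedRows_subset usedCols_subset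
    ((Finset.filter_subset _ _).trans (Finset.filter_subset _ _) : A ⊆ _) (by
      rintro i hi ⟨j, j', hne, h1, h2, h3, h4⟩
      -- At most one of the two neighbors is truncated, so together they have at least `(l - 1) + 1`
      -- letters.
      refine absurd (hw.hasFreeNeighbor_of_two_neighbors hne h1 h2 h3 h4 ?_) (hAmem i hi).2
      have hj := (hw.bound i j h1).2
      have hj' := (hw.bound i j' h2).2
      have p1 := hg.pos_of_lt hl j hj
      have p2 := hg.pos_of_lt hl j' hj'
      rw [(hAmem i hi).1]
      rcases (Nat.lt_succ_iff.1 hj).lt_or_eq with h | h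
      · have := hg.mem j h
        omega
      · have := hg.mem j' (by omega)
        omega)
  have h2 : ((innerPairs k k' (usedRows (k + 1) (k' + 1) w) (usedCols (k + 1) (k' + 1) w)).filter
      fun e => e.1 ∈ A).card ≤ pairCount (innerPairs k k' (usedRows (k + 1) (k' + 1) w)
        (usedCols (k + 1) (k' + 1) w)) f g (l - 1) (l - 1) := by
    apply Finset.card_le_card
    rintro ⟨i, j⟩ he
    obtain ⟨he, hi⟩ := Finset.mem_filter.1 he
    refine Finset.mem_filter.2 ⟨he, (hAmem i hi).1, ?_⟩
    obtain ⟨he1, he2⟩ := Finset.mem_filter.1 he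
    by_contra hne
    refine (hAmem i hi).2 (hw.hasFreeNeighbor_of_single he1 ?_)
    have := hg.mem j he2.2
    have := (hAmem i hi).1
    simp only at hne
    omega
  rw [Finset.card_empty] at h1
  omega

lemma le_card_short_filter [DecidablePred (HasFreeNeighbor g (k + 1) w)]
    (hw : IsPlan s t f g (k + 1) (k' + 1) w) (hl : 2 ≤ l) :
    pairCount (innerPairs k k' (usedRows (k + 1) (k' + 1) w) (usedCols (k + 1) (k' + 1) w))
        f g (l - 1) l +
      pairCount (innerPairs k k' (usedRows (k + 1) (k' + 1) w) (usedCols (k + 1) (k' + 1) w))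
        f g (l - 1) (l + 1) ≤
      ((blocksOfLength f (k + 1) (l - 1)).filter (HasFreeNeighbor g (k + 1) w)).card := by
  unfold pairCount
  rw [← Finset.card_union_of_disjoint, ← card_image_fst_innerPairs (k := k) (k' := k')
    (R := usedRows (k + 1) (k' + 1) w) (R' := usedCols (k + 1) (k' + 1) w)]
  · apply Finset.card_le_card
    intro i hi
    obtain ⟨⟨i, j⟩, he, rfl⟩ := Finset.mem_image.1 hi
    have : (i, j) ∈ innerPairs k k' (usedRows (k + 1) (k' + 1) w) (usedCols (k + 1) (k' + 1) w) ∧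
        f i = l - 1 ∧ l ≤ g j := by
      rcases Finset.mem_union.1 he with h | h <;> obtain ⟨h1, h2, h3⟩ := Finset.mem_filter.1 h
      · exact ⟨h1, h2, h3.ge⟩
      · refine ⟨h1, h2, ?_⟩
        simp only at h3
        omega
    obtain ⟨h1, h2, h3⟩ := this
    obtain ⟨h4, h5, -⟩ := Finset.mem_filter.1 h1
    have h6 : f i < g j := by omega
    refine Finset.mem_filter.2 ⟨Finset.mem_filter.2 ⟨Finset.mem_range.2 ?_, h2⟩,
      hw.hasFreeNeighbor_of_single h4 h6⟩
    simp only at h5 ⊢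
    omega
  · exact Finset.union_subset (Finset.filter_subset _ _) (Finset.filter_subset _ _)
  · rw [Finset.disjoint_filter]
    rintro e - ⟨-, h1⟩ ⟨-, h2⟩
    omega

/-- A full long block with two neighbors costs a left out block of the second string. With one
neighbor it must exhaust a block of length `l + 1`, and optimality then makes the two a single pair.
So only left out blocks of the second string appear, which leads to the term `3q`. -/
lemma card_long_filter_le [DecidablePred (IsFull f (k' + 1) w)]
    (hw : IsPlan s t f g (k + 1) (k' + 1) w) (hl : 2 ≤ l)
    (hf : IsBlockLengths l k f) (hg : IsBlockLengths l k' g)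
    (hopt : lcsLength (blockList s f (k + 1)).flatten (blockList t g (k' + 1)).flatten ≤
      weight (k + 1) (k' + 1) w) :
    ((blocksOfLength f (k + 1) (l + 1)).filter (IsFull f (k' + 1) w)).card ≤
      pairCount (innerPairs k k' (usedRows (k + 1) (k' + 1) w) (usedCols (k + 1) (k' + 1) w))
        f g (l + 1) (l + 1) +
      (Finset.range (k' + 1) \ usedCols (k + 1) (k' + 1) w).card + 2 := by
  set R := usedRows (k + 1) (k' + 1) w with hR
  set R' := usedCols (k + 1) (k' + 1) w with hR'
  classical
  set T := (Finset.range (k + 1)).filter fun i => ∃ j j', j ≠ j' ∧ w i j ≠ 0 ∧ w i j' ≠ 0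
    with hT
  have hcover : (blocksOfLength f (k + 1) (l + 1)).filter (IsFull f (k' + 1) w) ⊆
      (((innerPairs k k' R R').filter fun e => f e.1 = l + 1 ∧ g e.2 = l + 1).image Prod.fst) ∪
      (T ∪ ({k} ∪ ((singlePairs R R').filter fun e => e.2 = k').image Prod.fst)) := by
    intro i hi
    obtain ⟨hi, hfull⟩ := Finset.mem_filter.1 hi
    obtain ⟨hik, hfi⟩ := Finset.mem_filter.1 hi
    by_cases h2 : ∃ j j', j ≠ j' ∧ w i j ≠ 0 ∧ w i j' ≠ 0
    · exact Finset.mem_union_right _ (Finset.mem_union_left _ (Finset.mem_filter.2 ⟨hik, h2⟩))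
    obtain ⟨j, hj, hE⟩ : ∃ j ∈ Finset.range (k' + 1), w i j ≠ 0 := by
      apply Finset.exists_ne_zero_of_sum_ne_zero
      rw [hfull]
      omega
    have hi1 : ∀ j', w i j' ≠ 0 → j' = j := fun j' h' => by
      by_contra hne
      exact h2 ⟨j', j, hne, h', hE⟩
    have hrow : ∑ j' ∈ Finset.range (k' + 1), w i j' = w i j := by
      apply Finset.sum_eq_single_of_mem j hj
      intro j' _ hne
      by_contra h0
      exact hne (hi1 j' h0)
    have hwij : w i j = l + 1 := by rw [← hrow, hfull, hfi]
    have hcol := hw.col j (Finset.mem_range.1 hj)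
    have hgj := hg.le_of_lt j (Finset.mem_range.1 hj)
    rw [← Finset.add_sum_erase _ _ hik] at hcol
    -- No block is longer than `l + 1`, so block `i` has used up all letters of block `j`.
    have hj1 : ∀ i', w i' j ≠ 0 → i' = i := by
      intro i' h'
      by_contra hne
      have : w i' j ≤ ∑ x ∈ (Finset.range (k + 1)).erase i, w x j :=
        Finset.single_le_sum (f := fun x => w x j) (fun _ _ => Nat.zero_le _)
          (Finset.mem_erase.2 ⟨hne, Finset.mem_range.2 (hw.bound i' j h').1⟩)
      omega
    have hsingle : (i, j) ∈ singlePairs R R' := hw.isBlockGraph.mem_singlePairs_of_maximal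
      (hw.exists_crossing (hf.pos_of_lt hl) (hg.pos_of_lt hl) hopt) hE hi1 hj1
    by_cases hik' : i = k
    · simp [hik']
    by_cases hjk : j = k'
    · iterate 3 apply Finset.mem_union_right
      exact Finset.mem_image.2 ⟨(i, j), Finset.mem_filter.2 ⟨hsingle, hjk⟩, rfl⟩
    · apply Finset.mem_union_left
      refine Finset.mem_image.2 ⟨(i, j), Finset.mem_filter.2 ⟨Finset.mem_filter.2
        ⟨hsingle, ?_⟩, hfi, ?_⟩, rfl⟩
      · have h1 := Finset.mem_range.1 hik
        have h2 := Finset.mem_range.1 hj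
        simp only
        omega
      · simp only
        omega
  refine (Finset.card_le_card hcover).trans ?_
  have h1 := card_image_fst_innerPairs (M := (innerPairs k k' R R').filter
    fun e => f e.1 = l + 1 ∧ g e.2 = l + 1) (Finset.filter_subset _ _)
  have h3 := card_image_singlePairs_last_le k' R R'
  refine (Finset.card_union_le _ _).trans ?_
  rw [h1, add_assoc]
  refine Nat.add_le_add_left ?_ _
  have h4 : T.card ≤ (Finset.range (k' + 1) \ R').card :=
    hw.isBlockGraph.card_two_neighbors_le usedCols_subset T fun i hi => (Finset.mem_filter.1 hi).2
  have h5 := Finset.card_union_le T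
    ({k} ∪ ((singlePairs R R').filter fun e => e.2 = k').image Prod.fst)
  have h6 := Finset.card_union_le {k} (((singlePairs R R').filter fun e => e.2 = k').image Prod.fst)
  rw [Finset.card_singleton] at h6
  omega

/-- A long block in a single pair with a shorter block cannot be full. -/
lemma card_long_filter_add_le [DecidablePred (IsFull f (k' + 1) w)]
    (hw : IsPlan s t f g (k + 1) (k' + 1) w) (hl : 2 ≤ l) :
    ((blocksOfLength f (k + 1) (l + 1)).filter (IsFull f (k' + 1) w)).card +
      (pairCount (innerPairs k k' (usedRows (k + 1) (k' + 1) w) (usedCols (k + 1) (k' + 1) w))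
        f g (l + 1) (l - 1) +
      pairCount (innerPairs k k' (usedRows (k + 1) (k' + 1) w) (usedCols (k + 1) (k' + 1) w))
        f g (l + 1) l) ≤ (blocksOfLength f (k + 1) (l + 1)).card := by
  have hsplit := Finset.card_filter_add_card_filter_not (s := blocksOfLength f (k + 1) (l + 1))
    (IsFull f (k' + 1) w)
  rw [← hsplit]
  refine Nat.add_le_add_left ?_ _
  unfold pairCount
  rw [← Finset.card_union_of_disjoint, ← card_image_fst_innerPairs (k := k) (k' := k')
    (R := usedRows (k + 1) (k' + 1) w) (R' := usedCols (k + 1) (k' + 1) w)]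
  · apply Finset.card_le_card
    intro i hi
    obtain ⟨⟨i, j⟩, he, rfl⟩ := Finset.mem_image.1 hi
    have : (i, j) ∈ innerPairs k k' (usedRows (k + 1) (k' + 1) w) (usedCols (k + 1) (k' + 1) w) ∧
        f i = l + 1 ∧ g j ≤ l := by
      rcases Finset.mem_union.1 he with h | h <;> obtain ⟨h1, h2, h3⟩ := Finset.mem_filter.1 h
      · refine ⟨h1, h2, ?_⟩
        simp only at h3
        omega
      · exact ⟨h1, h2, h3.le⟩
    obtain ⟨h1, h2, h3⟩ := this
    obtain ⟨h4, h5, -⟩ := Finset.mem_filter.1 h1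
    have hE := hw.isBlockGraph.rel_of_single h4
    refine Finset.mem_filter.2 ⟨Finset.mem_filter.2 ⟨Finset.mem_range.2 (hw.bound i j hE).1, h2⟩,
      ?_⟩
    unfold IsFull
    have hcol := hw.col j (hw.bound i j hE).2
    rw [hw.sum_col_of_single h4] at hcol
    simp only
    rw [hw.sum_row_of_single h4]
    omega
  · exact Finset.union_subset (Finset.filter_subset _ _) (Finset.filter_subset _ _)
  · rw [Finset.disjoint_filter]
    rintro e - ⟨-, h1⟩ ⟨-, h2⟩
    omega

/-- Up to a bounded proportion, the blocks of length `x` belong to inner pairs. -/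
lemma card_blocksOfLength_le (hw : IsPlan s t f g (k + 1) (k' + 1) w)
    (hl : 2 ≤ l) (hg : IsBlockLengths l k' g) (x : ℕ) :
    (blocksOfLength f (k + 1) x).card ≤
      (pairCount (innerPairs k k' (usedRows (k + 1) (k' + 1) w) (usedCols (k + 1) (k' + 1) w))
        f g x (l - 1) +
      pairCount (innerPairs k k' (usedRows (k + 1) (k' + 1) w) (usedCols (k + 1) (k' + 1) w))
        f g x l +
      pairCount (innerPairs k k' (usedRows (k + 1) (k' + 1) w) (usedCols (k + 1) (k' + 1) w))
        f g x (l + 1)) +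
      3 * (Finset.range (k + 1) \ usedRows (k + 1) (k' + 1) w).card +
      (Finset.range (k' + 1) \ usedCols (k + 1) (k' + 1) w).card + 2 := by
  refine (hw.isBlockGraph.card_le_add_card_sdiff usedRows_subset usedCols_subset
    (Finset.filter_subset _ _ : blocksOfLength f (k + 1) x ⊆ _)).trans ?_
  gcongr
  unfold pairCount
  rw [← Finset.card_union_of_disjoint, ← Finset.card_union_of_disjoint]
  · apply Finset.card_le_card
    rintro ⟨i, j⟩ he
    obtain ⟨he, hi⟩ := Finset.mem_filter.1 he
    have hfi : f i = x := (Finset.mem_filter.1 hi).2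
    have hgj := hg.mem j (Finset.mem_filter.1 he).2.2
    simp only [Finset.mem_union, Finset.mem_filter, he, hfi, true_and]
    omega
  · rw [Finset.disjoint_union_left, Finset.disjoint_filter, Finset.disjoint_filter]
    constructor <;> (rintro e - ⟨-, h1⟩ ⟨-, h2⟩; omega)
  · rw [Finset.disjoint_filter]
    rintro e - ⟨-, h1⟩ ⟨-, h2⟩
    omega

lemma le_card_innerPairs (hw : IsPlan s t f g (k + 1) (k' + 1) w) :
    k + 1 ≤ (innerPairs k k' (usedRows (k + 1) (k' + 1) w) (usedCols (k + 1) (k' + 1) w)).card +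
      3 * (Finset.range (k + 1) \ usedRows (k + 1) (k' + 1) w).card +
      (Finset.range (k' + 1) \ usedCols (k + 1) (k' + 1) w).card + 2 := by
  have := hw.isBlockGraph.card_le_add_card_sdiff usedRows_subset usedCols_subset
    (subset_refl (Finset.range (k + 1)))
  rw [Finset.card_range] at this
  refine this.trans ?_
  gcongr
  exact Finset.filter_subset _ _

end IsPlan

/-! ### The mean change of the longest common subsequence of two given strings -/

/-- The mean change of the length of the longest common subsequence under a uniformly chosen
modification. -/
noncomputable def meanChange (l : ℕ) (x y : List Bool) : ℝ :=
  (∑ c ∈ choices l x, ((lcsLength (modifyString l x c) y : ℝ) - (lcsLength x y : ℝ))) /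
    ((choices l x).card : ℝ)

lemma blockLength_flatten_blockList (s : Bool) {f : ℕ → ℕ} {K i : ℕ} (hf : ∀ i < K, 0 < f i)
    (hi : i < K) : blockLength (blockList s f K).flatten i = f i := by
  unfold blockLength
  rw [blocks_flatten_blockList s f K hf, List.getD_eq_getElem _ _ (by simpa using hi)]
  simp [blockList]

lemma choices_flatten_blockList (l : ℕ) (s : Bool) {f : ℕ → ℕ} {K : ℕ} (hf : ∀ i < K, 0 < f i) :
    choices l (blockList s f K).flatten =
      blocksOfLength f K (l - 1) ×ˢ blocksOfLength f K (l + 1) := by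
  ext ⟨i, j⟩
  simp only [choices, blocksOfLength, Finset.mem_filter, Finset.mem_product, Finset.mem_range,
    blocks_flatten_blockList s f K hf, length_blockList]
  constructor
  · rintro ⟨⟨hi, hj⟩, h1, h2⟩
    rw [blockLength_flatten_blockList s hf hi] at h1
    rw [blockLength_flatten_blockList s hf hj] at h2
    exact ⟨⟨hi, h1⟩, hj, h2⟩
  · rintro ⟨⟨hi, h1⟩, hj, h2⟩
    rw [blockLength_flatten_blockList s hf hi, blockLength_flatten_blockList s hf hj]
    exact ⟨⟨hi, hj⟩, h1, h2⟩

lemma resizeBlock_blockList (l : ℕ) (s : Bool) {f : ℕ → ℕ} {K i : ℕ}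
    (hf : 0 < f i) :
    resizeBlock l (blockList s f K) i = blockList s (Function.update f i l) K := by
  apply List.ext_getElem
  · simp [resizeBlock]
  · intro j h1 h2
    simp only [resizeBlock, List.getElem_modify, blockList, List.getElem_map, List.getElem_range]
    by_cases hij : i = j
    · subst hij
      obtain ⟨m, hm⟩ : ∃ m, f i = m + 1 := ⟨f i - 1, by omega⟩
      simp [hm, List.replicate_succ]
    · rw [if_neg hij, Function.update_of_ne (Ne.symm hij)]

lemma modifyString_flatten_blockList (l : ℕ) (hl : 2 ≤ l) (s : Bool) {f : ℕ → ℕ} {K : ℕ}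
    (hf : ∀ i < K, 0 < f i) {i j : ℕ} (hi : i ∈ blocksOfLength f K (l - 1))
    (hj : j ∈ blocksOfLength f K (l + 1)) :
    i ≠ j ∧ modifyString l (blockList s f K).flatten (i, j) =
      (blockList s (Function.update (Function.update f i (f i + 1)) j (f j - 1)) K).flatten := by
  have hmem : (i, j) ∈ choices l (blockList s f K).flatten := by
    rw [choices_flatten_blockList l s hf]
    exact Finset.mk_mem_product hi hj
  simp only [blocksOfLength, Finset.mem_filter, Finset.mem_range] at hi hj
  have hij : i ≠ j := by
    rintro rfl
    omega
  refine ⟨hij, ?_⟩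
  rw [modifyString, if_pos hmem, blocks_flatten_blockList s f K hf,
    resizeBlock_blockList l s (hf i hi.1), resizeBlock_blockList l s]
  · have h1 : f i + 1 = l := by omega
    have h2 : f j - 1 = l := by omega
    rw [h1, h2]
  · rw [Function.update_of_ne hij.symm]
    exact hf j hj.1

-- Each choice changes the length by at least the gain indicator of the short block minus the
-- fullness indicator of the long one. Over the product set of choices the sum factorizes.
open Classical in
lemma IsPlan.le_sum_choices {l : ℕ} (hl : 2 ≤ l) {s t : Bool} {f g : ℕ → ℕ} {K K' : ℕ}
    {w : ℕ → ℕ → ℕ} (hw : IsPlan s t f g K K' w) (hf : ∀ i < K, 0 < f i)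
    (hopt : weight K K' w = lcsLength (blockList s f K).flatten (blockList t g K').flatten) :
    (((blocksOfLength f K (l - 1)).filter (HasFreeNeighbor g K w)).card : ℝ) *
        (blocksOfLength f K (l + 1)).card -
      ((blocksOfLength f K (l + 1)).filter (IsFull f K' w)).card *
        (blocksOfLength f K (l - 1)).card ≤
    ∑ c ∈ choices l (blockList s f K).flatten,
      ((lcsLength (modifyString l (blockList s f K).flatten c) (blockList t g K').flatten : ℝ) -
        (lcsLength (blockList s f K).flatten (blockList t g K').flatten : ℝ)) := by
  rw [choices_flatten_blockList l s hf, Finset.sum_product]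
  calc _ = ∑ i ∈ blocksOfLength f K (l - 1), ∑ j ∈ blocksOfLength f K (l + 1),
        ((if HasFreeNeighbor g K w i then (1 : ℝ) else 0) - if IsFull f K' w j then 1 else 0) := by
        simp only [Finset.sum_sub_distrib, Finset.sum_const, nsmul_eq_mul, Finset.sum_boole,
          ← Finset.mul_sum]
        ring
    _ ≤ _ := by
        refine Finset.sum_le_sum fun i hi => Finset.sum_le_sum fun j hj => ?_
        obtain ⟨hij, hmod⟩ := modifyString_flatten_blockList l hl s hf hi hj
        have hjK : j < K := Finset.mem_range.1 (Finset.mem_filter.1 hj).1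
        have h := hw.weight_le_lcsLength_update (i := i) hjK hij (hf j hjK)
        rw [hmod, ← hopt]
        have h' : ((weight K K' w + (if HasFreeNeighbor g K w i then 1 else 0) : ℕ) : ℝ) ≤
          ((lcsLength (blockList s (Function.update (Function.update f i (f i + 1)) j (f j - 1))
            K).flatten (blockList t g K').flatten + (if IsFull f K' w j then 1 else 0) : ℕ) : ℝ) :=
          by exact_mod_cast h
        push_cast at h'
        linarith

lemma leftOutProportion_eq {s : Bool} {f : ℕ → ℕ} {K : ℕ} (hf : ∀ i < K, 0 < f i) {S R : Finset ℕ}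
    (hR : ∀ i < K, Disjoint (blockPositions (blockList s f K).flatten i) S ↔ i ∉ R) :
    leftOutProportion (blockList s f K).flatten S = ((Finset.range K \ R).card : ℝ) / K := by
  unfold leftOutProportion
  rw [blocks_flatten_blockList s f K hf, length_blockList]
  congr 3
  ext i
  simp only [Finset.mem_filter, Finset.mem_range, Finset.mem_sdiff]
  constructor
  · rintro ⟨h1, h2⟩
    exact ⟨h1, (hR i h1).1 h2⟩
  · rintro ⟨h1, h2⟩
    exact ⟨h1, (hR i h1).2 h2⟩

/-- The combinatorial bounds: `R` and `R'` are the sets of the blocks that some optimal alignment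
does not leave out, `inc` counts the short blocks whose extension increases the longest common
subsequence, and `dec` counts the long blocks whose reduction might decrease it. -/
theorem exists_counts {l k k' : ℕ} (hl : 2 ≤ l) {s t : Bool} {f g : ℕ → ℕ}
    (hf : IsBlockLengths l k f) (hg : IsBlockLengths l k' g) {q : ℝ}
    (hq : LeavesOutAtMost (blockList s f (k + 1)).flatten (blockList t g (k' + 1)).flatten q) :
    ∃ R ⊆ Finset.range (k + 1), ∃ R' ⊆ Finset.range (k' + 1), ∃ inc dec : ℕ,
      ((Finset.range (k + 1) \ R).card : ℝ) / ((k + 1 : ℕ) : ℝ) ≤ q ∧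
      ((Finset.range (k' + 1) \ R').card : ℝ) / ((k' + 1 : ℕ) : ℝ) ≤ q ∧
      (inc : ℝ) * (blocksOfLength f (k + 1) (l + 1)).card -
        dec * (blocksOfLength f (k + 1) (l - 1)).card ≤
        ∑ c ∈ choices l (blockList s f (k + 1)).flatten,
          ((lcsLength (modifyString l (blockList s f (k + 1)).flatten c)
            (blockList t g (k' + 1)).flatten : ℝ) -
          (lcsLength (blockList s f (k + 1)).flatten (blockList t g (k' + 1)).flatten : ℝ)) ∧
      (blocksOfLength f (k + 1) (l - 1)).card ≤ inc +
        pairCount (innerPairs k k' R R') f g (l - 1) (l - 1) +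
        3 * (Finset.range (k + 1) \ R).card + 2 ∧
      pairCount (innerPairs k k' R R') f g (l - 1) l +
        pairCount (innerPairs k k' R R') f g (l - 1) (l + 1) ≤ inc ∧
      dec ≤ pairCount (innerPairs k k' R R') f g (l + 1) (l + 1) +
        (Finset.range (k' + 1) \ R').card + 2 ∧
      dec + (pairCount (innerPairs k k' R R') f g (l + 1) (l - 1) +
        pairCount (innerPairs k k' R R') f g (l + 1) l) ≤
        (blocksOfLength f (k + 1) (l + 1)).card ∧
      (∀ x, (blocksOfLength f (k + 1) x).card ≤
        (pairCount (innerPairs k k' R R') f g x (l - 1) +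
        pairCount (innerPairs k k' R R') f g x l +
        pairCount (innerPairs k k' R R') f g x (l + 1)) +
        3 * (Finset.range (k + 1) \ R).card + (Finset.range (k' + 1) \ R').card + 2) ∧
      k + 1 ≤ (innerPairs k k' R R').card + 3 * (Finset.range (k + 1) \ R).card +
        (Finset.range (k' + 1) \ R').card + 2 := by
  classical
  have hfpos := hf.pos_of_lt hl
  have hgpos := hg.pos_of_lt hl
  obtain ⟨a, ha⟩ := exists_isOptimalAlignment (blockList s f (k + 1)).flatten
    (blockList t g (k' + 1)).flatten
  obtain ⟨w, hw, hsum, hrows, hcols⟩ := exists_isPlan_of_isAlignment hfpos hgpos ha.1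
  have hopt : weight (k + 1) (k' + 1) w = lcsLength (blockList s f (k + 1)).flatten
    (blockList t g (k' + 1)).flatten := hsum.trans ha.card_eq
  have hG := hw.isBlockGraph
  obtain ⟨hq1, hq2⟩ := hq a ha
  rw [leftOutProportion_eq hfpos (R := IsPlan.usedRows (k + 1) (k' + 1) w)] at hq1
  · rw [leftOutProportion_eq hgpos (R := IsPlan.usedCols (k + 1) (k' + 1) w)] at hq2
    · exact ⟨_, IsPlan.usedRows_subset, _, IsPlan.usedCols_subset, _, _, hq1, hq2,
        hw.le_sum_choices hl hfpos hopt, hw.card_short_le hl hg, hw.le_card_short_filter hl,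
        hw.card_long_filter_le hl hf hg hopt.ge, hw.card_long_filter_add_le hl,
        hw.card_blocksOfLength_le hl hg, hw.le_card_innerPairs⟩
    · intro j hj
      rw [hcols j hj, hG.right]
      push Not
      rfl
  · intro i hi
    rw [hrows i hi, hG.left]
    push Not
    rfl

/-! ### The minimisation problem -/

lemma entropyTwo_eq_binEntropy (q : ℝ) : entropyTwo q = Real.binEntropy q := by
  simp [entropyTwo, Real.binEntropy]

lemma entropy_eq_sum_negMulLog (p : Fin 3 → Fin 3 → ℝ) :
    entropy p = ∑ i, ∑ j, Real.negMulLog (p i j) := by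
  simp [entropy, Real.negMulLog, Real.log_inv]

lemma entropy_nonneg {p : Fin 3 → Fin 3 → ℝ} (hp : ∀ i j, 0 ≤ p i j)
    (h1 : ∀ i j, p i j ≤ 1) : 0 ≤ entropy p := by
  rw [entropy_eq_sum_negMulLog]
  exact Finset.sum_nonneg fun i _ => Finset.sum_nonneg fun j _ =>
    Real.negMulLog_nonneg (hp i j) (h1 i j)

/-- Gibbs' inequality relative to the uniform distribution, term by term from `log x ≤ x - 1` with
`x = 1 / (9 p)`. -/
lemma entropy_le_log_nine {p : Fin 3 → Fin 3 → ℝ} (hp : ∀ i j, 0 ≤ p i j)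
    (hsum : ∑ i, ∑ j, p i j = 1) : Real.log (1 / 9) + entropy p ≤ 0 := by
  have key : ∀ i j, p i j * Real.log (1 / 9) + p i j * Real.log (1 / p i j) ≤ 1 / 9 - p i j := by
    intro i j
    rcases (hp i j).eq_or_lt with h | h
    · rw [← h]; norm_num
    · rw [← mul_add, ← Real.log_mul (by norm_num) (by positivity)]
      calc p i j * Real.log (1 / 9 * (1 / p i j)) ≤ p i j * (1 / 9 * (1 / p i j) - 1) := by
            gcongr
            exact Real.log_le_sub_one_of_pos (by positivity)
        _ = 1 / 9 - p i j := by field_simp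
  calc Real.log (1 / 9) + entropy p
      = ∑ i, ∑ j, (p i j * Real.log (1 / 9) + p i j * Real.log (1 / p i j)) := by
        simp only [Finset.sum_add_distrib, ← Finset.sum_mul, hsum, entropy, one_mul]
    _ ≤ ∑ i : Fin 3, ∑ j : Fin 3, (1 / 9 - p i j) :=
        Finset.sum_le_sum fun i _ => Finset.sum_le_sum fun j _ => key i j
    _ = 0 := by
        simp only [Finset.sum_sub_distrib, hsum]
        norm_num

/-- The constraints without the one on the entropies. -/
def weaklyFeasible (q₀ : ℝ) : Set ((Fin 3 → Fin 3 → ℝ) × ℝ) :=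
  {z | z.2 ∈ Set.Icc 0 q₀ ∧ (1 / 3 - q₀) / 2 ≤ ∑ j, z.1 0 j ∧ (1 / 3 - q₀) / 2 ≤ ∑ j, z.1 2 j ∧
    (∀ i j, 0 ≤ z.1 i j) ∧ ∑ i, ∑ j, z.1 i j = 1}

lemma isCompact_weaklyFeasible (q₀ : ℝ) : IsCompact (weaklyFeasible q₀) := by
  have hbig : IsCompact ((Set.univ.pi fun _ : Fin 3 => Set.univ.pi fun _ : Fin 3 =>
      Set.Icc (0 : ℝ) 1) ×ˢ Set.Icc (0 : ℝ) q₀) :=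
    (isCompact_univ_pi fun _ => isCompact_univ_pi fun _ => isCompact_Icc).prod isCompact_Icc
  apply hbig.of_isClosed_subset
  · have h1 : Continuous fun z : (Fin 3 → Fin 3 → ℝ) × ℝ => ∑ j, z.1 0 j := by fun_prop
    have h2 : Continuous fun z : (Fin 3 → Fin 3 → ℝ) × ℝ => ∑ j, z.1 2 j := by fun_prop
    have h3 : Continuous fun z : (Fin 3 → Fin 3 → ℝ) × ℝ => ∑ i, ∑ j, z.1 i j := by fun_prop
    have h4 : ∀ i j, Continuous fun z : (Fin 3 → Fin 3 → ℝ) × ℝ => z.1 i j := fun i j => by fun_prop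
    have h5 : IsClosed {z : (Fin 3 → Fin 3 → ℝ) × ℝ | ∀ i j, 0 ≤ z.1 i j} := by
      simp only [Set.ofPred_forall]
      exact isClosed_iInter fun i => isClosed_iInter fun j =>
        isClosed_le continuous_const (h4 i j)
    exact (isClosed_Icc.preimage continuous_snd).inter
      ((isClosed_le continuous_const h1).inter ((isClosed_le continuous_const h2).inter
        (h5.inter (isClosed_eq h3 continuous_const))))
  · rintro ⟨p, q⟩ ⟨h1, -, -, h4, h5⟩
    refine ⟨fun i _ j _ => ⟨h4 i j, ?_⟩, h1⟩
    simp only at h4 h5 ⊢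
    calc p i j ≤ ∑ j, p i j := Finset.single_le_sum (fun j _ => h4 i j) (Finset.mem_univ j)
      _ ≤ ∑ i, ∑ j, p i j := Finset.single_le_sum (f := fun i => ∑ j, p i j)
          (fun i _ => Finset.sum_nonneg fun j _ => h4 i j) (Finset.mem_univ i)
      _ = 1 := h5

/-- The uniform distribution shows that a positive minimum forces `q₀` to be small. -/
lemma lt_of_isLeast {q₀ ε : ℝ} (hq₀ : q₀ ∈ Set.Ico (0 : ℝ) (1 / 3)) (hε : 0 < ε)
    (hmin : IsLeast (feasibleValues q₀) (2 * ε)) : q₀ < 1 / 24 := by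
  obtain ⟨h0, h1⟩ := hq₀
  -- At this point the objective function equals `1/3 - 8 q₀`.
  have hfeas : IsFeasible q₀ (fun _ _ => 1 / 9) q₀ := by
    refine ⟨⟨h0, le_rfl⟩, ?_, ?_, fun _ _ => by norm_num, by norm_num, ?_⟩
    · norm_num; linarith
    · norm_num; linarith
    · have : entropy (fun _ _ => 1 / 9) = -Real.log (1 / 9) := by
        simp [entropy, Real.log_inv]
        ring
      rw [this, add_neg_cancel, mul_zero, add_zero, entropyTwo_eq_binEntropy]
      have := Real.binEntropy_nonneg h0 (by linarith)
      linarith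
  have := hmin.2 ⟨_, _, hfeas, rfl⟩
  norm_num [objective] at this
  linarith

/-- Slightly weakening the constraint on the entropies changes the minimum only slightly. -/
lemma exists_objective_ge {q₀ ε : ℝ} (hq₀ : q₀ ∈ Set.Ico (0 : ℝ) (1 / 3)) (hε : 0 < ε)
    (hmin : IsLeast (feasibleValues q₀) (2 * ε)) :
    ∃ δ > 0, ∀ z ∈ weaklyFeasible q₀,
      -δ ≤ 2 * entropyTwo z.2 + (1 - 4 * z.2) * (Real.log (1 / 9) + entropy z.1) →
      3 / 2 * ε ≤ objective z.1 z.2 := by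
  set e : (Fin 3 → Fin 3 → ℝ) × ℝ → ℝ := fun z =>
    2 * entropyTwo z.2 + (1 - 4 * z.2) * (Real.log (1 / 9) + entropy z.1) with he
  have hecont : Continuous e := by
    simp only [he, entropyTwo_eq_binEntropy, entropy_eq_sum_negMulLog]
    fun_prop
  have hobj : ContinuousOn (fun z : (Fin 3 → Fin 3 → ℝ) × ℝ => objective z.1 z.2)
      (weaklyFeasible q₀) := by
    unfold objective
    -- The mass constraints keep both denominators away from zero.
    have hpos : 0 < (1 / 3 - q₀) / 2 := by linarith [hq₀.2]
    refine ContinuousOn.sub (ContinuousOn.sub (ContinuousOn.mul (ContinuousOn.div ?_ ?_ ?_) ?_)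
      (ContinuousOn.mul (ContinuousOn.div ?_ ?_ ?_) ?_)) ?_
    all_goals try fun_prop
    · rintro z ⟨-, h, -⟩
      rw [Fin.sum_univ_three] at h
      linarith
    · rintro z ⟨-, -, h, -⟩
      rw [Fin.sum_univ_three] at h
      linarith
  -- On the compact set where the objective is at most `3ε/2 < 2ε`, the entropy constraint must fail
  -- strictly, hence by a uniform margin; `δ` is half of it.
  set S := weaklyFeasible q₀ ∩ (fun z => objective z.1 z.2) ⁻¹' Set.Iic (3 / 2 * ε) with hS
  have hScomp : IsCompact S := (isCompact_weaklyFeasible q₀).of_isClosed_subset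
    (hobj.preimage_isClosed_of_isClosed (isCompact_weaklyFeasible q₀).isClosed isClosed_Iic)
    Set.inter_subset_left
  have hneg : ∀ z ∈ S, e z < 0 := by
    rintro ⟨p, q⟩ ⟨⟨h1, h2, h3, h4, h5⟩, h6⟩
    by_contra hcon
    have := hmin.2 ⟨p, q, ⟨h1, h2, h3, h4, h5, not_lt.1 hcon⟩, rfl⟩
    simp only [Set.mem_preimage, Set.mem_Iic] at h6
    linarith
  rcases S.eq_empty_or_nonempty with hemp | hne
  · refine ⟨1, one_pos, fun z hz _ => ?_⟩
    by_contra hcon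
    have : z ∈ S := ⟨hz, (not_le.1 hcon).le⟩
    rw [hemp] at this
    exact this
  · obtain ⟨z₀, hz₀, hmax⟩ := hScomp.exists_isMaxOn hne hecont.continuousOn
    refine ⟨-e z₀ / 2, by linarith [hneg z₀ hz₀], fun z hz hez => ?_⟩
    by_contra hcon
    have h1 : e z ≤ e z₀ := hmax ⟨hz, (not_le.1 hcon).le⟩
    have h2 := hneg z₀ hz₀
    have h3 : - (-e z₀ / 2) ≤ e z := hez
    linarith

/-- The entropy constraint survives the passage from block counts to proportions. -/
lemma neg_le_entropy_of_counts {q₀ η K K' a b N G : ℝ} (hq₀ : q₀ < 1 / 24) (hη : 0 < η)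
    (hK : 0 < K) (hK' : 0 < K') (ha : 0 ≤ a) (hb : 0 ≤ b)
    (haq : a / K ≤ q₀) (hbq : b / K' ≤ q₀) (hKK : K' ≤ K + η * K)
    (hN : (1 - 4 * max (a / K) (b / K')) * K - 2 * (η * K) ≤ N) (hG : G ≤ 0) (hG' : -3 ≤ G)
    (hent : -(η * K) ≤ K * Real.binEntropy (a / K) + K' * Real.binEntropy (b / K') + N * G) :
    -(8 * η) ≤ 2 * entropyTwo (max (a / K) (b / K')) + (1 - 4 * max (a / K) (b / K')) * G := by
  set q := max (a / K) (b / K') with hq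
  have hq0 : 0 ≤ q := le_max_of_le_left (by positivity)
  have hqq : q ≤ q₀ := max_le haq hbq
  rw [entropyTwo_eq_binEntropy]
  have hhalf : q ≤ 2⁻¹ := by norm_num; linarith
  have hmono := Real.binEntropy_strictMonoOn.monotoneOn
  have hA : Real.binEntropy (a / K) ≤ Real.binEntropy q :=
    hmono ⟨by positivity, (le_max_left _ _).trans hhalf⟩ ⟨hq0, hhalf⟩ (le_max_left _ _)
  have hB : Real.binEntropy (b / K') ≤ Real.binEntropy q :=
    hmono ⟨by positivity, (le_max_right _ _).trans hhalf⟩ ⟨hq0, hhalf⟩ (le_max_right _ _)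
  have hq1 : 0 ≤ Real.binEntropy q := Real.binEntropy_nonneg hq0 (by linarith)
  have hq2 : Real.binEntropy q ≤ 1 := Real.binEntropy_le_log_two.trans (by
    have := Real.log_two_lt_d9
    linarith)
  have hηK : 0 < η * K := by positivity
  have e1 : K * Real.binEntropy (a / K) ≤ K * Real.binEntropy q := by gcongr
  have e2 : K' * Real.binEntropy (b / K') ≤ K * Real.binEntropy q + η * K := by
    calc _ ≤ K' * Real.binEntropy q := by gcongr
      _ ≤ (K + η * K) * Real.binEntropy q := by gcongr
      _ = K * Real.binEntropy q + η * K * Real.binEntropy q := by ring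
      _ ≤ _ := by linarith [mul_le_of_le_one_right hηK.le hq2]
  have e3 : N * G ≤ K * ((1 - 4 * q) * G) + 6 * (η * K) := by
    have t1 := mul_le_mul_of_nonpos_right hN hG
    have t2 := mul_le_mul_of_nonneg_left hG' hηK.le
    linarith
  -- The error 8 is 1 from the assumption, 1 from replacing `K'` by `K`, and 6 from the error in `N`
  -- times `|G| ≤ 3`.
  have e4 : 0 ≤ K * (2 * Real.binEntropy q + (1 - 4 * q) * G + 8 * η) := by linarith
  have := nonneg_of_mul_nonneg_right e4 hK
  linarith

/-- The lower bound for the mean gain of the short blocks and the upper bound for the mean loss of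
the long blocks. -/
lemma gain_and_loss_bounds {q η K a b S L inc dec r1 r2 : ℝ} {c : Fin 3 → Fin 3 → ℝ}
    (hc : ∀ i j, 0 ≤ c i j) (hη : 0 < η) (hη1 : η ≤ 1 / 144) (hK : 0 < K) (hq0 : 0 ≤ q)
    (hq1 : q ≤ 1 / 24) (haK : a ≤ q * K) (hbK : b ≤ q * K + η * K / 24)
    (hK2 : 2 ≤ η * K) (hS : K / 3 - η * K ≤ S) (hL : K / 3 - η * K ≤ L)
    (hSpos : 0 < S) (hLpos : 0 < L)
    (hn0 : 0 < c 0 0 + c 0 1 + c 0 2) (hn2 : 0 < c 2 0 + c 2 1 + c 2 2)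
    (hr1 : r1 = (c 0 1 + c 0 2) / (c 0 0 + c 0 1 + c 0 2))
    (hr2 : r2 = c 2 2 / (c 2 0 + c 2 1 + c 2 2))
    (h1 : S ≤ inc + c 0 0 + 3 * a + 2) (h2 : c 0 1 + c 0 2 ≤ inc)
    (h3 : dec ≤ c 2 2 + b + 2) (h4 : dec + (c 2 0 + c 2 1) ≤ L) :
    r1 * (1 - 9 * q) - 6 * η ≤ inc / S ∧ dec / L ≤ r2 * (1 - 3 * q) + 3 * q + 6 * η := by
  set n0 := c 0 0 + c 0 1 + c 0 2 with hn0d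
  set n2 := c 2 0 + c 2 1 + c 2 2 with hn2d
  have hηK : 0 < η * K := by positivity
  have hr1n : r1 * n0 = c 0 1 + c 0 2 := hr1 ▸ div_mul_cancel₀ _ hn0.ne'
  have hr2n : r2 * n2 = c 2 2 := hr2 ▸ div_mul_cancel₀ _ hn2.ne'
  have hr10 : 0 ≤ r1 := hr1 ▸ div_nonneg (add_nonneg (hc _ _) (hc _ _)) hn0.le
  have hr11 : r1 ≤ 1 := hr1 ▸ (div_le_one hn0).2 (by linarith [hc 0 0])
  have hr20 : 0 ≤ r2 := hr2 ▸ div_nonneg (hc _ _) hn2.le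
  have hr21 : r2 ≤ 1 := hr2 ▸ (div_le_one hn2).2 (by linarith [hc 2 0, hc 2 1])
  -- With `V = S - 3a - 2` there are two bounds, `inc ≥ r1 n0` and `inc ≥ V - (1 - r1) n0`. The
  -- first suffices if `n0 ≥ V`, the second otherwise. The bound for `dec` is obtained in the same
  -- way.
  have hinc : r1 * (S - 3 * a - 2) ≤ inc := by
    by_cases hV : S - 3 * a - 2 ≤ n0
    · calc r1 * (S - 3 * a - 2) ≤ r1 * n0 := by gcongr
        _ ≤ inc := by rw [hr1n]; exact h2
    · have : (1 - r1) * n0 ≤ (1 - r1) * (S - 3 * a - 2) := by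
        apply mul_le_mul_of_nonneg_left (not_le.1 hV).le
        linarith
      linarith
  have hdec : dec ≤ r2 * (L - b) + b + 2 := by
    by_cases hV : n2 ≤ L - b
    · have : r2 * n2 ≤ r2 * (L - b) := by gcongr
      linarith
    · have : (1 - r2) * (L - b) ≤ (1 - r2) * n2 := by
        apply mul_le_mul_of_nonneg_left (not_le.1 hV).le
        linarith
      linarith
  have hηη : η * (η * K) ≤ 1 / 144 * (η * K) := by gcongr
  have hqη : q * (η * K) ≤ 1 / 24 * (η * K) := by gcongr
  have hincS : r1 * (1 - 9 * q) - 6 * η ≤ inc / S := by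
    rw [le_div_iff₀ hSpos]
    refine le_trans ?_ hinc
    -- Short blocks are about a third of all blocks, so `3a ≤ 3qK` becomes about `9qS`.
    have t0 : 3 * a + 2 ≤ 9 * q * S + 6 * η * S := by
      have t1 : q * (K / 3 - η * K) ≤ q * S := by gcongr
      have t2 : η * (K / 3 - η * K) ≤ η * S := by gcongr
      linarith
    have t1 : r1 * (3 * a + 2) ≤ r1 * (9 * q * S + 6 * η * S) := by gcongr
    have t2 : r1 * (6 * η * S) ≤ 6 * η * S := mul_le_of_le_one_left (by positivity) hr11
    linarith
  have hdecL : dec / L ≤ r2 * (1 - 3 * q) + 3 * q + 6 * η := by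
    rw [div_le_iff₀ hLpos]
    refine hdec.trans ?_
    have t1 : q * (K / 3 - η * K) ≤ q * L := by gcongr
    have t2 : η * (K / 3 - η * K) ≤ η * L := by gcongr
    have t3 : b ≤ 3 * q * L + η * L := by linarith
    have t4 : (1 - r2) * b ≤ (1 - r2) * (3 * q * L + η * L) :=
      mul_le_mul_of_nonneg_left t3 (by linarith)
    have t5 : (1 - r2) * (η * L) ≤ η * L := mul_le_of_le_one_left (by positivity) (by linarith)
    linarith
  exact ⟨hincS, hdecL⟩

/-- The lower bound for the mean change in terms of the numbers of blocks of the different kinds,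
up to an error that is controlled by `η`. -/
lemma le_div_sub_div {q₀ ε δ η : ℝ} (hq₀ : q₀ < 1 / 24) (hη : 0 < η)
    (hη1 : η ≤ 1 / 144) (hη2 : η ≤ ε / 24) (hη3 : 8 * η ≤ δ)
    (hobj : ∀ z ∈ weaklyFeasible q₀,
      -δ ≤ 2 * entropyTwo z.2 + (1 - 4 * z.2) * (Real.log (1 / 9) + entropy z.1) →
      3 / 2 * ε ≤ objective z.1 z.2)
    {K K' a b S L N inc dec : ℝ} {c : Fin 3 → Fin 3 → ℝ} (hK : 0 < K) (hK' : 0 < K')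
    (ha : 0 ≤ a) (hb : 0 ≤ b) (hc : ∀ i j, 0 ≤ c i j) (hcN : ∑ i, ∑ j, c i j = N) (hNK : N ≤ K)
    (haq : a / K ≤ q₀) (hbq : b / K' ≤ q₀) (hKK : |K' - K| ≤ η * K) (hK2 : 2 ≤ η * K)
    (hS : |S - K / 3| ≤ η * K) (hL : |L - K / 3| ≤ η * K)
    (hent : -(η * K) ≤ K * Real.binEntropy (a / K) + K' * Real.binEntropy (b / K') +
      N * (Real.log (1 / 9) + entropy fun i j => c i j / N))
    (h1 : S ≤ inc + c 0 0 + 3 * a + 2) (h2 : c 0 1 + c 0 2 ≤ inc)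
    (h3 : dec ≤ c 2 2 + b + 2) (h4 : dec + (c 2 0 + c 2 1) ≤ L)
    (h5 : S ≤ c 0 0 + c 0 1 + c 0 2 + 3 * a + b + 2)
    (h6 : L ≤ c 2 0 + c 2 1 + c 2 2 + 3 * a + b + 2)
    (h7 : K ≤ N + 3 * a + b + 2) :
    0 < S ∧ 0 < L ∧ ε ≤ inc / S - dec / L := by
  set q := max (a / K) (b / K') with hq
  have hq0 : 0 ≤ q := le_max_of_le_left (by positivity)
  have hqq : q ≤ q₀ := max_le haq hbq
  have haK : a ≤ q * K := (div_le_iff₀ hK).1 (le_max_left _ _)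
  have hbK' : b ≤ q * K' := (div_le_iff₀ hK').1 (le_max_right _ _)
  rw [abs_le] at hKK hS hL
  have hηK : 0 < η * K := by positivity
  have hqK : 0 ≤ q * K := by positivity
  have hbK : b ≤ q * K + η * K / 24 := by
    have : q * K' ≤ q * (K + η * K) := by gcongr; linarith
    have : q * (η * K) ≤ 1 / 24 * (η * K) := by gcongr; linarith
    linarith
  have hqK24 : q * K ≤ K / 24 := by
    have : q * K ≤ 1 / 24 * K := by gcongr; linarith
    linarith
  have hη144 : η * K ≤ K / 144 := by
    have : η * K ≤ 1 / 144 * K := by gcongr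
    linarith
  have hSpos : 0 < S := by linarith
  have hLpos : 0 < L := by linarith
  have hNpos : 0 < N := by linarith
  set n0 := c 0 0 + c 0 1 + c 0 2 with hn0
  set n2 := c 2 0 + c 2 1 + c 2 2 with hn2
  have hmass : (1 / 3 - q₀) / 2 * N ≤ (1 / 3 - q₀) / 2 * K := by
    have : 0 ≤ (1 / 3 - q₀) / 2 := by linarith
    gcongr
  have hq₀K : q₀ * K ≤ K / 24 := by
    have : q₀ * K ≤ 1 / 24 * K := by gcongr
    linarith
  have hqq₀K : q * K ≤ q₀ * K := by gcongr
  -- About `(1/3 - 4q) K` pairs remain. As `q ≤ q₀ < 1/24`, this exceeds half of `(1/3 - q₀) K`,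
  -- with room for the errors since `η ≤ 1/144`.
  have hn0ge : (1 / 3 - q₀) / 2 * K ≤ n0 := by linarith
  have hn2ge : (1 / 3 - q₀) / 2 * K ≤ n2 := by linarith
  have hmpos : 0 < (1 / 3 - q₀) / 2 * K := by
    have : 0 < (1 / 3 - q₀) / 2 := by linarith
    positivity
  have hn0pos : 0 < n0 := by linarith
  have hn2pos : 0 < n2 := by linarith
  set p : Fin 3 → Fin 3 → ℝ := fun i j => c i j / N with hp
  have hpnn : ∀ i j, 0 ≤ p i j := fun i j => div_nonneg (hc i j) hNpos.le
  have hpsum : ∑ i, ∑ j, p i j = 1 := by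
    simp only [hp, ← Finset.sum_div, hcN]
    exact div_self hNpos.ne'
  have hp1 : ∀ i j, p i j ≤ 1 := fun i j => by
    calc p i j ≤ ∑ j, p i j := Finset.single_le_sum (fun j _ => hpnn i j) (Finset.mem_univ j)
      _ ≤ ∑ i, ∑ j, p i j := Finset.single_le_sum (f := fun i => ∑ j, p i j)
          (fun i _ => Finset.sum_nonneg fun j _ => hpnn i j) (Finset.mem_univ i)
      _ = 1 := hpsum
  have hweak : (p, q) ∈ weaklyFeasible q₀ := by
    refine ⟨⟨hq0, hqq⟩, ?_, ?_, hpnn, hpsum⟩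
    · simp only [hp, ← Finset.sum_div]
      rw [Fin.sum_univ_three, le_div_iff₀ hNpos]
      linarith
    · simp only [hp, ← Finset.sum_div]
      rw [Fin.sum_univ_three, le_div_iff₀ hNpos]
      linarith
  have hG : Real.log (1 / 9) + entropy p ≤ 0 := entropy_le_log_nine hpnn hpsum
  have hG' : -3 ≤ Real.log (1 / 9) + entropy p := by
    have h9 : Real.log 9 ≤ 3 := by
      rw [Real.log_le_iff_le_exp (by norm_num)]
      have := Real.exp_one_gt_d9
      calc (9 : ℝ) ≤ 2.7 ^ 3 := by norm_num
        _ ≤ Real.exp 1 ^ 3 := by gcongr; linarith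
        _ = Real.exp 3 := by rw [← Real.exp_nat_mul]; norm_num
    have : Real.log (1 / 9) = -Real.log 9 := by rw [one_div, Real.log_inv]
    have := entropy_nonneg hpnn hp1
    linarith
  have hentq : -δ ≤ 2 * entropyTwo q + (1 - 4 * q) * (Real.log (1 / 9) + entropy p) := by
    have := neg_le_entropy_of_counts hq₀ hη hK hK' ha hb haq hbq (by linarith) (by linarith) hG
      hG' hent
    linarith
  have hfinal := hobj (p, q) hweak hentq
  have hobjeq : objective p q =
      (c 0 1 + c 0 2) / n0 * (1 - 9 * q) - c 2 2 / n2 * (1 - 3 * q) - 3 * q := by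
    simp only [objective, hp, ← add_div]
    rw [div_div_div_cancel_right₀ hNpos.ne', div_div_div_cancel_right₀ hNpos.ne']
  -- The two errors of `6η` sum to at most `ε/2`, since `η ≤ ε/24`.
  obtain ⟨hincS, hdecL⟩ := gain_and_loss_bounds hc hη hη1 hK hq0 (by linarith) haK hbK hK2
    (by linarith) (by linarith) hSpos hLpos hn0pos hn2pos rfl rfl h1 h2 h3 h4
  refine ⟨hSpos, hLpos, ?_⟩
  simp only at hfinal
  rw [hobjeq] at hfinal
  linarith

/-! ### Counting by entropy -/

lemma pow_eq_exp_of_div {m K : ℝ} {r : ℕ} (hm : (r : ℝ) = m) (hK : 0 < K) :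
    (m / K) ^ r = Real.exp (m * Real.log (m / K)) := by
  rcases Nat.eq_zero_or_pos r with h | h
  · subst h
    simp [← hm]
  · have hmpos : 0 < m / K := by
      rw [← hm]
      positivity
    rw [← hm] at hmpos ⊢
    rw [Real.exp_nat_mul, Real.exp_log hmpos]

/-- The right side is the probability of a word with letter counts `c` when its letters are drawn
independently with frequencies `c / N`. Unused letters contribute `0 ^ 0 = 1`. -/
lemma exp_neg_entropy_eq_prod {N : ℝ} (hN : 0 < N) (c : Fin 3 → Fin 3 → ℕ) :
    Real.exp (-(N * entropy fun i j => (c i j : ℝ) / N)) =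
      ∏ i, ∏ j, ((c i j : ℝ) / N) ^ c i j := by
  simp only [pow_eq_exp_of_div rfl hN, ← Real.exp_sum]
  congr 1
  rw [entropy, Finset.mul_sum, ← Finset.sum_neg_distrib]
  refine Finset.sum_congr rfl fun i _ => ?_
  rw [Finset.mul_sum, ← Finset.sum_neg_distrib]
  refine Finset.sum_congr rfl fun j _ => ?_
  rw [one_div, Real.log_inv]
  field_simp

/-- The number of words with given letter counts is at most the exponential of the entropy. -/
lemma card_words_le {ι : Type*} [Fintype ι] [DecidableEq ι] (c : Fin 3 → Fin 3 → ℕ)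
    (hc : ∑ i, ∑ j, c i j = Fintype.card ι) :
    (((Finset.univ : Finset (ι → Fin 3 × Fin 3)).filter fun w =>
      ∀ i j, (Finset.univ.filter fun e => w e = (i, j)).card = c i j).card : ℝ) ≤
      Real.exp ((Fintype.card ι : ℝ) * entropy fun i j => (c i j : ℝ) / (Fintype.card ι : ℝ)) := by
  rcases Nat.eq_zero_or_pos (Fintype.card ι) with h0 | hpos
  · have : IsEmpty ι := Fintype.card_eq_zero_iff.1 h0
    rw [h0, Nat.cast_zero, zero_mul, Real.exp_zero]
    calc _ ≤ ((Finset.univ : Finset (ι → Fin 3 × Fin 3)).card : ℝ) := by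
          exact_mod_cast Finset.card_filter_le _ _
      _ = 1 := by simp
  · have hN : (0 : ℝ) < Fintype.card ι := by exact_mod_cast hpos
    set N : ℝ := ((Fintype.card ι : ℕ) : ℝ) with hNdef
    -- Under the product distribution with frequencies `c / N` all words counted have the same
    -- probability, and the total is 1.
    have hprod : ∀ w : ι → Fin 3 × Fin 3,
        (∀ i j, (Finset.univ.filter fun e => w e = (i, j)).card = c i j) →
        ∏ e, (c (w e).1 (w e).2 : ℝ) / N =
          Real.exp (-(N * entropy fun i j => (c i j : ℝ) / N)) := by
      intro w hw
      rw [exp_neg_entropy_eq_prod hN, ← Finset.prod_fiberwise' Finset.univ w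
        (fun b => (c b.1 b.2 : ℝ) / N), Fintype.prod_prod_type]
      refine Finset.prod_congr rfl fun i _ => Finset.prod_congr rfl fun j _ => ?_
      rw [Finset.prod_const, hw]
    have hsum : ∑ w : ι → Fin 3 × Fin 3, ∏ e, (c (w e).1 (w e).2 : ℝ) / N = 1 := by
      have h1 := Finset.prod_univ_sum (fun _ : ι => (Finset.univ : Finset (Fin 3 × Fin 3)))
        (fun _ b => (c b.1 b.2 : ℝ) / N)
      rw [Fintype.piFinset_univ] at h1
      rw [← h1]
      have h2 : ∑ b : Fin 3 × Fin 3, (c b.1 b.2 : ℝ) / N = 1 := by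
        rw [Fintype.sum_prod_type]
        simp only [← Finset.sum_div]
        rw [div_eq_one_iff_eq hN.ne', hNdef, ← hc]
        push_cast
        rfl
      rw [h2, Finset.prod_const_one]
    set W := (Finset.univ : Finset (ι → Fin 3 × Fin 3)).filter fun w =>
      ∀ i j, (Finset.univ.filter fun e => w e = (i, j)).card = c i j with hW
    have hle : (W.card : ℝ) * Real.exp (-(N * entropy fun i j => (c i j : ℝ) / N)) ≤ 1 := by
      rw [← hsum, ← nsmul_eq_mul, ← Finset.sum_const]
      calc _ = ∑ w ∈ W, ∏ e, (c (w e).1 (w e).2 : ℝ) / N :=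
            Finset.sum_congr rfl fun w hw => (hprod w (Finset.mem_filter.1 hw).2).symm
        _ ≤ _ := Finset.sum_le_sum_of_subset_of_nonneg (Finset.subset_univ _) fun w _ _ =>
            Finset.prod_nonneg fun e _ => by positivity
    rw [Real.exp_neg, ← div_eq_mul_inv, div_le_one (Real.exp_pos _)] at hle
    exact hle

/-- The left side is one term of the binomial expansion of `(x + (1 - x)) ^ K = 1` at `x = m / K`.
-/
lemma choose_mul_exp_le_one {K m : ℕ} (hm : m ≤ K) (hK : 0 < K) :
    (K.choose m : ℝ) * Real.exp (-((K : ℝ) * Real.binEntropy ((m : ℝ) / K))) ≤ 1 := by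
  have hK' : (0 : ℝ) < K := by exact_mod_cast hK
  have hsub : ((K - m : ℕ) : ℝ) = (K : ℝ) - m := Nat.cast_sub hm
  have h1 : 1 - (m : ℝ) / K = ((K : ℝ) - m) / K := by field_simp
  have hexp : Real.exp (-((K : ℝ) * Real.binEntropy ((m : ℝ) / K))) =
      ((m : ℝ) / K) ^ m * (1 - (m : ℝ) / K) ^ (K - m) := by
    rw [h1, pow_eq_exp_of_div rfl hK', pow_eq_exp_of_div hsub hK', ← Real.exp_add, Real.binEntropy,
      h1, Real.log_inv, Real.log_inv]
    congr 1
    field_simp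
    ring
  have hnn : 0 ≤ 1 - (m : ℝ) / K := by
    rw [h1, ← hsub]
    positivity
  have hpow := add_pow ((m : ℝ) / K) (1 - (m : ℝ) / K) K
  rw [add_sub_cancel, one_pow] at hpow
  rw [hexp, mul_comm]
  refine le_of_le_of_eq ?_ hpow.symm
  exact Finset.single_le_sum (f := fun j => ((m : ℝ) / K) ^ j * (1 - (m : ℝ) / K) ^ (K - j) *
    (K.choose j : ℝ)) (fun j _ => by positivity) (Finset.mem_range.2 (Nat.lt_succ_of_le hm))

/-- The weighted number of possible sets of left out blocks. -/
lemma sum_exp_neg_binEntropy_le {K : ℕ} (hK : 0 < K) :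
    ∑ R ∈ (Finset.range K).powerset,
      Real.exp (-((K : ℝ) * Real.binEntropy (((Finset.range K \ R).card : ℝ) / K))) ≤ K + 1 := by
  have h1 : ∀ R ∈ (Finset.range K).powerset,
      Real.exp (-((K : ℝ) * Real.binEntropy (((Finset.range K \ R).card : ℝ) / K))) =
      Real.exp (-((K : ℝ) * Real.binEntropy ((R.card : ℝ) / K))) := by
    intro R hR
    have hR' := Finset.mem_powerset.1 hR
    have hle : R.card ≤ K := by simpa using Finset.card_le_card hR'
    have hK' : (0 : ℝ) < K := by exact_mod_cast hK
    rw [Finset.card_sdiff_of_subset hR', Finset.card_range, Nat.cast_sub hle,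
      ← Real.binEntropy_one_sub ((R.card : ℝ) / K)]
    congr 4
    field_simp
  rw [Finset.sum_congr rfl h1, Finset.sum_powerset_apply_card
    (fun m => Real.exp (-((K : ℝ) * Real.binEntropy ((m : ℝ) / K)))), Finset.card_range]
  calc _ ≤ ∑ m ∈ Finset.range (K + 1), (1 : ℝ) := by
        refine Finset.sum_le_sum fun m hm => ?_
        rw [nsmul_eq_mul]
        exact choose_mul_exp_le_one (Nat.lt_succ_iff.1 (Finset.mem_range.1 hm)) hK
    _ = K + 1 := by simp

/-! ### Probabilities of pair counts -/

/-- The block lengths `l - 1`, `l`, `l + 1` for the indices `0`, `1`, `2`. -/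
def lengthOf (l : ℕ) (i : Fin 3) : ℕ := l - 1 + i

lemma lengthOf_injective (l : ℕ) : Function.Injective (lengthOf l) := by
  intro i j h
  unfold lengthOf at h
  omega

lemma lengthOf_mem {l : ℕ} (hl : 2 ≤ l) (i : Fin 3) :
    lengthOf l i ∈ ({l - 1, l, l + 1} : Finset ℕ) := by
  fin_cases i <;> simp [lengthOf] <;> omega

section Probability

variable {Ω : Type*} [MeasurableSpace Ω] {μ : Measure Ω}
  {l : ℕ} {sX sY : Ω → Bool} {BX BY : ℕ → Ω → ℕ}

/-- Injectivity makes the blocks involved distinct, so independence gives a factor `1/3 · 1/3` for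
each pair. -/
lemma IsBlockModel.measure_pairs_eq (hB : IsBlockModel μ l sX sY BX BY) (hl : 2 ≤ l)
    {ι : Type*} [Fintype ι] {u v : ι → ℕ} (hu : Function.Injective u)
    (hv : Function.Injective v) (w : ι → Fin 3 × Fin 3) :
    μ.real {ω | ∀ e, BX (u e) ω = lengthOf l (w e).1 ∧ BY (v e) ω = lengthOf l (w e).2} =
      (1 / 9) ^ Fintype.card ι := by
  have hindep := hB.indep_lengths.precomp (Function.Injective.sumMap hu hv)
  have h := hindep.measure_inter_preimage_eq_mul Finset.univ
    (sets := fun i => {lengthOf l (Sum.elim (fun e => (w e).1) (fun e => (w e).2) i)})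
    (fun i _ => MeasurableSet.singleton _)
  rw [Fintype.prod_sum_type] at h
  have hX : ∀ e, μ ((fun ω => BX (u e) ω) ⁻¹' {lengthOf l (w e).1}) = 1 / 3 := fun e =>
    hB.law_BX (u e) _ (lengthOf_mem hl _)
  have hY : ∀ e, μ ((fun ω => BY (v e) ω) ⁻¹' {lengthOf l (w e).2}) = 1 / 3 := fun e =>
    hB.law_BY (v e) _ (lengthOf_mem hl _)
  simp only [Sum.map_inl, Sum.map_inr, Sum.elim_inl, Sum.elim_inr] at h
  have hset : {ω | ∀ e, BX (u e) ω = lengthOf l (w e).1 ∧ BY (v e) ω = lengthOf l (w e).2} =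
      ⋂ i ∈ (Finset.univ : Finset (ι ⊕ ι)), (fun ω => Sum.elim BX BY (Sum.map u v i) ω) ⁻¹'
        {lengthOf l (Sum.elim (fun e => (w e).1) (fun e => (w e).2) i)} := by
    ext ω
    simp [forall_and]
  rw [Measure.real, hset]
  refine (congrArg ENNReal.toReal h).trans ?_
  rw [Finset.prod_congr rfl fun e _ => hX e, Finset.prod_congr rfl fun e _ => hY e,
    Finset.prod_const, Finset.card_univ, ← mul_pow, ENNReal.toReal_pow, ENNReal.toReal_mul]
  norm_num

/-- The probability that the pairs of a matching have prescribed type counts. -/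
lemma IsBlockModel.measure_pairCount_eq_le [IsProbabilityMeasure μ]
    (hB : IsBlockModel μ l sX sY BX BY) (hl : 2 ≤ l)
    {M : Finset (ℕ × ℕ)} (h1 : ∀ e ∈ M, ∀ e' ∈ M, e.1 = e'.1 → e = e')
    (h2 : ∀ e ∈ M, ∀ e' ∈ M, e.2 = e'.2 → e = e') (c : Fin 3 → Fin 3 → ℕ)
    (hc : ∑ i, ∑ j, c i j = M.card) :
    μ.real {ω | (∀ e ∈ M, ∃ i j, BX e.1 ω = lengthOf l i ∧ BY e.2 ω = lengthOf l j) ∧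
      ∀ i j, pairCount M (fun k => BX k ω) (fun k => BY k ω) (lengthOf l i) (lengthOf l j) =
        c i j} ≤
      Real.exp ((M.card : ℝ) * (Real.log (1 / 9) + entropy fun i j => (c i j : ℝ) / M.card)) := by
  classical
  have hu : Function.Injective fun e : M => e.1.1 := fun e e' h =>
    Subtype.ext (h1 e.1 e.2 e'.1 e'.2 h)
  have hv : Function.Injective fun e : M => e.1.2 := fun e e' h =>
    Subtype.ext (h2 e.1 e.2 e'.1 e'.2 h)
  set W := (Finset.univ : Finset (M → Fin 3 × Fin 3)).filter fun w =>
      ∀ i j, (Finset.univ.filter fun e => w e = (i, j)).card = c i j with hW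
  have hcard : Fintype.card M = M.card := Fintype.card_coe M
  have hsub : {ω | (∀ e ∈ M, ∃ i j, BX e.1 ω = lengthOf l i ∧ BY e.2 ω = lengthOf l j) ∧
      ∀ i j, pairCount M (fun k => BX k ω) (fun k => BY k ω) (lengthOf l i) (lengthOf l j) =
        c i j} ⊆ ⋃ w ∈ W, {ω | ∀ e : M, BX e.1.1 ω = lengthOf l (w e).1 ∧
          BY e.1.2 ω = lengthOf l (w e).2} := by
    -- The word `w` records the types of all pairs. There are at most `exp (N H)` words with the
    -- given counts, each of probability `9 ^ (-N)`.
    rintro ω ⟨hω1, hω2⟩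
    have hex : ∀ e : M, ∃ b : Fin 3 × Fin 3, BX e.1.1 ω = lengthOf l b.1 ∧
        BY e.1.2 ω = lengthOf l b.2 := fun e => by
      obtain ⟨i, j, h⟩ := hω1 e.1 e.2
      exact ⟨(i, j), h⟩
    choose w hw using hex
    simp only [Set.mem_iUnion]
    refine ⟨w, ?_, hw⟩
    refine Finset.mem_filter.2 ⟨Finset.mem_univ _, fun i j => ?_⟩
    rw [← hω2 i j, pairCount]
    have : (M.filter fun e => BX e.1 ω = lengthOf l i ∧ BY e.2 ω = lengthOf l j) =
        (Finset.univ.filter fun e : M => w e = (i, j)).map (Function.Embedding.subtype _) := by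
      ext e
      simp only [Finset.mem_filter, Finset.mem_map, Finset.mem_univ, true_and,
        Function.Embedding.coe_subtype]
      constructor
      · rintro ⟨he, hx, hy⟩
        refine ⟨⟨e, he⟩, ?_, rfl⟩
        have := hw ⟨e, he⟩
        exact Prod.ext (lengthOf_injective l (this.1.symm.trans hx))
          (lengthOf_injective l (this.2.symm.trans hy))
      · rintro ⟨e', he', rfl⟩
        have := hw e'
        rw [he'] at this
        exact ⟨e'.2, this⟩
    rw [this, Finset.card_map]
  calc _ ≤ μ.real (⋃ w ∈ W, {ω | ∀ e : M, BX e.1.1 ω = lengthOf l (w e).1 ∧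
          BY e.1.2 ω = lengthOf l (w e).2}) := measureReal_mono hsub (measure_ne_top _ _)
    _ ≤ ∑ w ∈ W, (1 / 9 : ℝ) ^ M.card := by
        refine (measureReal_biUnion_finset_le _ _).trans (Finset.sum_le_sum fun w _ => ?_)
        rw [hB.measure_pairs_eq hl hu hv w, hcard]
    _ = W.card * Real.exp (M.card * Real.log (1 / 9)) := by
        rw [Finset.sum_const, nsmul_eq_mul, Real.exp_nat_mul, Real.exp_log (by norm_num)]
    _ ≤ Real.exp (M.card * entropy fun i j => (c i j : ℝ) / M.card) *
          Real.exp (M.card * Real.log (1 / 9)) := by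
        gcongr
        have := card_words_le (ι := M) c (by rw [hc, hcard])
        rwa [hcard] at this
    _ = _ := by
        rw [← Real.exp_add, mul_add, add_comm]

end Probability

/-- The logarithm of the number of ways to choose the set of left out blocks. -/
noncomputable def leftOutEntropy (K : ℕ) (R : Finset ℕ) : ℝ :=
  (K : ℝ) * Real.binEntropy (((Finset.range K \ R).card : ℝ) / K)

/-- The logarithm of the probability of the observed type counts of the pairs in `M`. -/
noncomputable def pairEntropy (l : ℕ) (M : Finset (ℕ × ℕ)) (f g : ℕ → ℕ) : ℝ :=
  (M.card : ℝ) * (Real.log (1 / 9) +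
    entropy fun i j => (pairCount M f g (lengthOf l i) (lengthOf l j) : ℝ) / M.card)

lemma card_innerPairs_le (k k' : ℕ) (R R' : Finset ℕ) : (innerPairs k k' R R').card ≤ k := by
  rw [← card_image_fst_innerPairs (subset_refl (innerPairs k k' R R'))]
  calc _ ≤ (Finset.range k).card := by
        apply Finset.card_le_card
        intro i hi
        obtain ⟨e, he, rfl⟩ := Finset.mem_image.1 hi
        exact Finset.mem_range.2 (Finset.mem_filter.1 he).2.1
    _ = k := Finset.card_range k

lemma sum_pairCount_eq_card (l : ℕ) {M : Finset (ℕ × ℕ)} {f g : ℕ → ℕ}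
    (h : ∀ e ∈ M, ∃ i j, f e.1 = lengthOf l i ∧ g e.2 = lengthOf l j) :
    ∑ i, ∑ j, pairCount M f g (lengthOf l i) (lengthOf l j) = M.card := by
  classical
  have hex : ∀ e : ℕ × ℕ, ∃ b : Fin 3 × Fin 3, e ∈ M →
      f e.1 = lengthOf l b.1 ∧ g e.2 = lengthOf l b.2 := by
    intro e
    by_cases he : e ∈ M
    · obtain ⟨i, j, hij⟩ := h e he
      exact ⟨(i, j), fun _ => hij⟩
    · exact ⟨(0, 0), fun h' => absurd h' he⟩
  choose w hw using hex
  rw [Finset.card_eq_sum_card_fiberwise (f := w) (t := Finset.univ) (fun _ _ => by simp),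
    Fintype.sum_prod_type]
  refine Finset.sum_congr rfl fun i _ => Finset.sum_congr rfl fun j _ => ?_
  rw [pairCount]
  congr 1
  apply Finset.filter_congr
  intro e he
  obtain ⟨h1, h2⟩ := hw e he
  rw [h1, h2, (lengthOf_injective l).eq_iff, (lengthOf_injective l).eq_iff, ← Prod.mk_inj]

section Probability

variable {Ω : Type*} [MeasurableSpace Ω] {μ : Measure Ω} [IsProbabilityMeasure μ]
  {l : ℕ} {sX sY : Ω → Bool} {BX BY : ℕ → Ω → ℕ}

/-- The nine type counts take at most `(n + 1) ^ 9` values, and each admissible value has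
probability at most `exp r`. -/
lemma IsBlockModel.measure_pairEntropy_lt_le (hB : IsBlockModel μ l sX sY BX BY) (hl : 2 ≤ l)
    {k k' n : ℕ} (hk : k < n) (R R' : Finset ℕ) (r : ℝ) :
    μ.real {ω | (∀ i, ∃ x, BX i ω = lengthOf l x) ∧ (∀ i, ∃ x, BY i ω = lengthOf l x) ∧
      pairEntropy l (innerPairs k k' R R') (fun i => BX i ω) (fun i => BY i ω) < r} ≤
      ((n : ℝ) + 1) ^ 9 * Real.exp r := by
  classical
  set M := innerPairs k k' R R' with hM
  have hMn : M.card < n + 1 := by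
    have : M.card ≤ k := card_innerPairs_le k k' R R'
    omega
  set S := (Finset.univ : Finset (Fin 3 → Fin 3 → Fin (n + 1))).filter fun c =>
    ∑ i, ∑ j, (c i j : ℕ) = M.card ∧ (M.card : ℝ) * (Real.log (1 / 9) +
      entropy fun i j => ((c i j : ℕ) : ℝ) / M.card) < r with hS
  set E : (Fin 3 → Fin 3 → Fin (n + 1)) → Set Ω := fun c =>
    {ω | (∀ e ∈ M, ∃ i j, BX e.1 ω = lengthOf l i ∧ BY e.2 ω = lengthOf l j) ∧
      ∀ i j, pairCount M (fun k => BX k ω) (fun k => BY k ω) (lengthOf l i) (lengthOf l j) =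
        c i j} with hE
  have hsub : {ω | (∀ i, ∃ x, BX i ω = lengthOf l x) ∧ (∀ i, ∃ x, BY i ω = lengthOf l x) ∧
      pairEntropy l M (fun i => BX i ω) (fun i => BY i ω) < r} ⊆ ⋃ c ∈ S, E c := by
    rintro ω ⟨hx, hy, hlt⟩
    have hall : ∀ e ∈ M, ∃ i j, BX e.1 ω = lengthOf l i ∧ BY e.2 ω = lengthOf l j := fun e _ => by
      obtain ⟨i, hi⟩ := hx e.1
      obtain ⟨j, hj⟩ := hy e.2
      exact ⟨i, j, hi, hj⟩
    obtain ⟨c, hc⟩ : ∃ c : Fin 3 → Fin 3 → Fin (n + 1), ∀ i j,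
        pairCount M (fun k => BX k ω) (fun k => BY k ω) (lengthOf l i) (lengthOf l j) = c i j :=
      ⟨fun i j => ⟨_, (Finset.card_filter_le _ _).trans_lt hMn⟩, fun i j => rfl⟩
    have h1 := sum_pairCount_eq_card l (f := fun k => BX k ω) (g := fun k => BY k ω) hall
    unfold pairEntropy at hlt
    simp only [hc] at h1 hlt
    simp only [Set.mem_iUnion]
    refine ⟨c, ?_, hall, hc⟩
    rw [hS, Finset.mem_filter]
    exact ⟨Finset.mem_univ _, h1, hlt⟩
  have hbound : ∀ c ∈ S, μ.real (E c) ≤ Real.exp r := by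
    intro c hc
    obtain ⟨-, hc1, hc2⟩ := Finset.mem_filter.1 hc
    refine (hB.measure_pairCount_eq_le hl ?_ ?_ (fun i j => (c i j : ℕ)) hc1).trans
      (Real.exp_le_exp.2 hc2.le)
    · exact fun e he e' he' h => fst_injOn_singlePairs (Finset.mem_filter.1 he).1
        (Finset.mem_filter.1 he').1 h
    · exact fun e he e' he' h => snd_injOn_singlePairs (Finset.mem_filter.1 he).1
        (Finset.mem_filter.1 he').1 h
  calc _ ≤ μ.real (⋃ c ∈ S, E c) := measureReal_mono hsub (measure_ne_top _ _)
    _ ≤ ∑ c ∈ S, Real.exp r :=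
        (measureReal_biUnion_finset_le _ _).trans (Finset.sum_le_sum hbound)
    _ = S.card * Real.exp r := by rw [Finset.sum_const, nsmul_eq_mul]
    _ ≤ _ := by
        gcongr
        have : S.card ≤ (n + 1) ^ 9 := by
          refine (Finset.card_le_univ S).trans ?_
          simp only [Fintype.card_pi, Fintype.card_fin, Finset.prod_const, Finset.card_univ]
          rw [← pow_mul]
        exact_mod_cast this

/-- With high probability, the entropy constraint holds simultaneously for all possible sets of
left out blocks. -/
theorem IsBlockModel.measure_entropy_lt_le (hB : IsBlockModel μ l sX sY BX BY) (hl : 2 ≤ l)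
    (n : ℕ) (r : ℝ) :
    μ.real {ω | (∀ i, ∃ x, BX i ω = lengthOf l x) ∧ (∀ i, ∃ x, BY i ω = lengthOf l x) ∧
      ∃ k < n, ∃ k' < n, ∃ R ⊆ Finset.range (k + 1), ∃ R' ⊆ Finset.range (k' + 1),
        leftOutEntropy (k + 1) R + leftOutEntropy (k' + 1) R' +
        pairEntropy l (innerPairs k k' R R') (fun i => BX i ω) (fun i => BY i ω) < r} ≤
      ((n : ℝ) + 1) ^ 13 * Real.exp r := by
  set E : ℕ → ℕ → Finset ℕ → Finset ℕ → Set Ω := fun k k' R R' =>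
    {ω | (∀ i, ∃ x, BX i ω = lengthOf l x) ∧ (∀ i, ∃ x, BY i ω = lengthOf l x) ∧
      pairEntropy l (innerPairs k k' R R') (fun i => BX i ω) (fun i => BY i ω) <
        r - leftOutEntropy (k + 1) R - leftOutEntropy (k' + 1) R'} with hE
  have hsub : {ω | (∀ i, ∃ x, BX i ω = lengthOf l x) ∧ (∀ i, ∃ x, BY i ω = lengthOf l x) ∧
      ∃ k < n, ∃ k' < n, ∃ R ⊆ Finset.range (k + 1), ∃ R' ⊆ Finset.range (k' + 1),
        leftOutEntropy (k + 1) R + leftOutEntropy (k' + 1) R' +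
        pairEntropy l (innerPairs k k' R R') (fun i => BX i ω) (fun i => BY i ω) < r} ⊆
      ⋃ k ∈ Finset.range n, ⋃ k' ∈ Finset.range n, ⋃ R ∈ (Finset.range (k + 1)).powerset,
        ⋃ R' ∈ (Finset.range (k' + 1)).powerset, E k k' R R' := by
    rintro ω ⟨hx, hy, k, hk, k', hk', R, hR, R', hR', hlt⟩
    simp only [Set.mem_iUnion]
    exact ⟨k, Finset.mem_range.2 hk, k', Finset.mem_range.2 hk', R, Finset.mem_powerset.2 hR, R',
      Finset.mem_powerset.2 hR', hx, hy, by linarith⟩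
  -- Shifting the threshold by the left out entropies weights each `R` by `exp (-leftOutEntropy)`,
  -- and these weights sum to at most `n + 1`.
  have hsum : ∀ k < n, ∑ R ∈ (Finset.range (k + 1)).powerset,
      Real.exp (-leftOutEntropy (k + 1) R) ≤ (n : ℝ) + 1 := fun k hk => by
    have h1 := sum_exp_neg_binEntropy_le (Nat.succ_pos k)
    refine h1.trans ?_
    have : k + 1 ≤ n := hk
    gcongr
  calc _ ≤ μ.real _ := measureReal_mono hsub (measure_ne_top _ _)
    _ ≤ ∑ k ∈ Finset.range n, ∑ k' ∈ Finset.range n, ∑ R ∈ (Finset.range (k + 1)).powerset,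
        ∑ R' ∈ (Finset.range (k' + 1)).powerset, μ.real (E k k' R R') := by
        refine (measureReal_biUnion_finset_le _ _).trans (Finset.sum_le_sum fun k _ => ?_)
        refine (measureReal_biUnion_finset_le _ _).trans (Finset.sum_le_sum fun k' _ => ?_)
        refine (measureReal_biUnion_finset_le _ _).trans (Finset.sum_le_sum fun R _ => ?_)
        exact measureReal_biUnion_finset_le _ _
    _ ≤ ∑ k ∈ Finset.range n, ∑ k' ∈ Finset.range n,
        ((n : ℝ) + 1) ^ 9 * Real.exp r * (((n : ℝ) + 1) * ((n : ℝ) + 1)) := by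
        refine Finset.sum_le_sum fun k hk => Finset.sum_le_sum fun k' hk' => ?_
        have hk := Finset.mem_range.1 hk
        have hk' := Finset.mem_range.1 hk'
        calc _ ≤ ∑ R ∈ (Finset.range (k + 1)).powerset, ∑ R' ∈ (Finset.range (k' + 1)).powerset,
              ((n : ℝ) + 1) ^ 9 * Real.exp r * (Real.exp (-leftOutEntropy (k + 1) R) *
                Real.exp (-leftOutEntropy (k' + 1) R')) := by
              refine Finset.sum_le_sum fun R _ => Finset.sum_le_sum fun R' _ => ?_
              refine (hB.measure_pairEntropy_lt_le hl hk R R' _).trans_eq ?_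
              rw [mul_assoc, ← Real.exp_add, ← Real.exp_add]
              congr 2
              ring
          _ = ((n : ℝ) + 1) ^ 9 * Real.exp r *
              ((∑ R ∈ (Finset.range (k + 1)).powerset, Real.exp (-leftOutEntropy (k + 1) R)) *
              ∑ R' ∈ (Finset.range (k' + 1)).powerset, Real.exp (-leftOutEntropy (k' + 1) R')) := by
              rw [Finset.sum_mul_sum, Finset.mul_sum]
              refine Finset.sum_congr rfl fun R _ => ?_
              rw [Finset.mul_sum]
          _ ≤ _ := by
              gcongr
              · exact hsum k hk
              · exact hsum k' hk'
    _ = (n : ℝ) * n * (((n : ℝ) + 1) ^ 9 * Real.exp r * (((n : ℝ) + 1) * ((n : ℝ) + 1))) := by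
        simp only [Finset.sum_const, Finset.card_range, nsmul_eq_mul]
        ring
    _ ≤ ((n : ℝ) + 1) * ((n : ℝ) + 1) *
        (((n : ℝ) + 1) ^ 9 * Real.exp r * (((n : ℝ) + 1) * ((n : ℝ) + 1))) := by
        gcongr <;> linarith
    -- The exponent 13 is 9 for the type counts, 2 for `R` and `R'`, and 2 for `k` and `k'`.
    _ = _ := by ring

/-- Hoeffding's inequality for the number of blocks of a given length, uniformly in the number of
blocks. -/
theorem measure_abs_card_sub_le {B : ℕ → Ω → ℕ} (hmeas : ∀ i, Measurable (B i))
    (hindep : iIndepFun B μ) {v : ℕ} (hlaw : ∀ i, μ {ω | B i ω = v} = 1 / 3) {δ : ℝ} (hδ : 0 < δ)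
    (n : ℕ) :
    μ.real {ω | ∃ k ≤ n,
      δ * n < |((blocksOfLength (fun i => B i ω) k v).card : ℝ) - (k : ℝ) / 3|} ≤
      (n + 1) * (2 * Real.exp (-(2 * δ ^ 2 * n))) := by
  have hφ : Measurable fun b : ℕ => (if b = v then (1 : ℝ) else 0) := measurable_from_top
  have hint : ∀ i, ∫ ω, (if B i ω = v then (1 : ℝ) else 0) ∂μ = 1 / 3 := by
    intro i
    have hset : MeasurableSet {ω | B i ω = v} := hmeas i (MeasurableSet.singleton v)
    have : (fun ω => if B i ω = v then (1 : ℝ) else 0) = Set.indicator {ω | B i ω = v} 1 := by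
      ext ω
      simp [Set.indicator_apply]
    rw [this, integral_indicator_one hset, Measure.real, hlaw]
    norm_num
  -- A variable with values in `[0, 1]` is sub-Gaussian with variance proxy `1/4` after centering.
  have hsubG : ∀ i, HasSubgaussianMGF (fun ω => (if B i ω = v then (1 : ℝ) else 0) - 1 / 3)
      (1 / 4) μ := by
    intro i
    have h := hasSubgaussianMGF_of_mem_Icc (μ := μ) (a := 0) (b := 1)
      (X := fun ω => if B i ω = v then (1 : ℝ) else 0) (hφ.comp (hmeas i)).aemeasurable
      (Eventually.of_forall fun ω => by by_cases h : B i ω = v <;> simp [h])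
    rw [hint i] at h
    convert h using 1
    norm_num
  have hindep1 : iIndepFun (fun i ω => (if B i ω = v then (1 : ℝ) else 0) - 1 / 3) μ :=
    hindep.comp (fun _ b => (if b = v then (1 : ℝ) else 0) - 1 / 3) fun _ => measurable_from_top
  have hindep2 : iIndepFun (fun i ω => -((if B i ω = v then (1 : ℝ) else 0) - 1 / 3)) μ :=
    hindep.comp (fun _ b => -((if b = v then (1 : ℝ) else 0) - 1 / 3)) fun _ => measurable_from_top
  have hcardsum : ∀ k ω, ((blocksOfLength (fun i => B i ω) k v).card : ℝ) - (k : ℝ) / 3 =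
      ∑ i ∈ Finset.range k, ((if B i ω = v then (1 : ℝ) else 0) - 1 / 3) := by
    intro k ω
    rw [Finset.sum_sub_distrib, Finset.sum_boole, blocksOfLength]
    simp
    ring
  have hδn : (0 : ℝ) ≤ δ * n := by positivity
  have hbound : ∀ k ≤ n, 0 < k →
      Real.exp (-(δ * n) ^ 2 / (2 * k * ((1 / 4 : NNReal) : ℝ))) ≤
        Real.exp (-(2 * δ ^ 2 * n)) := by
    intro k hk hk0
    apply Real.exp_le_exp.2
    have hk' : (0 : ℝ) < k := by exact_mod_cast hk0
    have hkn : (k : ℝ) ≤ n := by exact_mod_cast hk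
    rw [div_le_iff₀ (by push_cast; positivity)]
    push_cast
    have : δ ^ 2 * (n * k) ≤ δ ^ 2 * (n * n) := by gcongr
    nlinarith
  have hsub : {ω | ∃ k ≤ n,
      δ * n < |((blocksOfLength (fun i => B i ω) k v).card : ℝ) - (k : ℝ) / 3|} ⊆
      ⋃ k ∈ Finset.range (n + 1), {ω | 0 < k ∧
        δ * n < |((blocksOfLength (fun i => B i ω) k v).card : ℝ) - (k : ℝ) / 3|} := by
    rintro ω ⟨k, hk, h⟩
    simp only [Set.mem_iUnion]
    refine ⟨k, Finset.mem_range.2 (by omega), ?_, h⟩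
    rcases Nat.eq_zero_or_pos k with rfl | hpos
    · simp [blocksOfLength] at h
      linarith
    · exact hpos
  calc _ ≤ μ.real _ := measureReal_mono hsub (measure_ne_top _ _)
    _ ≤ ∑ k ∈ Finset.range (n + 1), 2 * Real.exp (-(2 * δ ^ 2 * n)) := by
        refine (measureReal_biUnion_finset_le _ _).trans (Finset.sum_le_sum fun k hk => ?_)
        have hk := Nat.lt_succ_iff.1 (Finset.mem_range.1 hk)
        by_cases hk0 : 0 < k
        · have h1 := HasSubgaussianMGF.measure_sum_range_ge_le_of_iIndepFun hindep1 (n := k) (fun i _ => hsubG i) hδn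
          have h2 := HasSubgaussianMGF.measure_sum_range_ge_le_of_iIndepFun hindep2 (n := k)
            (fun i _ => (hsubG i).neg) hδn
          have hsub2 : {ω | 0 < k ∧
              δ * n < |((blocksOfLength (fun i => B i ω) k v).card : ℝ) - (k : ℝ) / 3|} ⊆
              {ω | δ * n ≤ ∑ i ∈ Finset.range k, ((if B i ω = v then (1 : ℝ) else 0) - 1 / 3)} ∪
              {ω | δ * n ≤
                ∑ i ∈ Finset.range k, -((if B i ω = v then (1 : ℝ) else 0) - 1 / 3)} := by
            rintro ω ⟨-, h⟩
            rw [hcardsum, lt_abs] at h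
            rcases h with h | h
            · exact Or.inl h.le
            · right
              simp only [Set.mem_ofPred_eq, Finset.sum_neg_distrib]
              exact h.le
          calc _ ≤ _ := measureReal_mono hsub2 (measure_ne_top _ _)
            _ ≤ _ := measureReal_union_le _ _
            _ ≤ _ := by linarith [hbound k hk hk0]
        · simp only [hk0, false_and, Set.ofPred_false, measureReal_empty]
          positivity
    _ = _ := by
        simp only [Finset.sum_const, Finset.card_range, nsmul_eq_mul]
        push_cast
        ring

end Probability

/-! ### The conditional expectation is the mean over all choices -/

section CondExp

variable {Ω : Type*} [MeasurableSpace Ω] {μ : Measure Ω}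

lemma meanChange_of_choices_eq_empty {l : ℕ} {x : List Bool} (h : choices l x = ∅)
    (y : List Bool) : meanChange l x y = 0 := by
  simp [meanChange, h]

/-- On the event that the strings are `x` and `y`, the change of the longest common subsequence and
its mean over all choices have the same integral. -/
lemma IsUniformChoice.setIntegral_eq [IsProbabilityMeasure μ] {l : ℕ} {X Y : Ω → List Bool} {C : Ω → ℕ × ℕ}
    (hC : IsUniformChoice μ l X Y C) (x y : List Bool)
    (hA : MeasurableSet {ω | X ω = x ∧ Y ω = y}) :
    ∫ ω in {ω | X ω = x ∧ Y ω = y}, meanChange l (X ω) (Y ω) ∂μ =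
      ∫ ω in {ω | X ω = x ∧ Y ω = y},
        ((lcsLength (modifyString l (X ω) (C ω)) (Y ω) : ℝ) - (lcsLength (X ω) (Y ω) : ℝ)) ∂μ := by
  set A := {ω | X ω = x ∧ Y ω = y} with hAdef
  have hleft : ∫ ω in A, meanChange l (X ω) (Y ω) ∂μ = μ.real A * meanChange l x y := by
    rw [setIntegral_congr_fun hA (g := fun _ => meanChange l x y)]
    · rw [setIntegral_const, smul_eq_mul]
    · rintro ω ⟨rfl, rfl⟩
      rfl
  rw [hleft]
  rcases (choices l x).eq_empty_or_nonempty with hemp | hne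
  · rw [meanChange_of_choices_eq_empty hemp, mul_zero, setIntegral_congr_fun hA (g := fun _ => 0)]
    · simp
    · rintro ω ⟨rfl, rfl⟩
      simp [modifyString, hemp]
  have hcardpos : (0 : ℝ) < (choices l x).card := by exact_mod_cast hne.card_pos
  have hmeasC : ∀ c : ℕ × ℕ, MeasurableSet (A ∩ C ⁻¹' {c}) := fun c =>
    hA.inter (hC.measurable_choice (MeasurableSet.singleton c))
  have hlaw : ∀ c ∈ choices l x, μ (A ∩ C ⁻¹' {c}) = μ A / ((choices l x).card : ENNReal) := by
    intro c hc
    rw [← hC.law_choice x y c hc]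
    congr 1
    ext ω
    simp [hAdef, and_assoc]
  have hdisj : Set.Pairwise (choices l x : Set (ℕ × ℕ))
      (Function.onFun Disjoint fun c => A ∩ C ⁻¹' {c}) := by
    intro c _ c' _ hcc
    refine Set.disjoint_left.2 ?_
    rintro ω ⟨-, h1⟩ ⟨-, h2⟩
    exact hcc (h1.symm.trans h2)
  -- The admissible choices carry the whole mass of `A`, so other values of `C` form a null set
  -- there.
  have hunion : (⋃ c ∈ choices l x, A ∩ C ⁻¹' {c}) =ᵐ[μ] A := by
    apply ae_eq_of_subset_of_measure_ge
    · exact Set.iUnion₂_subset fun c _ => Set.inter_subset_left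
    · rw [measure_biUnion_finset hdisj fun c _ => hmeasC c, Finset.sum_congr rfl hlaw,
        Finset.sum_const, nsmul_eq_mul, ENNReal.mul_div_cancel]
      · exact_mod_cast hne.card_pos.ne'
      · exact ENNReal.natCast_ne_top _
    · exact (Finset.measurableSet_biUnion _ fun c _ => hmeasC c).nullMeasurableSet
    · exact measure_ne_top _ _
  have hconst : ∀ c, Set.EqOn
      (fun ω => (lcsLength (modifyString l (X ω) (C ω)) (Y ω) : ℝ) - (lcsLength (X ω) (Y ω) : ℝ))
      (fun _ => (lcsLength (modifyString l x c) y : ℝ) - (lcsLength x y : ℝ))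
      (A ∩ C ⁻¹' {c}) := by
    rintro c ω ⟨⟨rfl, rfl⟩, hc⟩
    rw [Set.mem_preimage, Set.mem_singleton_iff] at hc
    simp only [hc]
  rw [← setIntegral_congr_set hunion, integral_biUnion_finset _ (fun c _ => hmeasC c) hdisj]
  · rw [meanChange, mul_div_assoc', Finset.mul_sum, Finset.sum_div]
    refine Finset.sum_congr rfl fun c hc => ?_
    rw [setIntegral_congr_fun (hmeasC c) (hconst c), setIntegral_const, smul_eq_mul, Measure.real,
      Measure.real, hlaw c hc, ENNReal.toReal_div, ENNReal.toReal_natCast]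
    ring
  · intro c _
    exact (integrableOn_congr_fun (hconst c) (hmeasC c)).2 integrableOn_const

/-- The conditional expectation of the change of the longest common subsequence. -/
theorem IsUniformChoice.expectedChange_ae_eq [IsProbabilityMeasure μ] {l n : ℕ}
    {X Y : Ω → List Bool} {C : Ω → ℕ × ℕ}
    (hC : IsUniformChoice μ l X Y C) (hXY : Measurable[_, ⊤] fun ω => (X ω, Y ω))
    (hX : ∀ ω, (X ω).length ≤ n) (hY : ∀ ω, (Y ω).length ≤ n) :
    expectedChange μ l X Y C =ᵐ[μ] fun ω => meanChange l (X ω) (Y ω) := by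
  classical
  have hle : sigmaXY X Y ≤ ‹MeasurableSpace Ω› := hXY.comap_le
  have hatom : ∀ x y, MeasurableSet {ω | X ω = x ∧ Y ω = y} := fun x y => by
    have : {ω | X ω = x ∧ Y ω = y} = (fun ω => (X ω, Y ω)) ⁻¹' {(x, y)} := by
      ext ω
      simp
    rw [this]
    exact hXY (MeasurableSpace.measurableSet_top)
  set F : Ω → ℝ := fun ω => (lcsLength (modifyString l (X ω) (C ω)) (Y ω) : ℝ) -
    (lcsLength (X ω) (Y ω) : ℝ) with hF
  have hFmeas : Measurable F := by
    let _ : MeasurableSpace (List Bool × List Bool) := ⊤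
    have h1 : Measurable fun ω => ((X ω, Y ω), C ω) := Measurable.prodMk hXY hC.measurable_choice
    let Φ : (List Bool × List Bool) × (ℕ × ℕ) → ℝ := fun z =>
      (lcsLength (modifyString l z.1.1 z.2) z.1.2 : ℝ) - (lcsLength z.1.1 z.1.2 : ℝ)
    have h2 : Measurable Φ := Measurable.of_discrete
    have h3 : F = Φ ∘ fun ω => ((X ω, Y ω), C ω) := rfl
    rw [h3]
    exact h2.comp h1
  have hFint : Integrable F μ := by
    refine Integrable.of_bound hFmeas.aestronglyMeasurable (n : ℝ) (ae_of_all _ fun ω => ?_)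
    have h1 : (lcsLength (modifyString l (X ω) (C ω)) (Y ω) : ℝ) ≤ n := by
      exact_mod_cast (lcsLength_le_length _ _).trans (hY ω)
    have h2 : (lcsLength (X ω) (Y ω) : ℝ) ≤ n := by
      exact_mod_cast (lcsLength_le_length _ _).trans (hY ω)
    have h3 : (0 : ℝ) ≤ lcsLength (modifyString l (X ω) (C ω)) (Y ω) := Nat.cast_nonneg _
    have h4 : (0 : ℝ) ≤ lcsLength (X ω) (Y ω) := Nat.cast_nonneg _
    rw [Real.norm_eq_abs, abs_le]
    constructor <;> simp only [hF] <;> linarith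
  have hGmeas : Measurable[sigmaXY X Y] fun ω => meanChange l (X ω) (Y ω) := by
    let _ : MeasurableSpace (List Bool × List Bool) := ⊤
    let G : List Bool × List Bool → ℝ := fun z => meanChange l z.1 z.2
    have h1 : Measurable G := measurable_from_top
    have h2 : Measurable[sigmaXY X Y] fun ω => (X ω, Y ω) := comap_measurable _
    have h3 : (fun ω => meanChange l (X ω) (Y ω)) = G ∘ fun ω => (X ω, Y ω) := rfl
    rw [h3]
    exact h1.comp h2
  -- Only finitely many pairs of strings occur, so every event generated by them is a finite
  -- disjoint union of atoms, and it suffices to compare integrals over atoms.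
  have hfin : {z : List Bool × List Bool | z.1.length ≤ n ∧ z.2.length ≤ n}.Finite :=
    (List.finite_length_le Bool n).prod (List.finite_length_le Bool n)
  set V := hfin.toFinset with hV
  have hVmem : ∀ ω, (X ω, Y ω) ∈ V := fun ω => by
    rw [hV, Set.Finite.mem_toFinset]
    exact ⟨hX ω, hY ω⟩
  clear_value V
  have hGint : Integrable (fun ω => meanChange l (X ω) (Y ω)) μ := by
    refine Integrable.of_bound (hGmeas.mono hle le_rfl).aestronglyMeasurable
      (∑ z ∈ V, |meanChange l z.1 z.2|) (ae_of_all _ fun ω => ?_)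
    rw [Real.norm_eq_abs]
    have h := Finset.single_le_sum (f := fun z : List Bool × List Bool => |meanChange l z.1 z.2|)
      (fun _ _ => abs_nonneg _) (hVmem ω)
    simpa only using h
  refine (ae_eq_condExp_of_forall_setIntegral_eq hle hFint (fun s _ _ => hGint.integrableOn) ?_
    hGmeas.stronglyMeasurable.aestronglyMeasurable).symm
  rintro s ⟨T, -, rfl⟩ -
  have hunion : (fun ω => (X ω, Y ω)) ⁻¹' T =
      ⋃ z ∈ V.filter (· ∈ T), {ω | X ω = z.1 ∧ Y ω = z.2} := by
    ext ω
    simp only [Set.mem_preimage, Set.mem_iUnion, Finset.mem_filter]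
    constructor
    · intro h
      exact ⟨(X ω, Y ω), ⟨hVmem ω, h⟩, rfl, rfl⟩
    · rintro ⟨z, ⟨-, hz⟩, h1, h2⟩
      rwa [h1, h2]
  have hdisj : Set.Pairwise (V.filter (· ∈ T) : Set (List Bool × List Bool))
      (Function.onFun Disjoint fun z => {ω | X ω = z.1 ∧ Y ω = z.2}) := by
    intro z _ z' _ hzz
    refine Set.disjoint_left.2 ?_
    rintro ω ⟨h1, h2⟩ ⟨h3, h4⟩
    exact hzz (Prod.ext (h1.symm.trans h3) (h2.symm.trans h4))
  rw [hunion, integral_biUnion_finset _ (fun z _ => hatom z.1 z.2) hdisj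
      (fun z _ => hGint.integrableOn),
    integral_biUnion_finset _ (fun z _ => hatom z.1 z.2) hdisj (fun z _ => hFint.integrableOn)]
  exact Finset.sum_congr rfl fun z _ => hC.setIntegral_eq z.1 z.2 (hatom z.1 z.2)

/-! ### Measurability of the strings -/

lemma length_blockString_le (s : Bool) (B : ℕ → ℕ) (n : ℕ) : (blockString s B n).length ≤ n := by
  simp [blockString]

/-- The strings depend only on the first letters and on the first `n` lengths. These take values in
a countable discrete space, on which every function is measurable. -/
lemma IsBlockModel.measurable_strings {l : ℕ} {sX sY : Ω → Bool} {BX BY : ℕ → Ω → ℕ}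
    (hB : IsBlockModel μ l sX sY BX BY) (n : ℕ) :
    Measurable[_, ⊤] fun ω =>
      (blockString (sX ω) (fun i => BX i ω) n, blockString (sY ω) (fun i => BY i ω) n) := by
  let _ : MeasurableSpace (List Bool × List Bool) := ⊤
  let φ : (Bool × (Fin n → ℕ)) × (Bool × (Fin n → ℕ)) → List Bool × List Bool := fun z =>
    (blockString z.1.1 (fun i => if h : i < n then z.1.2 ⟨i, h⟩ else 0) n,
      blockString z.2.1 (fun i => if h : i < n then z.2.2 ⟨i, h⟩ else 0) n)
  have hφ : Measurable φ := Measurable.of_discrete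
  have hcongr : ∀ (s : Bool) (B : ℕ → ℕ),
      blockString s B n = blockString s (fun i => if i < n then B i else 0) n := by
    intro s B
    unfold blockString
    congr 1
    apply List.flatMap_congr
    intro i hi
    simp only [if_pos (List.mem_range.1 hi)]
  have hin : Measurable fun ω => ((sX ω, fun i : Fin n => BX i ω), (sY ω, fun i : Fin n => BY i ω)) :=
    (hB.measurable_sX.prodMk (measurable_pi_lambda _ fun i : Fin n => hB.measurable_BX i)).prodMk
      (hB.measurable_sY.prodMk (measurable_pi_lambda _ fun i : Fin n => hB.measurable_BY i))
  have heq : (fun ω =>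
      (blockString (sX ω) (fun i => BX i ω) n, blockString (sY ω) (fun i => BY i ω) n)) =
      φ ∘ fun ω => ((sX ω, fun i : Fin n => BX i ω), (sY ω, fun i : Fin n => BY i ω)) := by
    funext ω
    simp only [φ, Function.comp]
    rw [hcongr (sX ω), hcongr (sY ω)]
    simp
  rw [heq]
  exact hφ.comp hin

end CondExp

/-! ### The bound for typical strings -/

/-- Each short block falls one letter below `l` and each long one exceeds it by one. As the two
kinds are almost equally frequent in typical strings, the number of blocks is close to `n / l`. -/
lemma sum_add_card_short {l k : ℕ} (hl : 2 ≤ l) {B : ℕ → ℕ} (hB : ∀ i, ∃ x, B i = lengthOf l x) :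
    ∑ i ∈ Finset.range k, B i + (blocksOfLength B k (l - 1)).card =
      k * l + (blocksOfLength B k (l + 1)).card := by
  unfold blocksOfLength
  rw [Finset.card_filter, Finset.card_filter, ← Finset.sum_add_distrib]
  have : k * l = ∑ _i ∈ Finset.range k, l := by simp
  rw [this, ← Finset.sum_add_distrib]
  refine Finset.sum_congr rfl fun i _ => ?_
  obtain ⟨x, hx⟩ := hB i
  rw [hx]
  unfold lengthOf
  have hx3 := x.2
  split_ifs <;> omega

lemma card_blocksOfLength_succ {k v : ℕ} {f B : ℕ → ℕ} (h : ∀ i < k, f i = B i) :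
    (blocksOfLength B k v).card ≤ (blocksOfLength f (k + 1) v).card ∧
      (blocksOfLength f (k + 1) v).card ≤ (blocksOfLength B k v).card + 1 := by
  have hcongr : (Finset.range k).filter (fun i => f i = v) =
      (Finset.range k).filter fun i => B i = v :=
    Finset.filter_congr fun i hi => by rw [h i (Finset.mem_range.1 hi)]
  unfold blocksOfLength
  rw [Finset.range_add_one, Finset.filter_insert, hcongr]
  split_ifs
  · rw [Finset.card_insert_of_notMem (by simp)]
    omega
  · omega

lemma pairCount_congr {k k' : ℕ} {R R' : Finset ℕ} {f g B B' : ℕ → ℕ} (hf : ∀ i < k, f i = B i)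
    (hg : ∀ i < k', g i = B' i) (x y : ℕ) :
    pairCount (innerPairs k k' R R') f g x y = pairCount (innerPairs k k' R R') B B' x y := by
  unfold pairCount
  congr 1
  refine Finset.filter_congr fun e he => ?_
  have := (Finset.mem_filter.1 he).2
  rw [hf _ this.1, hg _ this.2]

/-- The block lengths are uniformly close to being equidistributed. -/
def IsTypical (l n : ℕ) (θ : ℝ) (B : ℕ → ℕ) : Prop :=
  (∀ i, ∃ x, B i = lengthOf l x) ∧
  (∀ k ≤ n, |((blocksOfLength B k (l - 1)).card : ℝ) - (k : ℝ) / 3| ≤ θ * n) ∧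
  ∀ k ≤ n, |((blocksOfLength B k (l + 1)).card : ℝ) - (k : ℝ) / 3| ≤ θ * n

lemma IsTypical.pos {l n : ℕ} {θ : ℝ} {B : ℕ → ℕ} (h : IsTypical l n θ B) (hl : 2 ≤ l) (i : ℕ) :
    0 < B i := by
  obtain ⟨x, hx⟩ := h.1 i
  rw [hx, lengthOf]
  omega

/-- The deviations of the short and the long count cost `θ n` each. The last block changes the
counts by at most 1 and the total length by at most `l + 1`. -/
lemma IsTypical.exists_blockList {l n : ℕ} {θ : ℝ} {B : ℕ → ℕ} (h : IsTypical l n θ B)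
    (hl : 2 ≤ l) (hθn : 2 * (l : ℝ) + 2 ≤ θ * n) (s : Bool) :
    ∃ k f, k < n ∧ (∀ i < k, f i = B i) ∧ IsBlockLengths l k f ∧
      blockString s B n = (blockList s f (k + 1)).flatten ∧
      |((k + 1 : ℕ) : ℝ) * l - n| ≤ 2 * (θ * n) + l + 1 ∧
      |((blocksOfLength f (k + 1) (l - 1)).card : ℝ) - ((k + 1 : ℕ) : ℝ) / 3| ≤ 2 * (θ * n) ∧
      |((blocksOfLength f (k + 1) (l + 1)).card : ℝ) - ((k + 1 : ℕ) : ℝ) / 3| ≤ 2 * (θ * n) := by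
  have hl0 : (2 : ℝ) ≤ l := by exact_mod_cast hl
  have hn : 0 < n := by
    rcases Nat.eq_zero_or_pos n with rfl | hn
    · norm_num at hθn
      linarith
    · exact hn
  obtain ⟨k, f, hk, hfB, hpos, hle, hsum, hstr⟩ := blockString_eq_flatten_blockList s B (h.pos hl) hn
  have hlen : ∀ i, B i = l - 1 ∨ B i = l ∨ B i = l + 1 := by
    intro i
    obtain ⟨x, hx⟩ := h.1 i
    rw [hx, lengthOf]
    have := x.2
    omega
  have hBk := hlen k
  have hsumB := sum_add_card_short (k := k) hl h.1
  have hsumf : ∑ i ∈ Finset.range (k + 1), f i = ∑ i ∈ Finset.range k, B i + f k := by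
    rw [Finset.sum_range_succ, Finset.sum_congr rfl fun i hi => hfB i (Finset.mem_range.1 hi)]
  have h1 := h.2.1 k hk.le
  have h2 := h.2.2 k hk.le
  rw [abs_le] at h1 h2
  have hfk : (f k : ℝ) ≤ l + 1 := by
    have : f k ≤ l + 1 := by omega
    exact_mod_cast this
  have hfk0 : (0 : ℝ) ≤ f k := Nat.cast_nonneg _
  have hsumB' : ((∑ i ∈ Finset.range k, B i : ℕ) : ℝ) + (blocksOfLength B k (l - 1)).card =
      k * l + (blocksOfLength B k (l + 1)).card := by exact_mod_cast hsumB
  have hn' : (n : ℝ) = ((∑ i ∈ Finset.range k, B i : ℕ) : ℝ) + f k := by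
    rw [← hsum, hsumf]
    push_cast
    rfl
  have hcard : ∀ v, ((blocksOfLength B k v).card : ℝ) ≤ (blocksOfLength f (k + 1) v).card ∧
      ((blocksOfLength f (k + 1) v).card : ℝ) ≤ (blocksOfLength B k v).card + 1 := fun v => by
    exact_mod_cast card_blocksOfLength_succ (v := v) hfB
  refine ⟨k, f, hk, hfB, ⟨fun i hi => hfB i hi ▸ hlen i, hpos, by omega⟩, hstr, ?_, ?_, ?_⟩
  · push_cast
    rw [abs_le]
    constructor <;> linarith
  · have := hcard (l - 1)
    push_cast
    rw [abs_le]
    constructor <;> linarith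
  · have := hcard (l + 1)
    push_cast
    rw [abs_le]
    constructor <;> linarith

/-- For typical block lengths that satisfy the entropy constraint, the mean change is large if the
optimal alignments leave out few blocks. -/
theorem le_meanChange_of_isTypical {l n : ℕ} (hl : 2 ≤ l) {q₀ ε δ η θ : ℝ} (hq₀ : q₀ < 1 / 24)
    (hη : 0 < η) (hη1 : η ≤ 1 / 144) (hη2 : η ≤ ε / 24) (hη3 : 8 * η ≤ δ)
    (hobj : ∀ z ∈ weaklyFeasible q₀,
      -δ ≤ 2 * entropyTwo z.2 + (1 - 4 * z.2) * (Real.log (1 / 9) + entropy z.1) →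
      3 / 2 * ε ≤ objective z.1 z.2)
    (hθ : θ = η / (10 * l)) (hθn : 2 * (l : ℝ) + 2 ≤ θ * n) {B B' : ℕ → ℕ}
    (hB : IsTypical l n θ B) (hB' : IsTypical l n θ B')
    (hent : ∀ k < n, ∀ k' < n, ∀ R ⊆ Finset.range (k + 1), ∀ R' ⊆ Finset.range (k' + 1),
      -(θ * n) ≤ leftOutEntropy (k + 1) R + leftOutEntropy (k' + 1) R' +
        pairEntropy l (innerPairs k k' R R') B B') {s t : Bool}
    (hq : LeavesOutAtMost (blockString s B n) (blockString t B' n) q₀) :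
    ε ≤ meanChange l (blockString s B n) (blockString t B' n) := by
  obtain ⟨k, f, hk, hfB, hf, hx, hK, hS, hL⟩ := hB.exists_blockList hl hθn s
  obtain ⟨k', g, hk', hgB, hg, hy, hK', -, -⟩ := hB'.exists_blockList hl hθn t
  rw [hx, hy] at hq ⊢
  obtain ⟨R, hR, R', hR', inc, dec, hq1, hq2, hsum, h1, h2, h3, h4, h5, h6⟩ :=
    exists_counts hl hf hg hq
  have hl0 : (2 : ℝ) ≤ l := by exact_mod_cast hl
  have hθl : θ * (10 * l) = η := by
    rw [hθ]
    field_simp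
  have hθ0 : 0 < θ := by rw [hθ]; positivity
  have hn0 : (0 : ℝ) ≤ n := Nat.cast_nonneg n
  have hKpos : (0 : ℝ) < ((k + 1 : ℕ) : ℝ) := by positivity
  have hKpos' : (0 : ℝ) < ((k' + 1 : ℕ) : ℝ) := by positivity
  have hent' := hent k hk k' hk' R hR R' hR'
  set K : ℝ := ((k + 1 : ℕ) : ℝ) with hKdef
  set K' : ℝ := ((k' + 1 : ℕ) : ℝ) with hKdef'
  have hθsmall : θ * n ≤ n / 12 := by
    have : θ ≤ 1 / 12 := by nlinarith
    calc θ * n ≤ 1 / 12 * n := by gcongr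
      _ = n / 12 := by ring
  rw [abs_le] at hK hK'
  have hnK : (n : ℝ) ≤ 2 * (K * l) := by linarith
  -- The string has at least `n / (2 l)` blocks; this explains the factor `10 l` in `θ`.
  have hθK : 5 * (θ * n) ≤ η * K := by
    calc 5 * (θ * n) ≤ 5 * (θ * (2 * (K * l))) := by gcongr
      _ = θ * (10 * l) * K := by ring
      _ = η * K := by rw [hθl]
  have hKK : |K' - K| ≤ η * K := by
    have hlow : 2 * |K' - K| ≤ |(K' - K) * l| := by
      rw [abs_mul, abs_of_nonneg (by linarith : (0 : ℝ) ≤ l), mul_comm]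
      gcongr
    have hup : |(K' - K) * l| ≤ 5 * (θ * n) := by
      rw [abs_le]
      constructor <;> linarith
    linarith [abs_nonneg (K' - K)]
  -- Inner pairs avoid the last blocks, so their types are those of the original independent
  -- lengths.
  have hc : ∀ x y, pairCount (innerPairs k k' R R') f g x y =
      pairCount (innerPairs k k' R R') B B' x y := pairCount_congr hfB hgB
  simp only [hc] at h1 h2 h3 h4 h5
  set M := innerPairs k k' R R' with hM
  have e0 : lengthOf l 0 = l - 1 := by simp [lengthOf]
  have e1 : lengthOf l 1 = l := by simp [lengthOf]; omega
  have e2 : lengthOf l 2 = l + 1 := by simp [lengthOf]; omega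
  have hall : ∀ e ∈ M, ∃ i j, B e.1 = lengthOf l i ∧ B' e.2 = lengthOf l j := fun e _ => by
    obtain ⟨i, hi⟩ := hB.1 e.1
    obtain ⟨j, hj⟩ := hB'.1 e.2
    exact ⟨i, j, hi, hj⟩
  have hcsum := sum_pairCount_eq_card l hall
  have hNk : M.card ≤ k := card_innerPairs_le k k' R R'
  obtain ⟨hSpos, hLpos, hfinal⟩ := le_div_sub_div (K := K) (K' := K')
    (a := (Finset.range (k + 1) \ R).card) (b := (Finset.range (k' + 1) \ R').card)
    (S := (blocksOfLength f (k + 1) (l - 1)).card) (L := (blocksOfLength f (k + 1) (l + 1)).card)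
    (N := M.card) (inc := inc) (dec := dec)
    (c := fun i j => (pairCount M B B' (lengthOf l i) (lengthOf l j) : ℝ))
    hq₀ hη hη1 hη2 hη3 hobj hKpos hKpos' (Nat.cast_nonneg _) (Nat.cast_nonneg _)
    (fun _ _ => Nat.cast_nonneg _) (by exact_mod_cast hcsum)
    (by rw [hKdef]; exact_mod_cast hNk.trans (Nat.le_succ k)) hq1 hq2 hKK (by linarith)
    (hS.trans (by linarith)) (hL.trans (by linarith))
    (by
      unfold leftOutEntropy pairEntropy at hent'
      linarith)
    (by rw [e0]; exact_mod_cast h1)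
    (by rw [e0, e1, e2]; exact_mod_cast h2)
    (by rw [e2]; exact_mod_cast h3)
    (by rw [e0, e1, e2]; exact_mod_cast h4)
    (by rw [e0, e1, e2]; exact_mod_cast h5 (l - 1))
    (by rw [e0, e1, e2]; exact_mod_cast h5 (l + 1))
    (by rw [hKdef]; exact_mod_cast h6)
  refine hfinal.trans ?_
  rw [meanChange, choices_flatten_blockList l s (hf.pos_of_lt hl), Finset.card_product,
    ← choices_flatten_blockList l s (hf.pos_of_lt hl), Nat.cast_mul, le_div_iff₀ (by positivity)]
  refine le_trans (le_of_eq ?_) hsum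
  field_simp

/-! ### Typical block lengths have high probability -/

section Probability

variable {Ω : Type*} [MeasurableSpace Ω] {μ : Measure Ω} [IsProbabilityMeasure μ]

/-- The three prescribed values already have total probability 1. -/
lemma ae_forall_exists_lengthOf {l : ℕ} (hl : 2 ≤ l) {B : ℕ → Ω → ℕ}
    (hmeas : ∀ i, Measurable (B i))
    (hlaw : ∀ i, ∀ k ∈ ({l - 1, l, l + 1} : Finset ℕ), μ {ω | B i ω = k} = 1 / 3) :
    ∀ᵐ ω ∂μ, ∀ i, ∃ x, B i ω = lengthOf l x := by
  rw [ae_all_iff]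
  intro i
  have hm : ∀ x : Fin 3, MeasurableSet {ω | B i ω = lengthOf l x} := fun x =>
    hmeas i (MeasurableSet.singleton _)
  have hset : {ω | ∃ x, B i ω = lengthOf l x} = ⋃ x : Fin 3, {ω | B i ω = lengthOf l x} := by
    ext ω
    simp
  have hmeasure : μ {ω | ∃ x, B i ω = lengthOf l x} = 1 := by
    rw [hset, measure_iUnion _ hm, tsum_fintype, Finset.sum_congr rfl fun x _ =>
      hlaw i _ (lengthOf_mem hl x), Finset.sum_const, Finset.card_univ, Fintype.card_fin,
      nsmul_eq_mul]
    · rw [one_div]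
      exact ENNReal.mul_inv_cancel (by norm_num) (by norm_num)
    · intro x y hxy
      refine Set.disjoint_left.2 fun ω h1 h2 => hxy (lengthOf_injective l (h1.symm.trans h2))
  exact (mem_ae_iff_prob_eq_one (hset ▸ MeasurableSet.iUnion hm)).2 hmeasure

end Probability

/-- The left side decays like a polynomial times `exp (-c n)`. Half of the rate absorbs the
polynomial, and the other half dominates the square root. -/
lemma eventually_error_le {θ : ℝ} (hθ : 0 < θ) : ∀ᶠ n : ℕ in atTop,
    ((n : ℝ) + 1) ^ 13 * Real.exp (-(θ * n)) +
      4 * (((n : ℝ) + 1) * (2 * Real.exp (-(2 * θ ^ 2 * n)))) ≤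
      Real.exp (-((n : ℝ) ^ (1 / 2 : ℝ))) := by
  set c := min θ (2 * θ ^ 2) with hc
  have hcpos : 0 < c := lt_min hθ (by positivity)
  have hlit := (isLittleO_pow_exp_pos_mul_atTop 13 (half_pos hcpos)).bound
    (show (0 : ℝ) < 1 / (9 * Real.exp (c / 2)) by positivity)
  have hcast : Tendsto (fun n : ℕ => (n : ℝ) + 1) atTop atTop :=
    tendsto_natCast_atTop_atTop.atTop_add tendsto_const_nhds
  filter_upwards [hcast.eventually hlit, tendsto_natCast_atTop_atTop.eventually_ge_atTop
    (4 / c ^ 2)] with n hn hn2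
  have hn0 : (0 : ℝ) ≤ n := Nat.cast_nonneg n
  rw [Real.norm_of_nonneg (by positivity), Real.norm_of_nonneg (Real.exp_pos _).le] at hn
  have hpow : ((n : ℝ) + 1) ^ 13 ≤ 1 / 9 * Real.exp (c / 2 * n) := by
    refine hn.trans (le_of_eq ?_)
    rw [mul_add, mul_one, Real.exp_add]
    field_simp
  have hsqrt : (n : ℝ) ^ (1 / 2 : ℝ) ≤ c / 2 * n := by
    rw [← Real.sqrt_eq_rpow, Real.sqrt_le_left (by positivity)]
    have : 4 ≤ n * c ^ 2 := (div_le_iff₀ (by positivity)).1 hn2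
    nlinarith
  have h1 : Real.exp (-(θ * n)) ≤ Real.exp (-(c * n)) := by
    have : c * n ≤ θ * n := by gcongr; exact min_le_left _ _
    exact Real.exp_le_exp.2 (by linarith)
  have h2 : Real.exp (-(2 * θ ^ 2 * n)) ≤ Real.exp (-(c * n)) := by
    have : c * n ≤ 2 * θ ^ 2 * n := by gcongr; exact min_le_right _ _
    exact Real.exp_le_exp.2 (by linarith)
  have h3 : (n : ℝ) + 1 ≤ ((n : ℝ) + 1) ^ 13 := le_self_pow₀ (by linarith) (by norm_num)
  calc _ ≤ ((n : ℝ) + 1) ^ 13 * Real.exp (-(c * n)) +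
        4 * (((n : ℝ) + 1) ^ 13 * (2 * Real.exp (-(c * n)))) := by gcongr
    _ = 9 * (((n : ℝ) + 1) ^ 13 * Real.exp (-(c * n))) := by ring
    _ ≤ 9 * ((1 / 9 * Real.exp (c / 2 * n)) * Real.exp (-(c * n))) := by gcongr
    _ = Real.exp (-(c / 2 * n)) := by
        rw [mul_assoc, ← Real.exp_add]
        ring_nf
    _ ≤ _ := Real.exp_le_exp.2 (by linarith)

end BlockLCS

/-! ### The union bound over the exceptional events -/

theorem theorem3 {Ω : Type*} [MeasurableSpace Ω] (μ : Measure Ω) [IsProbabilityMeasure μ]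
    (l : ℕ) (hl : 2 ≤ l)
    (sX sY : Ω → Bool) (BX BY : ℕ → Ω → ℕ) (hB : IsBlockModel μ l sX sY BX BY)
    (X Y : ℕ → Ω → List Bool)
    (hX : ∀ n ω, X n ω = blockString (sX ω) (fun i => BX i ω) n)
    (hY : ∀ n ω, Y n ω = blockString (sY ω) (fun i => BY i ω) n)
    (C : ℕ → Ω → ℕ × ℕ) (hC : ∀ n, IsUniformChoice μ l (X n) (Y n) (C n))
    (q₀ : ℝ) (hq₀ : q₀ ∈ Set.Ico (0 : ℝ) (1 / 3))
    (ε : ℝ) (hε : 0 < ε) (hmin : IsLeast (feasibleValues q₀) (2 * ε)) :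
    ∃ β : ℝ, 0 < β ∧ ∀ᶠ n : ℕ in atTop,
      1 - Real.exp (-((n : ℝ) ^ β)) - μ.real {ω | LeavesOutAtMost (X n ω) (Y n ω) q₀}ᶜ ≤
        μ.real {ω | ε ≤ expectedChange μ l (X n) (Y n) (C n) ω} := by
  have hq24 := lt_of_isLeast hq₀ hε hmin
  obtain ⟨δ, hδ, hobj⟩ := exists_objective_ge hq₀ hε hmin
  obtain ⟨η, hη, hη1, hη2, hη3⟩ :
      ∃ η : ℝ, 0 < η ∧ η ≤ 1 / 144 ∧ η ≤ ε / 24 ∧ 8 * η ≤ δ := by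
    refine ⟨min (1 / 144) (min (ε / 24) (δ / 8)), by positivity, min_le_left _ _,
      (min_le_right _ _).trans (min_le_left _ _), ?_⟩
    have : min (1 / 144) (min (ε / 24) (δ / 8)) ≤ δ / 8 :=
      (min_le_right _ _).trans (min_le_right _ _)
    linarith
  obtain ⟨θ, hθ⟩ : ∃ θ : ℝ, θ = η / (10 * l) := ⟨_, rfl⟩
  have hθ0 : 0 < θ := by rw [hθ]; positivity
  obtain rfl : X = fun n ω => blockString (sX ω) (fun i => BX i ω) n :=
    funext fun n => funext fun ω => hX n ω
  obtain rfl : Y = fun n ω => blockString (sY ω) (fun i => BY i ω) n :=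
    funext fun n => funext fun ω => hY n ω
  -- The error is exponentially small in `n`, so the exponent `1/2` leaves ample room.
  refine ⟨1 / 2, by norm_num, ?_⟩
  have hlarge : ∀ᶠ n : ℕ in atTop, 2 * (l : ℝ) + 2 ≤ θ * n :=
    (tendsto_natCast_atTop_atTop.const_mul_atTop hθ0).eventually_ge_atTop _
  filter_upwards [eventually_error_le hθ0, hlarge] with n herr hθn
  have hnull := (ae_forall_exists_lengthOf hl hB.measurable_BX hB.law_BX).and
    ((ae_forall_exists_lengthOf hl hB.measurable_BY hB.law_BY).and
      ((hC n).expectedChange_ae_eq (hB.measurable_strings n)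
        (fun ω => length_blockString_le _ _ n) fun ω => length_blockString_le _ _ n))
  rw [Filter.Eventually, mem_ae_iff] at hnull
  have hindX : iIndepFun BX μ := hB.indep_lengths.precomp (g := Sum.inl) Sum.inl_injective
  have hindY : iIndepFun BY μ := hB.indep_lengths.precomp (g := Sum.inr) Sum.inr_injective
  have hconc : ∀ v ∈ ({l - 1, l, l + 1} : Finset ℕ),
      μ.real {ω | ∃ k ≤ n,
        θ * n < |((blocksOfLength (fun i => BX i ω) k v).card : ℝ) - (k : ℝ) / 3|} ≤
          (n + 1) * (2 * Real.exp (-(2 * θ ^ 2 * n))) ∧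
      μ.real {ω | ∃ k ≤ n,
        θ * n < |((blocksOfLength (fun i => BY i ω) k v).card : ℝ) - (k : ℝ) / 3|} ≤
          (n + 1) * (2 * Real.exp (-(2 * θ ^ 2 * n))) := fun v hv =>
    ⟨measure_abs_card_sub_le hB.measurable_BX hindX (fun i => hB.law_BX i v hv) hθ0 n,
      measure_abs_card_sub_le hB.measurable_BY hindY (fun i => hB.law_BY i v hv) hθ0 n⟩
  obtain ⟨hXs, hYs⟩ := hconc (l - 1) (by simp)
  obtain ⟨hXl, hYl⟩ := hconc (l + 1) (by simp)
  have hent := hB.measure_entropy_lt_le hl n (-(θ * n))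
  set N := {ω | (∀ i, ∃ x, BX i ω = lengthOf l x) ∧ (∀ i, ∃ x, BY i ω = lengthOf l x) ∧
    expectedChange μ l (fun ω => blockString (sX ω) (fun i => BX i ω) n)
      (fun ω => blockString (sY ω) (fun i => BY i ω) n) (C n) ω =
      meanChange l (blockString (sX ω) (fun i => BX i ω) n)
        (blockString (sY ω) (fun i => BY i ω) n)}ᶜ
  have hN : μ.real N = 0 := by rw [Measure.real, hnull, ENNReal.toReal_zero]
  set G := {ω | ε ≤ expectedChange μ l (fun ω => blockString (sX ω) (fun i => BX i ω) n)
    (fun ω => blockString (sY ω) (fun i => BY i ω) n) (C n) ω} with hG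
  set F := {ω | LeavesOutAtMost (blockString (sX ω) (fun i => BX i ω) n)
    (blockString (sY ω) (fun i => BY i ω) n) q₀}ᶜ
  set E := {ω | (∀ i, ∃ x, BX i ω = lengthOf l x) ∧ (∀ i, ∃ x, BY i ω = lengthOf l x) ∧
    ∃ k < n, ∃ k' < n, ∃ R ⊆ Finset.range (k + 1), ∃ R' ⊆ Finset.range (k' + 1),
      leftOutEntropy (k + 1) R + leftOutEntropy (k' + 1) R' +
        pairEntropy l (innerPairs k k' R R') (fun i => BX i ω) (fun i => BY i ω) < -(θ * n)}
  set S₁ := {ω | ∃ k ≤ n,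
    θ * n < |((blocksOfLength (fun i => BX i ω) k (l - 1)).card : ℝ) - (k : ℝ) / 3|}
  set S₂ := {ω | ∃ k ≤ n,
    θ * n < |((blocksOfLength (fun i => BX i ω) k (l + 1)).card : ℝ) - (k : ℝ) / 3|}
  set S₃ := {ω | ∃ k ≤ n,
    θ * n < |((blocksOfLength (fun i => BY i ω) k (l - 1)).card : ℝ) - (k : ℝ) / 3|}
  set S₄ := {ω | ∃ k ≤ n,
    θ * n < |((blocksOfLength (fun i => BY i ω) k (l + 1)).card : ℝ) - (k : ℝ) / 3|}
  -- Outside the exceptional events the deterministic bound applies. Only monotonicity and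
  -- subadditivity of the measure are needed, so measurability of these events plays no role.
  have hcover : Set.univ ⊆ G ∪ (F ∪ (N ∪ (E ∪ (S₁ ∪ (S₂ ∪ (S₃ ∪ S₄)))))) := by
    intro ω _
    by_contra h
    simp only [Set.mem_union, not_or] at h
    obtain ⟨hGω, hFω, hNω, hEω, h₁, h₂, h₃, h₄⟩ := h
    obtain ⟨hlX, hlY, heq⟩ := not_not.1 hNω
    refine hGω ?_
    rw [hG, Set.mem_ofPred_eq, heq]
    refine le_meanChange_of_isTypical hl hq24 hη hη1 hη2 hη3 hobj hθ hθn
      ⟨hlX, fun k hk => not_lt.1 fun h => h₁ ⟨k, hk, h⟩, fun k hk => not_lt.1 fun h => h₂ ⟨k, hk, h⟩⟩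
      ⟨hlY, fun k hk => not_lt.1 fun h => h₃ ⟨k, hk, h⟩, fun k hk => not_lt.1 fun h => h₄ ⟨k, hk, h⟩⟩
      (fun k hk k' hk' R hR R' hR' => not_lt.1 fun h =>
        hEω ⟨hlX, hlY, k, hk, k', hk', R, hR, R', hR', h⟩) (not_not.1 hFω)
  have hone : μ.real Set.univ = 1 := by simp
  have hle := measureReal_mono (μ := μ) hcover
  have u₁ := measureReal_union_le (μ := μ) G (F ∪ (N ∪ (E ∪ (S₁ ∪ (S₂ ∪ (S₃ ∪ S₄))))))
  have u₂ := measureReal_union_le (μ := μ) F (N ∪ (E ∪ (S₁ ∪ (S₂ ∪ (S₃ ∪ S₄)))))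
  have u₃ := measureReal_union_le (μ := μ) N (E ∪ (S₁ ∪ (S₂ ∪ (S₃ ∪ S₄))))
  have u₄ := measureReal_union_le (μ := μ) E (S₁ ∪ (S₂ ∪ (S₃ ∪ S₄)))
  have u₅ := measureReal_union_le (μ := μ) S₁ (S₂ ∪ (S₃ ∪ S₄))
  have u₆ := measureReal_union_le (μ := μ) S₂ (S₃ ∪ S₄)
  have u₇ := measureReal_union_le (μ := μ) S₃ S₄
  linarith
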